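/- Let $n\in\mathbb N$, $T>0$, let $S\subset[0,T]\times\mathbb R^n$ be compact, and let $d_S(t,x)=\inf_{(s,y)\in S}|(t,x)-(s,y)|$ be the Euclidean distance to $S$ in $\mathbb R^{1+n}$. Here $\nabla$ and $\operatorname{div}$ act in the space variable $x$ only. Let $b\colon[0,T]\times\mathbb R^n\to\mathbb R^n$ satisfy (i) $b\in L^1_{\rm loc}((0,T)\times\mathbb R^n)$; (ii) $\operatorname{div} b\in L^1(0,T;L^\infty(\mathbb R^n))$, where the divergence is distributional; (iii) $\dfrac{b}{1+|x|}\in L^1((0,T)\times\mathbb R^n)+L^1(0,T;L^\infty(\mathbb R^n))$; (iv) for every open $\Omega\subset\subset S^c$ (that is, $\overline\Omega$ is a compact subset of $((-\infty,T)\times\mathbb R^n)\setminus S$) the field $b$, extended by $b(t,\cdot)\equiv0$ for $t<0$, has the local renormalization property on $\Omega$: if $u\in L^\infty_{\rm loc}((-\infty,T)\times\mathbb R^n)$ satisfies $\iint_{(-\infty,T)\times\mathbb R^n}u\,(\partial_t\phi+b\cdot\nabla\phi+\operatorname{div} b\,\phi)\,dx\,dt=0$ for all $\phi\in C_c^\infty((-\infty,T)\times\mathbb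 R^n)$, then $\iint_\Omega\beta(u)(\partial_t\phi+b\cdot\nabla\phi+\operatorname{div} b\,\phi)\,dx\,dt=0$ for all $\beta\in C^1(\mathbb R)$ and all $\phi\in C_c^\infty(\Omega)$; (v) for some $p,q,p^*,q^*\in[1,\infty]$ with $\frac1p+\frac1{p^*}=\frac1q+\frac1{q^*}=1$, $$b\cdot\nabla d_S\in L^p(0,T;L^q_{\rm loc}(\mathbb R^n))\quad\text{and}\quad d_S^{-1}\in L^{p^*}(0,T;L^{q^*}_{\rm loc}(\mathbb R^n)),\qquad\text{where } d_S^{-1}=\infty \text{ on } S.$$ For $u_0\in L^\infty_{\rm loc}(\mathbb R^n)$, a function $u\in L^\infty_{\rm loc}([0,T)\times\mathbb R^n)$ is called a weak solution of the transport equation $\partial_tu+b\cdot\nabla u=0$ on $(0,T)\times\mathbb R^n$, $u(0,\cdot)=u_0$, if $$\int_{\mathbb R^n}u_0(x)\phi(0,x)\,dx+\int_0^T\!\!\int_{\mathbb R^n}u\,(\partial_t\phi+b\cdot\nabla\phi+\operatorname{div} b\,\phi)\,dx\,dt=0\qquad\text{for all }\phi\in C_c^\infty([0,T)\times\mathbb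 R^n).$$ Then: (a) $b$ has the renormalization property: for every $u_0\in L^\infty_{\rm loc}(\mathbb R^n)$, every weak solution $u$ with initial data $u_0$, and every $\beta\in C^1(\mathbb R)$, the function $\beta(u)$ is a weak solution with initial data $\beta(u_0)$. (b) For every $u_0\in L^\infty_{\rm loc}(\mathbb R^n)$ any two weak solutions with initial data $u_0$ agree almost everywhere on $(0,T)\times\mathbb R^n$. (c) For every $u_0\in L^\infty(\mathbb R^n)$ there exists a weak solution $u\in L^\infty((0,T)\times\mathbb R^n)$ with initial data $u_0$ (by (b), it is the only weak solution). -/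

import Mathlib

open MeasureTheory Set
open scoped ENNReal ContDiff

/-- `ℝⁿ` with its Euclidean norm. -/
abbrev Sp (n : ℕ) : Type := EuclideanSpace ℝ (Fin n)

/-- Space-time `ℝ × ℝⁿ`; its measure `volume` is the product of the Lebesgue measures. -/
abbrev SpTime (n : ℕ) : Type := ℝ × Sp n

/-! ### Function spaces -/

section Spaces

variable {n : ℕ} {F : Type*} [TopologicalSpace F] [ENorm F]

/-- `f ∈ L^p(0,T; L^q(ℝⁿ))`: `f` is measurable on `(0,T) × ℝⁿ` and `t ↦ ‖f(t,·)‖_{L^q(ℝⁿ)}` has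
finite `L^p(0,T)` norm. -/
def MemMixedLp (T : ℝ) (p q : ℝ≥0∞) (f : SpTime n → F) : Prop :=
  AEStronglyMeasurable f (volume.restrict (Ioo 0 T ×ˢ (univ : Set (Sp n)))) ∧
    eLpNorm (fun t : ℝ => eLpNorm (fun x : Sp n => f (t, x)) q volume) p
      (volume.restrict (Ioo 0 T)) < ⊤

/-- `f ∈ L^p(0,T; L^q_loc(ℝⁿ))`: for each compact `K ⊂ ℝⁿ` the function `t ↦ ‖f(t,·)‖_{L^q(K)}` has
finite `L^p(0,T)` norm. -/
def MemMixedLpLoc (T : ℝ) (p q : ℝ≥0∞) (f : SpTime n → F) : Prop :=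
  AEStronglyMeasurable f (volume.restrict (Ioo 0 T ×ˢ (univ : Set (Sp n)))) ∧
    ∀ K : Set (Sp n), IsCompact K →
      eLpNorm (fun t : ℝ => eLpNorm (fun x : Sp n => f (t, x)) q (volume.restrict K)) p
        (volume.restrict (Ioo 0 T)) < ⊤

end Spaces

/-- `f ∈ L^∞_loc(U)`: `f` is measurable and essentially bounded on each compact subset of `U`. -/
def MemLinftyLoc {X : Type*} [TopologicalSpace X] [MeasureSpace X] (f : X → ℝ) (U : Set X) : Prop :=
  ∀ K : Set X, IsCompact K → K ⊆ U → MemLp f ⊤ (volume.restrict K)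

/-! ### Test functions and derivatives -/

noncomputable section

variable {n : ℕ}

/-- `φ ∈ C_c^∞(U)`, for a set `U` open in `ℝ × ℝⁿ`. -/
def IsTestFun (U : Set (SpTime n)) (φ : SpTime n → ℝ) : Prop :=
  ContDiff ℝ ∞ φ ∧ HasCompactSupport φ ∧ tsupport φ ⊆ U

/-- The time derivative `∂φ/∂t`. -/
def timeDeriv (φ : SpTime n → ℝ) (z : SpTime n) : ℝ :=
  deriv (fun s : ℝ => φ (s, z.2)) z.1

/-- The spatial gradient `∇φ`. -/
def spaceGrad (φ : SpTime n → ℝ) (z : SpTime n) : Sp n :=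
  gradient (fun y : Sp n => φ (z.1, y)) z.2

/-- `d` is the (spatial, distributional) divergence of `b` on `(0,T) × ℝⁿ`. Being locally integrable,
`d` is determined by `b` up to a null set. -/
def IsWeakDiv (T : ℝ) (b : SpTime n → Sp n) (d : SpTime n → ℝ) : Prop :=
  LocallyIntegrableOn d (Ioo 0 T ×ˢ univ) ∧
    ∀ φ : SpTime n → ℝ, IsTestFun (Ioo 0 T ×ˢ univ) φ →
      ∫ z in Ioo 0 T ×ˢ univ, inner ℝ (b z) (spaceGrad φ z) =
        -∫ z in Ioo 0 T ×ˢ univ, d z * φ z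

/-- `∂φ/∂t + b·∇φ + (div b) φ`, where `d` stands for `div b`. -/
def adjTransport (b : SpTime n → Sp n) (d : SpTime n → ℝ) (φ : SpTime n → ℝ) (z : SpTime n) : ℝ :=
  timeDeriv φ z + inner ℝ (b z) (spaceGrad φ z) + d z * φ z

/-- The extension by zero to negative times. -/
def zeroExt {F : Type*} [Zero F] (f : SpTime n → F) (z : SpTime n) : F :=
  if z.1 < 0 then 0 else f z

/-! ### Weak and renormalized solutions -/

/-- `u` is a weak solution of `∂ₜu + b·∇u = 0` on `(0,T) × ℝⁿ`, `u(0,·) = u₀`, where `d = div b`.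
The test functions on `[0,T) × ℝⁿ` are the restrictions of those on `(-∞,T) × ℝⁿ`, and `u` is locally
bounded up to the time `t = 0` (the integral over `(0,T) × ℝⁿ` reaches down to `t = 0`). -/
def IsWeakSol (T : ℝ) (b : SpTime n → Sp n) (d : SpTime n → ℝ) (u₀ : Sp n → ℝ)
    (u : SpTime n → ℝ) : Prop :=
  MemLinftyLoc u₀ univ ∧ MemLinftyLoc u (Ico 0 T ×ˢ univ) ∧
    ∀ φ : SpTime n → ℝ, IsTestFun (Iio T ×ˢ univ) φ →
      (∫ x : Sp n, u₀ x * φ (0, x)) +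
        ∫ z in Ioo 0 T ×ˢ univ, u z * adjTransport b d φ z = 0

/-- The (global) renormalization property: for each weak solution `u` with initial data `u₀` and each
`β ∈ C¹(ℝ)`, `β(u)` is a weak solution with initial data `β(u₀)`. -/
def HasRenormProp (T : ℝ) (b : SpTime n → Sp n) (d : SpTime n → ℝ) : Prop :=
  ∀ (u₀ : Sp n → ℝ) (u : SpTime n → ℝ), IsWeakSol T b d u₀ u →
    ∀ β : ℝ → ℝ, ContDiff ℝ 1 β → IsWeakSol T b d (fun x => β (u₀ x)) (fun z => β (u z))

/-- `u ∈ L^∞_loc((-∞,T) × ℝⁿ)` is a weak solution of `∂ₜu + b·∇u = 0` on `(-∞,T) × ℝⁿ`, where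
`d = div b` (no initial condition). -/
def IsWeakSolPast (T : ℝ) (b : SpTime n → Sp n) (d : SpTime n → ℝ) (u : SpTime n → ℝ) : Prop :=
  MemLinftyLoc u (Iio T ×ˢ univ) ∧
    ∀ φ : SpTime n → ℝ, IsTestFun (Iio T ×ˢ univ) φ →
      ∫ z in Iio T ×ˢ univ, u z * adjTransport b d φ z = 0

/-- `u` is locally renormalized on the open set `Ω`. -/
def IsLocRenorm (b : SpTime n → Sp n) (d : SpTime n → ℝ) (Ω : Set (SpTime n))
    (u : SpTime n → ℝ) : Prop :=
  ∀ β : ℝ → ℝ, ContDiff ℝ 1 β → ∀ φ : SpTime n → ℝ, IsTestFun Ω φ →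
    ∫ z in Ω, β (u z) * adjTransport b d φ z = 0

/-- `b` (a field on `(-∞,T) × ℝⁿ` with divergence `d`) has the local renormalization property on
`Ω ⊆ (-∞,T) × ℝⁿ`. -/
def HasLocRenormProp (T : ℝ) (b : SpTime n → Sp n) (d : SpTime n → ℝ)
    (Ω : Set (SpTime n)) : Prop :=
  ∀ u : SpTime n → ℝ, IsWeakSolPast T b d u → IsLocRenorm b d Ω u

/-! ### The distance to the singular set -/

/-- The Euclidean distance of `z = (t,x)` to `S` in `ℝ × ℝⁿ`, as an extended number (the norm of the
type `ℝ × ℝⁿ` is the maximum norm, so the Euclidean one is spelled out). It is `∞` if `S` is empty. -/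
def eDistTo (S : Set (SpTime n)) (z : SpTime n) : ℝ≥0∞ :=
  ⨅ w ∈ S, ENNReal.ofReal (Real.sqrt ((z.1 - w.1) ^ 2 + ‖z.2 - w.2‖ ^ 2))

/-- The Euclidean distance `d_S` as a real function. -/
def distTo (S : Set (SpTime n)) (z : SpTime n) : ℝ := (eDistTo S z).toReal

end

/-! Renormalization. Extended by `u₀` to negative times, a weak solution solves the equation on
`(-∞,T)` for the field extended by zero, and the initial condition is absorbed into the equation.
The local hypothesis then gives the equation for `β(u)` against test functions supported off `S`. To
reach a general `φ`, test with `φ · χ((k+1) d_S - 1)`, where `χ` is a smooth step from 0 to 1; this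
is Lipschitz and supported off `S`, and Lipschitz test functions are admissible by mollification and
Rademacher's theorem. The only error is `φ χ' (k+1) (∂ₜd_S + b·∇d_S)`. Where `χ'` does not vanish,
`k+1 ≤ 2/d_S`, so the error is at most a constant times `(L + |b·∇d_S|)/d_S`, which is integrable by
Hölder's inequality in mixed norms. Integrability of `1/d_S` makes `S` a null set, hence the error
tends to 0 pointwise almost everywhere, and dominated convergence removes it
(`setIntegral_adjTransport_eq_zero_of_off`).

Uniqueness. If `w` is the difference of two solutions, renormalization makes `v = w²/(1+w²)` a
solution with zero data and values in `[0,1]`. Its mass against a weight `ψ` in space satisfies a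
Gronwall inequality: the `L¹(L^∞)` part of the field and the divergence give a coefficient, and the
`L¹` part gives an error controlled by `(1+|x|)|∇ψ|`. For the weights `(1+|x|²/(k+1)²)^{-(n+1)}` the
Gronwall constant does not depend on `k`, while the error tends to 0; thus `v = 0`
(`exists_setIntegral_weight_le`).

Existence. Constants are weak solutions. Testing this with a smooth approximation of `|φ|` gives
`∫|φ(0,·)| ≤ ∬|∂ₜφ + b·∇φ + (div b)φ|` (`IsWeakDiv.integral_abs_le`). Hence `φ ↦ -∫ u₀ φ(0,·)` is
bounded by the `L¹` norm of the adjoint operator applied to `φ`, and Hahn–Banach together with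
`(L¹)* = L^∞` produces the solution, without any regularization of `b`. -/

open Filter Topology Metric Convolution

/-! ### Mollification -/

section Mollification

/-- Bump functions at the origin with outer radii `δ / (k + 1)`. -/
noncomputable def bumpSeq {E : Type*} [NormedAddCommGroup E] [NormedSpace ℝ E] {δ : ℝ} (hδ : 0 < δ)
    (k : ℕ) : ContDiffBump (0 : E) where
  -- A fixed ratio of the two radii is what the Lebesgue differentiation theorem asks for in
  -- `ae_tendsto_mollify`.
  rIn := δ / (k + 1) / 2
  rOut := δ / (k + 1)
  rIn_pos := by positivity
  rIn_lt_rOut := half_lt_self (by positivity)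

variable {E F : Type*} [NormedAddCommGroup E] [NormedSpace ℝ E]

lemma tendsto_bumpSeq_rOut {δ : ℝ} (hδ : 0 < δ) :
    Tendsto (fun k => (bumpSeq (E := E) hδ k).rOut) atTop (𝓝 0) := by
  have := (tendsto_one_div_add_atTop_nhds_zero_nat (𝕜 := ℝ)).const_mul δ
  simpa [bumpSeq, div_eq_mul_inv] using this

lemma bumpSeq_rOut_le {δ : ℝ} (hδ : 0 < δ) (k : ℕ) : (bumpSeq (E := E) hδ k).rOut ≤ δ :=
  div_le_self hδ.le (by simp)

variable [FiniteDimensional ℝ E] [MeasurableSpace E] [NormedAddCommGroup F] [NormedSpace ℝ F]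

/-- The mollification of `f` by the `k`-th bump function of scale `δ`. -/
noncomputable def mollify (μ : Measure E) {δ : ℝ} (hδ : 0 < δ) (k : ℕ) (f : E → F) : E → F :=
  (bumpSeq hδ k).normed μ ⋆[ContinuousLinearMap.lsmul ℝ ℝ, μ] f

lemma mollify_apply {μ : Measure E} {δ : ℝ} (hδ : 0 < δ) (k : ℕ) (f : E → F) (x : E) :
    mollify μ hδ k f x = ∫ y, (bumpSeq hδ k).normed μ y • f (x - y) ∂μ := rfl

variable [BorelSpace E] {μ : Measure E} [μ.IsAddHaarMeasure] {δ : ℝ} (hδ : 0 < δ)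

lemma contDiff_mollify [CompleteSpace F] (k : ℕ) {f : E → F} (hf : LocallyIntegrable f μ) :
    ContDiff ℝ ∞ (mollify μ hδ k f) :=
  HasCompactSupport.contDiff_convolution_left (n := ⊤) _ (ContDiffBump.hasCompactSupport_normed _)
    (ContDiffBump.contDiff_normed _) hf

lemma tsupport_mollify_subset (k : ℕ) (f : E → F) :
    tsupport (mollify μ hδ k f) ⊆ cthickening δ (tsupport f) := by
  refine closure_minimal ?_ isClosed_cthickening
  refine (support_convolution_subset _).trans ?_
  rintro _ ⟨y, hy, x, hx, rfl⟩
  rw [ContDiffBump.support_normed_eq, mem_ball_zero_iff] at hy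
  refine mem_cthickening_of_dist_le _ x _ _ (subset_tsupport _ hx) ?_
  simpa [dist_eq_norm] using hy.le.trans (bumpSeq_rOut_le hδ k)

lemma integrable_normed_smul_of_continuous (k : ℕ) {f : E → F} (hf : Continuous f) (x : E) :
    Integrable (fun y => (bumpSeq hδ k).normed μ y • f (x - y)) μ := by
  refine Continuous.integrable_of_hasCompactSupport ?_ ?_
  · exact (ContDiffBump.continuous_normed _).smul (hf.comp (by fun_prop))
  · exact (ContDiffBump.hasCompactSupport_normed _).smul_right

lemma norm_mollify_le_of_bound (k : ℕ) {f : E → F} {M : ℝ} (hM : ∀ x, ‖f x‖ ≤ M) (x : E) :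
    ‖mollify μ hδ k f x‖ ≤ M := by
  rw [mollify_apply]
  calc ‖∫ y, (bumpSeq hδ k).normed μ y • f (x - y) ∂μ‖
      ≤ ∫ y, (bumpSeq hδ k).normed μ y * M ∂μ := by
        refine norm_integral_le_of_norm_le ((ContDiffBump.integrable_normed _).mul_const M) ?_
        refine Eventually.of_forall fun y => ?_
        rw [norm_smul, Real.norm_of_nonneg (ContDiffBump.nonneg_normed _ _)]
        exact mul_le_mul_of_nonneg_left (hM _) (ContDiffBump.nonneg_normed _ _)
    _ = M := by rw [integral_mul_const, ContDiffBump.integral_normed, one_mul]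

lemma tendsto_mollify_of_continuous [CompleteSpace F] {f : E → F} (hf : Continuous f) (x : E) :
    Tendsto (fun k => mollify μ hδ k f x) atTop (𝓝 (f x)) :=
  ContDiffBump.convolution_tendsto_right_of_continuous (tendsto_bumpSeq_rOut hδ) hf x

lemma ae_tendsto_mollify [CompleteSpace F] {f : E → F} (hf : LocallyIntegrable f μ) :
    ∀ᵐ x ∂μ, Tendsto (fun k => mollify μ hδ k f x) atTop (𝓝 (f x)) := by
  refine ContDiffBump.ae_convolution_tendsto_right_of_locallyIntegrable (K := 2)
    (tendsto_bumpSeq_rOut hδ) (Eventually.of_forall fun k => le_of_eq ?_) hf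
  simp only [bumpSeq]; ring

/-- The derivative is put on `f` and not on the kernel: difference quotients are dominated by the
Lipschitz constant, and Rademacher's theorem gives their limit. Both the bound `L` on the gradients
and their convergence almost everywhere can be read off from this form. -/
lemma hasFDerivAt_mollify_of_lipschitz (k : ℕ) {f : E → ℝ} {L : NNReal} (hf : LipschitzWith L f)
    (x : E) : HasFDerivAt (mollify μ hδ k f) (mollify μ hδ k (fderiv ℝ f) x) x := by
  have hρ : Continuous ((bumpSeq hδ k).normed μ) := ContDiffBump.continuous_normed (bumpSeq (E := E) hδ k)
  have hρi : Integrable ((bumpSeq hδ k).normed μ) μ := ContDiffBump.integrable_normed (bumpSeq (E := E) hδ k)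
  refine (hasFDerivAt_integral_of_dominated_loc_of_lip (𝕜 := ℝ)
    (bound := fun y => (bumpSeq hδ k).normed μ y * L) (s := univ)
    (F := fun x y => (bumpSeq hδ k).normed μ y • f (x - y))
    (F' := fun y => (bumpSeq hδ k).normed μ y • fderiv ℝ f (x - y)) univ_mem ?_ ?_ ?_ ?_ ?_ ?_).2
  · exact Eventually.of_forall fun x =>
      (hρ.smul (hf.continuous.comp (by fun_prop))).aestronglyMeasurable
  · exact integrable_normed_smul_of_continuous hδ k hf.continuous x
  · have : Measurable fun y => fderiv ℝ f (x - y) :=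
      (measurable_fderiv ℝ f).comp (measurable_const.sub measurable_id)
    exact hρ.aestronglyMeasurable.smul this.aestronglyMeasurable
  · refine Eventually.of_forall fun y => LipschitzOnWith.of_dist_le_mul fun a _ b _ => ?_
    have h1 := hf.dist_le_mul (a - y) (b - y)
    rw [dist_sub_right] at h1
    have h2 := ContDiffBump.nonneg_normed (μ := μ) (bumpSeq (E := E) hδ k) y
    rw [Real.coe_nnabs, abs_of_nonneg (by positivity), dist_eq_norm, ← smul_sub, norm_smul,
      Real.norm_of_nonneg h2, ← dist_eq_norm, mul_assoc]
    exact mul_le_mul_of_nonneg_left h1 h2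
  · exact hρi.mul_const _
  · have hae := (Measure.measurePreserving_sub_left μ x).quasiMeasurePreserving.ae
      hf.ae_differentiableAt
    filter_upwards [hae] with y hy
    have h3 : HasFDerivAt (fun z => z - y) (ContinuousLinearMap.id ℝ E) x :=
      (hasFDerivAt_id x).sub_const y
    have := (hy.hasFDerivAt.comp x h3).const_smul ((bumpSeq hδ k).normed μ y)
    exact this

/-- A compactly supported Lipschitz function is approximated by test functions, together with its
derivative. -/
theorem LipschitzWith.exists_contDiff_approx (μ : Measure E) [μ.IsAddHaarMeasure] {f : E → ℝ}
    {L : NNReal} (hf : LipschitzWith L f)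
    (hc : HasCompactSupport f) {V : Set E} (hV : IsOpen V) (hfV : tsupport f ⊆ V) :
    ∃ K, IsCompact K ∧ K ⊆ V ∧ ∃ φ : ℕ → E → ℝ, (∀ k, ContDiff ℝ ∞ (φ k)) ∧
      (∀ k, tsupport (φ k) ⊆ K) ∧ (∃ C, ∀ k z, |φ k z| ≤ C) ∧ (∀ k z, ‖fderiv ℝ (φ k) z‖ ≤ L) ∧
      (∀ z, Tendsto (fun k => φ k z) atTop (𝓝 (f z))) ∧
      ∀ᵐ z ∂μ, Tendsto (fun k => fderiv ℝ (φ k) z) atTop (𝓝 (fderiv ℝ f z)) := by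
  -- All mollifications live on this one compact thickening, which later gives a common integrable
  -- majorant.
  obtain ⟨δ, hδ, hδV⟩ := IsCompact.exists_cthickening_subset_open hc hV hfV
  have : ProperSpace E := FiniteDimensional.proper ℝ E
  obtain ⟨C, hC⟩ := hc.exists_bound_of_continuous hf.continuous
  have hder : ∀ k x, fderiv ℝ (mollify μ hδ k f) x = mollify μ hδ k (fderiv ℝ f) x :=
    fun k x => (hasFDerivAt_mollify_of_lipschitz hδ k hf x).fderiv
  have hloc : LocallyIntegrable (fderiv ℝ f) μ := by
    refine (locallyIntegrable_const (L : ℝ)).mono (measurable_fderiv ℝ f).aestronglyMeasurable ?_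
    exact Eventually.of_forall fun x => by
      simpa using norm_fderiv_le_of_lipschitz ℝ hf
  refine ⟨_, IsCompact.cthickening hc, hδV, fun k => mollify μ hδ k f, fun k =>
    contDiff_mollify hδ k hf.continuous.locallyIntegrable, fun k => tsupport_mollify_subset hδ k f,
    ⟨C, fun k z => norm_mollify_le_of_bound hδ k hC z⟩, fun k z => ?_,
    fun z => tendsto_mollify_of_continuous hδ hf.continuous z, ?_⟩
  · rw [hder]
    exact norm_mollify_le_of_bound hδ k (fun x => norm_fderiv_le_of_lipschitz ℝ hf) z
  · simp only [hder]
    exact ae_tendsto_mollify hδ hloc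

end Mollification

/-! ### Solving linear equations in `L^∞` by duality -/

section Duality

variable {X : Type*} [MeasurableSpace X]

/-- On a finite measure space `L²` embeds in `L¹`, so the Riesz representation in `L²` yields a
density `y`. Testing with indicators bounds the averages of `y` by `M`, hence `|y| ≤ M` almost
everywhere, and density of simple functions extends the formula to `L¹`. -/
lemma exists_bounded_of_dual_of_isFiniteMeasure {ν : Measure X} [IsFiniteMeasure ν]
    (Λ : Lp ℝ 1 ν →L[ℝ] ℝ) {M : ℝ} (hΛ : ∀ f, |Λ f| ≤ M * ‖f‖) :
    ∃ v : X → ℝ, AEStronglyMeasurable v ν ∧ (∀ᵐ z ∂ν, |v z| ≤ M) ∧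
      ∀ f : Lp ℝ 1 ν, Λ f = ∫ z, v z * f z ∂ν := by
  have htop : ∀ s, ν s ≠ ⊤ := fun s => measure_ne_top ν s
  -- The embedding of `L²` in `L¹`, written as Hölder multiplication by the constant 1.
  let ι : Lp ℝ 2 ν →L[ℝ] Lp ℝ 1 ν :=
    ((ContinuousLinearMap.mul ℝ ℝ).holderL ν 2 2 1) (indicatorConstLp 2 MeasurableSet.univ (htop _) 1)
  have hι : ∀ (s : Set X) (hs : MeasurableSet s) (c : ℝ),
      ι (indicatorConstLp 2 hs (htop s) c) = indicatorConstLp 1 hs (htop s) c := by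
    intro s hs c
    refine Lp.ext ?_
    filter_upwards [(ContinuousLinearMap.mul ℝ ℝ).coeFn_holder (r := 1)
      (indicatorConstLp 2 MeasurableSet.univ (htop _) (1 : ℝ)) (indicatorConstLp 2 hs (htop s) c),
      indicatorConstLp_coeFn (p := 2) (hs := hs) (hμs := htop s) (c := c),
      indicatorConstLp_coeFn (p := 1) (hs := hs) (hμs := htop s) (c := c),
      indicatorConstLp_coeFn (p := 2) (hs := MeasurableSet.univ) (hμs := htop univ)
        (c := (1 : ℝ))] with z h1 h2 h3 h4
    rw [h3, ← h2]
    refine h1.trans ?_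
    rw [h4]
    simp
  set y : Lp ℝ 2 ν := (InnerProductSpace.toDual ℝ (Lp ℝ 2 ν)).symm (Λ ∘L ι) with hy
  have hset : ∀ (s : Set X) (hs : MeasurableSet s) (c : ℝ),
      Λ (indicatorConstLp 1 hs (htop s) c) = c * ∫ z in s, y z ∂ν := by
    intro s hs c
    rw [← hι s hs, ← smul_eq_mul, ← integral_smul]
    have h1 : inner ℝ y (indicatorConstLp 2 hs (htop s) c) =
        Λ (ι (indicatorConstLp 2 hs (htop s) c)) := by
      rw [hy, InnerProductSpace.toDual_symm_apply]
      rfl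
    rw [← h1, real_inner_comm, L2.inner_indicatorConstLp_eq_inner_setIntegral, integral_smul,
      real_inner_comm]
    simp
  have hbd : ∀ (s : Set X), MeasurableSet s → |∫ z in s, y z ∂ν| ≤ M * ν.real s := by
    intro s hs
    have h1 := hΛ (indicatorConstLp 1 hs (htop s) 1)
    rw [hset s hs, one_mul, norm_indicatorConstLp one_ne_zero ENNReal.one_ne_top] at h1
    simpa using h1
  have hyi : Integrable y ν := (Lp.memLp y).integrable (by norm_num)
  have hup : (y : X → ℝ) ≤ᵐ[ν] fun _ => M := by
    refine ae_le_of_forall_setIntegral_le hyi (integrable_const M) fun s hs _ => ?_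
    rw [setIntegral_const, smul_eq_mul, mul_comm]
    exact (abs_le.1 (hbd s hs)).2
  have hlo : (fun _ => -M) ≤ᵐ[ν] (y : X → ℝ) := by
    refine ae_le_of_forall_setIntegral_le (integrable_const (-M)) hyi fun s hs _ => ?_
    rw [setIntegral_const, smul_eq_mul, mul_neg, mul_comm]
    exact (abs_le.1 (hbd s hs)).1
  have hyM : ∀ᵐ z ∂ν, |y z| ≤ M := by
    filter_upwards [hup, hlo] with z h1 h2 using abs_le.2 ⟨h2, h1⟩
  have hytop : MemLp y ⊤ ν := memLp_top_of_bound (Lp.memLp y).1 M hyM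
  have hpair : ∀ f : Lp ℝ 1 ν,
      (ContinuousLinearMap.mul ℝ ℝ).lpPairing ν ⊤ 1 (hytop.toLp y) f = ∫ z, y z * f z ∂ν := by
    intro f
    rw [ContinuousLinearMap.lpPairing_eq_integral]
    refine integral_congr_ae ?_
    filter_upwards [hytop.coeFn_toLp] with z hz
    rw [hz]
    rfl
  refine ⟨y, (Lp.memLp y).1, hyM, fun f => ?_⟩
  rw [← hpair f]
  refine Lp.induction ENNReal.one_ne_top (motive := fun f => Λ f =
    (ContinuousLinearMap.mul ℝ ℝ).lpPairing ν ⊤ 1 (hytop.toLp y) f) (fun c s hs _ => ?_)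
    (fun f g hf hg _ h1 h2 => ?_) (isClosed_eq Λ.continuous (ContinuousLinearMap.continuous _)) f
  · rw [Lp.simpleFunc.coe_indicatorConst, hset s hs, hpair, ← integral_const_mul,
      ← integral_indicator hs]
    refine integral_congr_ae ?_
    filter_upwards [indicatorConstLp_coeFn (p := 1) (hs := hs) (hμs := htop s) (c := c)] with z hz
    rw [hz]
    by_cases hzs : z ∈ s <;> simp [hzs, mul_comm]
  · rw [map_add, map_add, h1, h2]

/-- A positive integrable density `w` replaces `μ` by an equivalent finite measure `ν`, and `f ↦ w
f` is an isometry from `L¹(ν)` to `L¹(μ)`. The bound `M` is therefore not changed. -/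
lemma exists_bounded_of_dual {μ : Measure X} [SigmaFinite μ]
    (Λ : Lp ℝ 1 μ →L[ℝ] ℝ) {M : ℝ} (hΛ : ∀ f, |Λ f| ≤ M * ‖f‖) :
    ∃ v : X → ℝ, AEStronglyMeasurable v μ ∧ (∀ᵐ z ∂μ, |v z| ≤ M) ∧
      ∀ g : X → ℝ, ∀ hg : Integrable g μ,
        Λ ((memLp_one_iff_integrable.2 hg).toLp g) = ∫ z, v z * g z ∂μ := by
  obtain ⟨w, hw0, hwm, hw1⟩ := exists_pos_lintegral_lt_of_sigmaFinite μ one_ne_zero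
  set ν := μ.withDensity fun x => (w x : ℝ≥0∞) with hν
  have hfin : IsFiniteMeasure ν := isFiniteMeasure_withDensity hw1.ne_top
  have hμν : μ ≪ ν := withDensity_absolutelyContinuous' hwm.coe_nnreal_ennreal.aemeasurable
    (Eventually.of_forall fun x => by simpa using (hw0 x).ne')
  set J := withDensitySMulLI (E := ℝ) μ hwm with hJ
  obtain ⟨v, hv, hvM, hvΛ⟩ := exists_bounded_of_dual_of_isFiniteMeasure
    (Λ ∘L J.toContinuousLinearMap) (M := M) fun f => by
      simpa [J.norm_map] using hΛ (J f)
  refine ⟨v, hv.mono_ac hμν, hμν.ae_le hvM, fun g hg => ?_⟩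
  have hwg : ∀ x, w x • ((w x : ℝ)⁻¹ * g x) = g x := fun x => by
    have : (w x : ℝ) ≠ 0 := by exact_mod_cast (hw0 x).ne'
    rw [NNReal.smul_def, smul_eq_mul, mul_inv_cancel_left₀ this]
  have hgν : Integrable (fun x => (w x : ℝ)⁻¹ * g x) ν := by
    rw [hν, integrable_withDensity_iff_integrable_smul hwm]
    simpa only [hwg] using hg
  have h1 := hvΛ ((memLp_one_iff_integrable.2 hgν).toLp _)
  have h2 : J ((memLp_one_iff_integrable.2 hgν).toLp _) =
      (memLp_one_iff_integrable.2 hg).toLp g := by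
    rw [hJ, withDensitySMulLI_apply]
    refine MemLp.toLp_congr _ _ ?_
    filter_upwards [hμν.ae_le (memLp_one_iff_integrable.2 hgν).coeFn_toLp] with x hx
    rw [hx, hwg]
  rw [← h2]
  refine h1.trans ?_
  have h3 : ∫ x, v x * ((memLp_one_iff_integrable.2 hgν).toLp _ : Lp ℝ 1 ν) x ∂ν =
      ∫ x, v x * ((w x : ℝ)⁻¹ * g x) ∂ν := by
    refine integral_congr_ae ?_
    filter_upwards [(memLp_one_iff_integrable.2 hgν).coeFn_toLp] with x hx
    rw [hx]
  rw [h3, hν, integral_withDensity_eq_integral_smul hwm]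
  refine integral_congr_ae (Eventually.of_forall fun x => ?_)
  simp only
  rw [← mul_smul_comm, hwg]

/-- If `|ℓ φ| ≤ M ‖A φ‖_{L¹}`, then the equations `∫ v (A φ) = ℓ φ` have a solution `v` with
`|v| ≤ M`. -/
theorem exists_bounded_of_abs_le_integral_norm {μ : Measure X} [SigmaFinite μ] {V : Type*}
    [AddCommGroup V] [Module ℝ V] (A : V →ₗ[ℝ] X → ℝ) (hA : ∀ φ, Integrable (A φ) μ)
    (ℓ : V →ₗ[ℝ] ℝ) {M : ℝ} (hM : 0 ≤ M) (h : ∀ φ, |ℓ φ| ≤ M * ∫ z, ‖A φ z‖ ∂μ) :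
    ∃ v : X → ℝ, AEStronglyMeasurable v μ ∧ (∀ᵐ z ∂μ, |v z| ≤ M) ∧
      ∀ φ, ∫ z, v z * A φ z ∂μ = ℓ φ := by
  have hA1 : ∀ φ, MemLp (A φ) 1 μ := fun φ => memLp_one_iff_integrable.2 (hA φ)
  let B : V →ₗ[ℝ] Lp ℝ 1 μ :=
    { toFun := fun φ => (hA1 φ).toLp (A φ)
      map_add' := fun φ ψ => by
        rw [← MemLp.toLp_add]
        exact MemLp.toLp_congr _ _ (by rw [map_add])
      map_smul' := fun c φ => by
        rw [RingHom.id_apply, ← MemLp.toLp_const_smul]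
        exact MemLp.toLp_congr _ _ (by rw [map_smul]) }
  have hnorm : ∀ φ, ‖B φ‖ = ∫ z, ‖A φ z‖ ∂μ := fun φ =>
    L1.norm_of_fun_eq_integral_norm (hA φ)
  -- A linear section of `B` carries `ℓ` to the range of `B`, where Hahn–Banach applies.
  obtain ⟨s, hs⟩ := B.rangeRestrict.exists_rightInverse_of_surjective
    (LinearMap.range_rangeRestrict B)
  have hBs : ∀ y, B (s y) = y := fun y => congrArg Subtype.val (LinearMap.congr_fun hs y)
  lift M to NNReal using hM
  have hp : Continuous (M • normSeminorm ℝ (Lp ℝ 1 μ)) := by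
    change Continuous fun x : Lp ℝ 1 μ => (M : ℝ) * ‖x‖
    fun_prop
  obtain ⟨Λ, hΛ, hΛM⟩ := Module.Dual.exists_continuous_extension_of_le_seminorm
    (LinearMap.range B) (ℓ ∘ₗ s) hp fun y => by
      change |ℓ (s y)| ≤ M * ‖(y : Lp ℝ 1 μ)‖
      rw [← hBs y, hnorm]
      exact h _
  obtain ⟨v, hv, hvM, hvΛ⟩ := exists_bounded_of_dual Λ (M := M) hΛM
  refine ⟨v, hv, hvM, fun φ => ?_⟩
  rw [← hvΛ _ (hA φ)]
  have h1 : Λ (B φ) = ℓ (s ⟨B φ, φ, rfl⟩) := hΛ ⟨B φ, φ, rfl⟩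
  refine h1.trans ?_
  -- The choice of section does not matter: `ℓ` vanishes on the kernel of `B` by the assumed
  -- estimate.
  have h2 := h (s ⟨B φ, φ, rfl⟩ - φ)
  rw [← hnorm, map_sub, map_sub, hBs, sub_self, norm_zero, mul_zero] at h2
  exact sub_eq_zero.1 (abs_nonpos_iff.1 h2)

end Duality

/-! ### Gronwall's inequality in integral form -/

/-- Gronwall's inequality with an integrable coefficient; the constant depends on the coefficient
only. -/
theorem exists_gronwall_const {T : ℝ} {a : ℝ → ℝ} (ha0 : ∀ t, 0 ≤ a t)
    (ha : IntegrableOn a (Ioo 0 T)) :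
    ∃ C : ℝ, 0 ≤ C ∧ ∀ (m : ℝ → ℝ) (e : ℝ), IntegrableOn (fun t => a t * m t) (Ioo 0 T) →
      (∀ t, 0 ≤ m t) → 0 ≤ e →
      (∀ᵐ t ∂(volume.restrict (Ioo 0 T)), m t ≤ e + ∫ s in Ioo 0 t, a s * m s) →
      ∀ᵐ t ∂(volume.restrict (Ioo 0 T)), m t ≤ C * e := by
  -- Absolute continuity of the integral gives a length `r` such that `a` has integral at most 1/2
  -- on each window of length `r`. Over such a window the right-hand side `Φ` satisfies `Φ t ≤ Φ s +
  -- Φ t / 2`, so it at most doubles, and `⌈T/r⌉` windows cover `(0,T)`.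
  obtain ⟨δ, hδ, hδa⟩ := exists_pos_setLIntegral_lt_of_measure_lt
    (μ := volume.restrict (Ioo 0 T)) (f := fun t => ENNReal.ofReal (a t))
    (by
      have h1 := ha.2
      rw [hasFiniteIntegral_iff_ofReal (Eventually.of_forall ha0)] at h1
      exact h1.ne) (ε := ENNReal.ofReal (1 / 2)) (by simp)
  obtain ⟨r, hr, hrδ⟩ : ∃ r : ℝ, 0 < r ∧ ENNReal.ofReal r < δ := by
    rcases eq_or_ne δ ∞ with rfl | h
    · exact ⟨1, one_pos, ENNReal.ofReal_lt_top⟩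
    · have h2 : 0 < δ.toReal := ENNReal.toReal_pos hδ.ne' h
      refine ⟨δ.toReal / 2, by positivity, ?_⟩
      rw [ENNReal.ofReal_lt_iff_lt_toReal (by positivity) h]
      linarith
  have hsmall : ∀ s t : ℝ, 0 ≤ s → t ≤ T → t - s ≤ r → ∫ x in Ico s t, a x ≤ 1 / 2 := by
    intro s t hs ht hst
    rw [integral_Ico_eq_integral_Ioo]
    have hsub : Ioo s t ⊆ Ioo 0 T := Ioo_subset_Ioo hs ht
    have h1 := hδa (Ioo s t) (by
      rw [Measure.restrict_apply measurableSet_Ioo, inter_eq_left.2 hsub, Real.volume_Ioo]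
      exact (ENNReal.ofReal_le_ofReal hst).trans_lt hrδ)
    rw [Measure.restrict_restrict measurableSet_Ioo, inter_eq_left.2 hsub,
      ← ofReal_integral_eq_lintegral_ofReal (ha.mono_set hsub) (Eventually.of_forall ha0)] at h1
    exact (ENNReal.ofReal_le_ofReal_iff (by norm_num)).1 h1.le
  refine ⟨2 ^ ⌈T / r⌉₊, by positivity, fun m e hint hm he hle => ?_⟩
  set Φ : ℝ → ℝ := fun t => e + ∫ s in Ioo 0 t, a s * m s with hΦ
  have hintsub : ∀ t ≤ T, IntegrableOn (fun t => a t * m t) (Ioo 0 t) := fun t ht =>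
    hint.mono_set (Ioo_subset_Ioo le_rfl ht)
  have hmono : ∀ s t, s ≤ t → t ≤ T → Φ s ≤ Φ t := fun s t hst ht => by
    simp only [hΦ]
    gcongr 1
    exact setIntegral_mono_set (hintsub t ht)
      (Eventually.of_forall fun x => mul_nonneg (ha0 x) (hm x))
      (Ioo_subset_Ioo le_rfl hst).eventuallyLE
  have hΦ0 : ∀ t, 0 ≤ Φ t := fun t =>
    add_nonneg he (setIntegral_nonneg measurableSet_Ioo fun x _ => mul_nonneg (ha0 x) (hm x))
  have hstep : ∀ s t, 0 ≤ s → s ≤ t → t ≤ T → t - s ≤ r → Φ t ≤ 2 * Φ s := by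
    intro s t hs hst ht hr
    -- The start `s = 0` is separate because `Ioo 0 t` is not the union of `Ioo 0 0` and `Ico 0 t`.
    rcases hs.eq_or_lt with rfl | hs0
    · have h1 : ∫ x in Ioo 0 t, a x * m x ≤ ∫ x in Ioo 0 t, a x * Φ t := by
        refine setIntegral_mono_on_ae (hintsub t ht)
          ((ha.mono_set (Ioo_subset_Ioo le_rfl ht)).mul_const _) measurableSet_Ioo ?_
        rw [ae_restrict_iff' measurableSet_Ioo] at hle
        filter_upwards [hle] with x hx hxt
        exact mul_le_mul_of_nonneg_left
          ((hx ⟨hxt.1, hxt.2.trans_le ht⟩).trans (hmono x t hxt.2.le ht)) (ha0 x)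
      have h2 := hsmall 0 t le_rfl ht hr
      rw [integral_Ico_eq_integral_Ioo] at h2
      rw [integral_mul_const] at h1
      have h3 := mul_le_mul_of_nonneg_right h2 (hΦ0 t)
      have h4 : Φ t = e + ∫ x in Ioo 0 t, a x * m x := rfl
      have h5 : Φ 0 = e := by simp [hΦ]
      linarith
    · have hsplit : Ioo 0 t = Ioo 0 s ∪ Ico s t := by
        rw [Ioo_union_Ico_eq_Ioo hs0 hst]
      have hdisj : Disjoint (Ioo 0 s) (Ico s t) :=
        Set.disjoint_left.2 fun x hx hx' => absurd hx'.1 (not_le.2 hx.2)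
      have hsubI : Ico s t ⊆ Ioo 0 t := hsplit ▸ subset_union_right
      have hadd : Φ t = Φ s + ∫ x in Ico s t, a x * m x := by
        simp only [hΦ]
        rw [hsplit, setIntegral_union hdisj measurableSet_Ico (hintsub s (hst.trans ht))
          ((hintsub t ht).mono_set hsubI), add_assoc]
      have h1 : ∫ x in Ico s t, a x * m x ≤ ∫ x in Ico s t, a x * Φ t := by
        refine setIntegral_mono_on_ae ((hintsub t ht).mono_set hsubI)
          (((ha.mono_set (Ioo_subset_Ioo le_rfl ht)).mono_set hsubI).mul_const _)
          measurableSet_Ico ?_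
        rw [ae_restrict_iff' measurableSet_Ioo] at hle
        filter_upwards [hle] with x hx hxt
        have hx0 := hsubI hxt
        exact mul_le_mul_of_nonneg_left
          ((hx ⟨hx0.1, hx0.2.trans_le ht⟩).trans (hmono x t hx0.2.le ht)) (ha0 x)
      rw [integral_mul_const] at h1
      have h3 := mul_le_mul_of_nonneg_right (hsmall s t hs ht hr) (hΦ0 t)
      linarith
  have hpow : ∀ k : ℕ, ∀ t, 0 ≤ t → t ≤ T → t ≤ k * r → Φ t ≤ 2 ^ k * e := by
    intro k
    induction k with
    | zero =>
      intro t h0 hT hk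
      have : t = 0 := le_antisymm (by simpa using hk) h0
      simp [hΦ, this]
    | succ k ih =>
      intro t h0 hT hk
      push_cast at hk
      have h1 := hstep (max 0 (t - r)) t (le_max_left _ _) (max_le h0 (by linarith)) hT
        (by linarith [le_max_right 0 (t - r)])
      have h2 := ih (max 0 (t - r)) (le_max_left _ _) ((max_le h0 (by linarith)).trans hT)
        (max_le (by positivity) (by linarith))
      rw [pow_succ]
      linarith
  rw [ae_restrict_iff' measurableSet_Ioo] at hle ⊢
  filter_upwards [hle] with t ht htT
  refine (ht htT).trans (hpow _ t htT.1.le htT.2.le ?_)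
  have h1 := Nat.le_ceil (T / r)
  rw [div_le_iff₀ hr] at h1
  exact htT.2.le.trans h1

/-! ### Mixed norms -/

section Mixed

variable {α β : Type*} [MeasurableSpace α] [MeasurableSpace β] {μ : Measure α} {ν : Measure β}

/-- Hölder's inequality for conjugate exponents in `[1, ∞]`. -/
theorem lintegral_mul_le_eLpNorm_mul_eLpNorm {p q : ℝ≥0∞} (hp : 1 ≤ p) (hpq : p⁻¹ + q⁻¹ = 1)
    {f g : α → ℝ≥0∞} (hf : AEMeasurable f μ) (hg : AEMeasurable g μ) :
    ∫⁻ x, f x * g x ∂μ ≤ eLpNorm f p μ * eLpNorm g q μ := by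
  rcases eq_or_ne p ∞ with rfl | hp'
  · have hq : q = 1 := by simpa using hpq
    subst hq
    rw [eLpNorm_exponent_top, eLpNorm_one_eq_lintegral_enorm, eLpNormEssSup]
    simp only [enorm_eq_self]
    rw [← lintegral_const_mul'' _ hg]
    refine lintegral_mono_ae ?_
    filter_upwards [ae_le_essSup (f := f) (μ := μ)] with x hx
    gcongr
  rcases hp.eq_or_lt with rfl | hp1
  · have hq : q = (⊤ : ℝ≥0∞) := by
      rw [inv_one] at hpq
      have : q⁻¹ = 0 := by
        by_contra h
        exact absurd hpq (ENNReal.lt_add_right (by simp) h).ne'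
      simpa using this
    subst hq
    rw [eLpNorm_exponent_top, eLpNorm_one_eq_lintegral_enorm, eLpNormEssSup]
    simp only [enorm_eq_self]
    rw [← lintegral_mul_const'' _ hf]
    refine lintegral_mono_ae ?_
    filter_upwards [ae_le_essSup (f := g) (μ := μ)] with x hx
    gcongr
  have hq0 : q ≠ 0 := by
    rintro rfl
    simp at hpq
  have hqt : q ≠ (⊤ : ℝ≥0∞) := by
    rintro rfl
    simp at hpq
    exact hp1.ne' hpq
  have hconj : p.toReal.HolderConjugate q.toReal := by
    rw [Real.holderConjugate_iff]
    refine ⟨by simpa using (ENNReal.toReal_lt_toReal ENNReal.one_ne_top hp').2 hp1, ?_⟩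
    have h1 := congrArg ENNReal.toReal hpq
    rw [ENNReal.toReal_add (by simp [(zero_lt_one.trans hp1).ne']) (by simp [hq0])] at h1
    simpa using h1
  have := ENNReal.lintegral_mul_le_Lp_mul_Lq μ hconj hf hg
  rw [eLpNorm_eq_lintegral_rpow_enorm_toReal (zero_lt_one.trans hp1).ne' hp',
    eLpNorm_eq_lintegral_rpow_enorm_toReal hq0 hqt]
  simpa using this

/-- The essential supremum of a slice exceeds `c` exactly when the slice of `{f > c}` has positive
measure, and the measure of a slice depends measurably on `t`. -/
lemma measurable_essSup_section [SFinite ν] {f : α × β → ℝ≥0∞} (hf : Measurable f) :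
    Measurable fun t => essSup (fun x => f (t, x)) ν := by
  refine measurable_of_Ioi fun c => ?_
  have h1 : (fun t => essSup (fun x => f (t, x)) ν) ⁻¹' Ioi c =
      {t | ν (Prod.mk t ⁻¹' (f ⁻¹' Ioi c)) ≠ 0} := by
    ext t
    simp only [mem_preimage, mem_Ioi, mem_ofPred_eq]
    rw [← not_le, not_iff_not]
    constructor
    · intro h
      refine measure_mono_null ?_ (ae_iff.1 (ae_le_essSup (f := fun x => f (t, x)) (μ := ν)))
      intro x hx hle
      exact absurd (hle.trans h) (not_le.2 hx)
    · intro h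
      refine essSup_le_of_ae_le c ?_
      rw [EventuallyLE, ae_iff]
      refine measure_mono_null ?_ h
      intro x hx
      exact not_le.1 hx
  rw [h1]
  exact (measurable_measure_prodMk_left (hf measurableSet_Ioi)) (measurableSet_singleton 0).compl

lemma aemeasurable_eLpNorm_section [SFinite μ] [SFinite ν] {f : α × β → ℝ≥0∞}
    (hf : AEMeasurable f (μ.prod ν)) (q : ℝ≥0∞) :
    AEMeasurable (fun t => eLpNorm (fun x => f (t, x)) q ν) μ := by
  have h1 : (fun t => eLpNorm (fun x => f (t, x)) q ν) =ᵐ[μ]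
      fun t => eLpNorm (fun x => hf.mk f (t, x)) q ν := by
    filter_upwards [Measure.ae_ae_of_ae_prod hf.ae_eq_mk] with t ht
    exact eLpNorm_congr_ae ht
  refine AEMeasurable.congr ?_ h1.symm
  have hm := hf.measurable_mk
  refine Measurable.aemeasurable ?_
  rcases eq_or_ne q 0 with rfl | h0
  · simp
  rcases eq_or_ne q ∞ with rfl | ht
  · simp only [eLpNorm_exponent_top, eLpNormEssSup, enorm_eq_self]
    exact measurable_essSup_section hm
  · simp only [eLpNorm_eq_lintegral_rpow_enorm_toReal h0 ht, enorm_eq_self]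
    exact (Measurable.lintegral_prod_right' (hm.pow_const _)).pow_const _

/-- Hölder's inequality for mixed norms. -/
theorem lintegral_prod_mul_le_mixed [SFinite μ] [SFinite ν] {p q p' q' : ℝ≥0∞} (hp : 1 ≤ p)
    (hq : 1 ≤ q) (hpp : p⁻¹ + p'⁻¹ = 1) (hqq : q⁻¹ + q'⁻¹ = 1) {f g : α × β → ℝ≥0∞}
    (hf : AEMeasurable f (μ.prod ν)) (hg : AEMeasurable g (μ.prod ν)) :
    ∫⁻ z, f z * g z ∂μ.prod ν ≤ eLpNorm (fun t => eLpNorm (fun x => f (t, x)) q ν) p μ *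
      eLpNorm (fun t => eLpNorm (fun x => g (t, x)) q' ν) p' μ := by
  rw [lintegral_prod (fun z => f z * g z) (hf.mul hg)]
  refine le_trans (lintegral_mono_ae ?_) (lintegral_mul_le_eLpNorm_mul_eLpNorm hp hpp
    (aemeasurable_eLpNorm_section hf q) (aemeasurable_eLpNorm_section hg q'))
  filter_upwards [hf.aestronglyMeasurable.prodMk_left, hg.aestronglyMeasurable.prodMk_left] with t h1 h2
  exact lintegral_mul_le_eLpNorm_mul_eLpNorm hq hqq h1.aemeasurable h2.aemeasurable

end Mixed

/-! ### Space-time -/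

section SpaceTime

variable {n : ℕ}

instance SpTime.isAddHaarMeasure : (volume : Measure (SpTime n)).IsAddHaarMeasure :=
  inferInstanceAs ((volume : Measure ℝ).prod (volume : Measure (Sp n))).IsAddHaarMeasure

lemma volume_restrict_prod (s : Set ℝ) (t : Set (Sp n)) :
    (volume : Measure (SpTime n)).restrict (s ×ˢ t) =
      (volume.restrict s).prod (volume.restrict t) := by
  rw [Measure.volume_eq_prod, Measure.prod_restrict]

lemma volume_restrict_prod_univ (s : Set ℝ) :
    (volume : Measure (SpTime n)).restrict (s ×ˢ (univ : Set (Sp n))) =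
      (volume.restrict s).prod volume := by
  rw [volume_restrict_prod, Measure.restrict_univ]

lemma timeDeriv_eq_fderiv {φ : SpTime n → ℝ} {z : SpTime n} (hφ : DifferentiableAt ℝ φ z) :
    timeDeriv φ z = fderiv ℝ φ z (1, 0) := by
  have h1 : HasDerivAt (fun s : ℝ => (s, z.2)) ((1 : ℝ), (0 : Sp n)) z.1 :=
    (hasDerivAt_id z.1).prodMk (hasDerivAt_const _ _)
  exact (HasFDerivAt.comp_hasDerivAt (f := fun s : ℝ => (s, z.2)) z.1 hφ.hasFDerivAt h1).deriv

lemma inner_spaceGrad_eq_fderiv {φ : SpTime n → ℝ} {z : SpTime n} (hφ : DifferentiableAt ℝ φ z)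
    (v : Sp n) : inner ℝ v (spaceGrad φ z) = fderiv ℝ φ z (0, v) := by
  have h1 : HasFDerivAt (fun y : Sp n => (z.1, y))
      (ContinuousLinearMap.inr ℝ ℝ (Sp n)) z.2 := hasFDerivAt_prodMk_right z.1 z.2
  have h2 := (HasFDerivAt.comp (f := fun y : Sp n => (z.1, y)) z.2 hφ.hasFDerivAt h1).fderiv
  rw [spaceGrad, gradient, real_inner_comm, InnerProductSpace.toDual_symm_apply]
  change fderiv ℝ (φ ∘ fun y : Sp n => (z.1, y)) z.2 v = _
  rw [h2]
  simp

/-- `∂f/∂t + b·∇f + d f` for a function `f` that need not be smooth. -/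
noncomputable def fadj (b : SpTime n → Sp n) (d : SpTime n → ℝ) (f : SpTime n → ℝ) (z : SpTime n) :
    ℝ := fderiv ℝ f z (1, b z) + d z * f z

lemma adjTransport_eq_fadj {φ : SpTime n → ℝ} {z : SpTime n} (hφ : DifferentiableAt ℝ φ z)
    (b : SpTime n → Sp n) (d : SpTime n → ℝ) : adjTransport b d φ z = fadj b d φ z := by
  rw [adjTransport, fadj, timeDeriv_eq_fderiv hφ, inner_spaceGrad_eq_fderiv hφ, ← map_add]
  simp

lemma IsTestFun.adjTransport_eq {U : Set (SpTime n)} {φ : SpTime n → ℝ} (hφ : IsTestFun U φ)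
    (b : SpTime n → Sp n) (d : SpTime n → ℝ) : adjTransport b d φ = fadj b d φ :=
  funext fun _ => adjTransport_eq_fadj ((hφ.1.differentiable (by simp)) _) b d

lemma fadj_eq_zero_of_notMem_tsupport {b : SpTime n → Sp n} {d f : SpTime n → ℝ} {z : SpTime n}
    (hz : z ∉ tsupport f) : fadj b d f z = 0 := by
  have h1 : fderiv ℝ f z = 0 := by
    by_contra h
    exact hz (support_fderiv_subset ℝ h)
  rw [fadj, h1, image_eq_zero_of_notMem_tsupport hz]
  simp

lemma abs_fadj_le {b : SpTime n → Sp n} {d f : SpTime n → ℝ} {z : SpTime n} {L C : ℝ}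
    (hL : ‖fderiv ℝ f z‖ ≤ L) (hC : |f z| ≤ C) : |fadj b d f z| ≤ L * (1 + ‖b z‖) + C * |d z| := by
  have hL0 : 0 ≤ L := (norm_nonneg _).trans hL
  have h1 : |fderiv ℝ f z (1, b z)| ≤ L * (1 + ‖b z‖) := by
    refine ((fderiv ℝ f z).le_opNorm (1, b z)).trans ?_
    have : ‖((1 : ℝ), b z)‖ ≤ 1 + ‖b z‖ := by
      rw [Prod.norm_def]
      exact max_le (by simp) (by simp)
    gcongr
  refine (abs_add_le _ _).trans (add_le_add h1 ?_)
  rw [abs_mul, mul_comm]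
  gcongr

lemma IsCompact.exists_subset_box {K : Set (SpTime n)} (hK : IsCompact K) {T : ℝ} (hT : 0 < T)
    (hKT : K ⊆ Iio T ×ˢ univ) : ∃ A R T' : ℝ, 0 < A ∧ 0 < R ∧ 0 < T' ∧ T' < T ∧
      K ⊆ Icc (-A) T' ×ˢ closedBall 0 R := by
  obtain ⟨R, hR⟩ := hK.isBounded.subset_closedBall 0
  have hnorm : ∀ z ∈ K, |z.1| ≤ R ∧ ‖z.2‖ ≤ R := fun z hz => by
    have := hR hz
    rw [mem_closedBall_zero_iff, Prod.norm_def] at this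
    exact ⟨(le_max_left _ _).trans this, (le_max_right _ _).trans this⟩
  obtain ⟨T', hT'0, hT', hle⟩ : ∃ T', 0 < T' ∧ T' < T ∧ ∀ z ∈ K, z.1 ≤ T' := by
    rcases K.eq_empty_or_nonempty with rfl | hne
    · exact ⟨T / 2, by linarith, by linarith, by simp⟩
    · obtain ⟨w, hw, hmax⟩ := hK.exists_isMaxOn hne continuous_fst.continuousOn
      have h1 : w.1 < T := (hKT hw).1
      exact ⟨max w.1 (T / 2), by positivity, max_lt h1 (by linarith),
        fun z hz => (hmax hz).trans (le_max_left _ _)⟩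
  refine ⟨|R| + 1, |R| + 1, T', by positivity, by positivity, hT'0, hT', fun z hz => ?_⟩
  obtain ⟨h1, h2⟩ := hnorm z hz
  have h3 := le_abs_self R
  refine ⟨⟨by linarith [(abs_le.1 h1).1], hle z hz⟩, ?_⟩
  rw [mem_closedBall_zero_iff]
  linarith

/-! ### Locally bounded functions -/

section Linfty

variable {X : Type*} [TopologicalSpace X] [MeasureSpace X]

lemma memLp_top_iff_exists_bound {α : Type*} [MeasurableSpace α] {μ : Measure α} {f : α → ℝ} :
    MemLp f ⊤ μ ↔ AEStronglyMeasurable f μ ∧ ∃ M, 0 ≤ M ∧ ∀ᵐ x ∂μ, |f x| ≤ M := by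
  constructor
  · intro h
    refine ⟨h.1, (eLpNorm f ⊤ μ).toReal, ENNReal.toReal_nonneg, ?_⟩
    have h2 := h.2
    rw [eLpNorm_exponent_top] at h2 ⊢
    filter_upwards [ae_le_eLpNormEssSup (f := f) (μ := μ)] with x hx
    rw [← Real.norm_eq_abs, ← toReal_enorm]
    exact ENNReal.toReal_mono h2.ne hx
  · rintro ⟨h1, M, -, hM⟩
    exact memLp_top_of_bound h1 M (by simpa [Real.norm_eq_abs] using hM)

lemma memLp_top_continuous_comp {α : Type*} [MeasurableSpace α] {μ : Measure α} {f : α → ℝ}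
    (hf : MemLp f ⊤ μ) {β : ℝ → ℝ} (hβ : Continuous β) : MemLp (fun x => β (f x)) ⊤ μ := by
  obtain ⟨h1, M, -, hM⟩ := memLp_top_iff_exists_bound.1 hf
  obtain ⟨C, hC⟩ := (isCompact_Icc (a := -M) (b := M)).exists_bound_of_continuousOn hβ.continuousOn
  refine memLp_top_of_bound (hβ.comp_aestronglyMeasurable h1) C ?_
  filter_upwards [hM] with x hx using hC _ (abs_le.1 hx)

lemma MemLinftyLoc.continuous_comp {f : X → ℝ} {U : Set X} (hf : MemLinftyLoc f U) {β : ℝ → ℝ}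
    (hβ : Continuous β) : MemLinftyLoc (fun x => β (f x)) U := fun K hK hKU =>
  memLp_top_continuous_comp (hf K hK hKU) hβ

lemma MemLinftyLoc.sub {f g : X → ℝ} {U : Set X} (hf : MemLinftyLoc f U) (hg : MemLinftyLoc g U) :
    MemLinftyLoc (fun x => f x - g x) U := fun K hK hKU => (hf K hK hKU).sub (hg K hK hKU)

/-- The product of a locally bounded function and an integrable function with compact support. -/
lemma MemLinftyLoc.integrable_mul [OpensMeasurableSpace X] [T2Space X] {f g : X → ℝ} {U K : Set X}
    (hf : MemLinftyLoc f U)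
    (hK : IsCompact K) (hKU : K ⊆ U) (hg : IntegrableOn g K) (hgK : ∀ x ∉ K, g x = 0) :
    Integrable fun x => f x * g x := by
  obtain ⟨h1, M, -, hM⟩ := memLp_top_iff_exists_bound.1 (hf K hK hKU)
  have h2 : IntegrableOn (fun x => f x * g x) K := Integrable.bdd_mul hg h1 hM
  refine (integrableOn_iff_integrable_of_support_subset fun x hx => ?_).1 h2
  by_contra h
  simp [hgK x h] at hx

end Linfty

/-! ### Integrability on bounded sets -/

variable {T : ℝ}

lemma MemMixedLp.integrable_smul {F : Type*} [NormedAddCommGroup F] [NormedSpace ℝ F]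
    {f : SpTime n → F} (hf : MemMixedLp T 1 ⊤ f) {w : Sp n → ℝ} (hw : Integrable w) :
    IntegrableOn (fun z : SpTime n => w z.2 • f z) (Ioo 0 T ×ˢ univ) := by
  have hf1 := hf.1
  rw [volume_restrict_prod_univ] at hf1
  rw [IntegrableOn, volume_restrict_prod_univ]
  have hwm : AEStronglyMeasurable (fun z : SpTime n => w z.2)
      ((volume.restrict (Ioo 0 T)).prod volume) := hw.1.comp_snd
  refine ⟨hwm.smul hf1, ?_⟩
  rw [HasFiniteIntegral]
  have h1 := lintegral_prod_mul_le_mixed (μ := volume.restrict (Ioo 0 T))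
    (ν := (volume : Measure (Sp n))) (p := 1) (q := ⊤) (p' := ⊤) (q' := 1) le_rfl le_top (by simp)
    (by simp) hf1.enorm hwm.enorm
  refine lt_of_le_of_lt (le_trans (le_of_eq ?_) h1) (ENNReal.mul_lt_top ?_ ?_)
  · refine lintegral_congr fun z => ?_
    rw [enorm_smul, mul_comm]
  · simpa only [eLpNorm_enorm] using hf.2
  · refine lt_of_le_of_lt (b := ∫⁻ x, ‖w x‖ₑ) ?_ hw.2
    rw [eLpNorm_exponent_top, eLpNormEssSup]
    refine essSup_le_of_ae_le _ (Eventually.of_forall fun t => ?_)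
    simp [eLpNorm_one_eq_lintegral_enorm]

lemma MemMixedLp.integrableOn_box {F : Type*} [NormedAddCommGroup F] [NormedSpace ℝ F]
    {f : SpTime n → F} (hf : MemMixedLp T 1 ⊤ f) (R : ℝ) :
    IntegrableOn f (Ioo 0 T ×ˢ closedBall 0 R) := by
  have hw : Integrable ((closedBall (0 : Sp n) R).indicator fun _ => (1 : ℝ)) :=
    (integrable_indicator_iff measurableSet_closedBall).2
      (integrableOn_const measure_closedBall_lt_top.ne)
  have h1 := (hf.integrable_smul hw).mono_set
    (prod_mono_right (s := Ioo 0 T) (subset_univ (closedBall (0 : Sp n) R)))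
  refine h1.congr_fun (fun z hz => ?_) (measurableSet_Ioo.prod measurableSet_closedBall)
  simp only
  rw [indicator_of_mem hz.2, one_smul]

/-- On a ball the factor `1 + |x|` is bounded. The decomposition thus makes `b` integrable up to the
times 0 and `T`, beyond local integrability in the open strip. -/
lemma integrableOn_box_of_decay {b b₁ b₂ : SpTime n → Sp n}
    (h₁ : IntegrableOn b₁ (Ioo 0 T ×ˢ univ)) (h₂ : MemMixedLp T 1 ⊤ b₂)
    (hb : ∀ᵐ z ∂(volume.restrict (Ioo 0 T ×ˢ (univ : Set (Sp n)))),
      (1 + ‖z.2‖)⁻¹ • b z = b₁ z + b₂ z) (R : ℝ) :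
    IntegrableOn b (Ioo 0 T ×ˢ closedBall 0 R) := by
  have hsub := prod_mono_right (s := Ioo 0 T) (subset_univ (closedBall (0 : Sp n) R))
  have h3 : IntegrableOn (fun z => b₁ z + b₂ z) (Ioo 0 T ×ˢ closedBall 0 R) :=
    (h₁.mono_set hsub).add (h₂.integrableOn_box R)
  have h4 : IntegrableOn (fun z : SpTime n => (1 + ‖z.2‖) • (b₁ z + b₂ z))
      (Ioo 0 T ×ˢ closedBall 0 R) := by
    refine Integrable.bdd_smul (φ := fun z : SpTime n => 1 + ‖z.2‖) (C := 1 + R) h3 ?_ ?_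
    · exact (by fun_prop : Continuous fun z : SpTime n => 1 + ‖z.2‖).aestronglyMeasurable
    · refine (ae_restrict_iff' (measurableSet_Ioo.prod measurableSet_closedBall)).2
        (Eventually.of_forall fun z hz => ?_)
      have := mem_closedBall_zero_iff.1 hz.2
      rw [Real.norm_of_nonneg (by positivity)]
      linarith
  refine h4.congr ?_
  filter_upwards [ae_restrict_of_ae_restrict_of_subset hsub hb] with z hz
  rw [← hz, smul_smul, mul_inv_cancel₀ (by positivity), one_smul]

lemma measurableSet_box (s : Set ℝ) (hs : MeasurableSet s) (R : ℝ) :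
    MeasurableSet (s ×ˢ closedBall (0 : Sp n) R) := hs.prod measurableSet_closedBall

lemma ae_fst_ne_zero : ∀ᵐ z : SpTime n, z.1 ≠ 0 := by
  rw [Measure.volume_eq_prod]
  exact Measure.quasiMeasurePreserving_fst.ae (Measure.ae_ne volume 0)

/-- `zeroExt` keeps the values of `f` at time 0, but this slice is a null set. -/
lemma zeroExt_ae_eq_indicator {F : Type*} [Zero F] (f : SpTime n → F) :
    ∀ᵐ z : SpTime n, z.1 < T → zeroExt f z = (Ioo 0 T ×ˢ (univ : Set (Sp n))).indicator f z := by
  filter_upwards [ae_fst_ne_zero] with z hz hzT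
  rcases lt_or_gt_of_ne hz with h | h
  · rw [zeroExt, if_pos h, indicator_of_notMem]
    exact fun h' => absurd h'.1.1 (not_lt.2 h.le)
  · rw [zeroExt, if_neg (not_lt.2 h.le), indicator_of_mem]
    exact ⟨⟨h, hzT⟩, mem_univ _⟩

lemma integrableOn_indicator_box {F : Type*} [NormedAddCommGroup F] {f : SpTime n → F}
    (hf : ∀ R, IntegrableOn f (Ioo 0 T ×ˢ closedBall 0 R)) (R : ℝ) :
    IntegrableOn ((Ioo 0 T ×ˢ (univ : Set (Sp n))).indicator f) (univ ×ˢ closedBall 0 R) := by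
  rw [integrableOn_indicator_iff (measurableSet_Ioo.prod MeasurableSet.univ)]
  refine (hf R).mono_set ?_
  rw [prod_inter_prod, inter_univ, univ_inter]

lemma locallyIntegrable_indicator {F : Type*} [NormedAddCommGroup F] {f : SpTime n → F}
    (hf : ∀ R, IntegrableOn f (Ioo 0 T ×ˢ closedBall 0 R)) :
    LocallyIntegrable ((Ioo 0 T ×ˢ (univ : Set (Sp n))).indicator f) := by
  rw [locallyIntegrable_iff]
  intro K hK
  obtain ⟨R, hR⟩ := hK.isBounded.subset_closedBall 0
  refine (integrableOn_indicator_box hf R).mono_set fun z hz => ⟨mem_univ _, ?_⟩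
  have := hR hz
  rw [mem_closedBall_zero_iff, Prod.norm_def] at this
  exact mem_closedBall_zero_iff.2 ((le_max_right _ _).trans this)

lemma integrableOn_zeroExt {F : Type*} [NormedAddCommGroup F] {f : SpTime n → F}
    (hf : ∀ R, IntegrableOn f (Ioo 0 T ×ˢ closedBall 0 R)) {K : Set (SpTime n)} (hK : IsCompact K)
    (hKT : K ⊆ Iio T ×ˢ univ) : IntegrableOn (zeroExt f) K := by
  refine ((locallyIntegrable_iff.1 (locallyIntegrable_indicator hf)) K hK).congr ?_
  rw [EventuallyEq, ae_restrict_iff' hK.measurableSet]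
  filter_upwards [zeroExt_ae_eq_indicator (T := T) f] with z hz hzK
  exact (hz (hKT hzK).1).symm

end SpaceTime

section Extension

variable {n : ℕ} {T : ℝ}

/-! ### Extension of weak solutions to negative times -/

lemma IsTestFun.exists_lipschitz {U : Set (SpTime n)} {φ : SpTime n → ℝ} (hφ : IsTestFun U φ) :
    ∃ (L : NNReal) (C : ℝ), LipschitzWith L φ ∧ ∀ z, |φ z| ≤ C := by
  obtain ⟨L, hL⟩ := ContDiff.lipschitzWith_of_hasCompactSupport hφ.2.1 hφ.1 (by simp)
  obtain ⟨C, hC⟩ := hφ.2.1.exists_bound_of_continuous hφ.1.continuous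
  exact ⟨L, C, hL, hC⟩

lemma aestronglyMeasurable_fadj {B : SpTime n → Sp n} {D f : SpTime n → ℝ} (hf : Continuous f)
    {μ : Measure (SpTime n)} (hB : AEStronglyMeasurable B μ) (hD : AEStronglyMeasurable D μ) :
    AEStronglyMeasurable (fadj B D f) μ := by
  refine AEStronglyMeasurable.add ?_ (hD.mul hf.aestronglyMeasurable)
  exact isBoundedBilinearMap_apply.continuous.comp_aestronglyMeasurable
    ((measurable_fderiv ℝ f).aestronglyMeasurable.prodMk (aestronglyMeasurable_const.prodMk hB))

lemma integrableOn_fadj {B : SpTime n → Sp n} {D f : SpTime n → ℝ} {L : NNReal}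
    (hf : LipschitzWith L f) {C : ℝ} (hC : ∀ z, |f z| ≤ C) {K : Set (SpTime n)}
    (hK : volume K < ⊤) (hB : IntegrableOn B K) (hD : IntegrableOn D K) :
    IntegrableOn (fadj B D f) K := by
  have h1 : IntegrableOn (fun z => L * (1 + ‖B z‖) + C * |D z|) K :=
    (((integrableOn_const hK.ne).add hB.norm).const_mul _).add (hD.norm.const_mul C)
  exact h1.mono' (aestronglyMeasurable_fadj hf.continuous hB.1 hD.1)
    (Eventually.of_forall fun z => abs_fadj_le (norm_fderiv_le_of_lipschitz ℝ hf) (hC z))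

/-- The extension of `u` by its initial data to negative times. -/
noncomputable def pastExt (u₀ : Sp n → ℝ) (u : SpTime n → ℝ) (z : SpTime n) : ℝ :=
  if z.1 < 0 then u₀ z.2 else u z

lemma comp_pastExt (β : ℝ → ℝ) (u₀ : Sp n → ℝ) (u : SpTime n → ℝ) :
    (fun z => β (pastExt u₀ u z)) = pastExt (fun x => β (u₀ x)) (fun z => β (u z)) := by
  funext z
  simp only [pastExt]
  split_ifs <;> rfl

lemma memLinftyLoc_pastExt (hT : 0 < T) {u₀ : Sp n → ℝ} {u : SpTime n → ℝ}
    (hu₀ : MemLinftyLoc u₀ univ) (hu : MemLinftyLoc u (Ico 0 T ×ˢ univ)) :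
    MemLinftyLoc (pastExt u₀ u) (Iio T ×ˢ univ) := by
  classical
  intro K hK hKT
  obtain ⟨A, R, T', -, -, -, -, hbox⟩ := hK.exists_subset_box hT hKT
  have hs : MeasurableSet {z : SpTime n | z.1 < 0} := measurableSet_lt measurable_fst measurable_const
  have heq : pastExt u₀ u = {z : SpTime n | z.1 < 0}.piecewise (fun z => u₀ z.2) u := by
    funext z
    simp only [pastExt, Set.piecewise, mem_ofPred_eq]
  rw [heq]
  refine MemLp.piecewise hs ?_ ?_
  · obtain ⟨h1, M, -, hM⟩ := memLp_top_iff_exists_bound.1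
      (hu₀ (closedBall 0 R) (isCompact_closedBall _ _) (subset_univ _))
    have hsub : {z : SpTime n | z.1 < 0} ∩ K ⊆ univ ×ˢ closedBall 0 R :=
      fun z hz => ⟨mem_univ _, (hbox hz.2).2⟩
    have h2 : AEStronglyMeasurable (fun z : SpTime n => u₀ z.2)
        (volume.restrict (univ ×ˢ closedBall 0 R)) := by
      rw [volume_restrict_prod]
      exact h1.comp_snd
    have h3 : ∀ᵐ z : SpTime n ∂(volume.restrict (univ ×ˢ closedBall 0 R)), |u₀ z.2| ≤ M := by
      rw [volume_restrict_prod]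
      exact Measure.quasiMeasurePreserving_snd.ae hM
    rw [Measure.restrict_restrict hs]
    exact memLp_top_of_bound (h2.mono_measure (Measure.restrict_mono hsub le_rfl)) M
      (ae_restrict_of_ae_restrict_of_subset hsub (by simpa [Real.norm_eq_abs] using h3))
  · rw [Measure.restrict_restrict hs.compl, inter_comm]
    refine hu _ (hK.inter_right ?_) ?_
    · have : {z : SpTime n | z.1 < 0}ᶜ = {z | 0 ≤ z.1} := by ext; simp
      rw [this]
      exact isClosed_le continuous_const continuous_fst
    · rintro z ⟨hzK, hz⟩
      exact ⟨⟨not_lt.1 hz, (hKT hzK).1⟩, mem_univ _⟩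

lemma integrable_mul_fadj {W : SpTime n → ℝ} (hW : MemLinftyLoc W (Iio T ×ˢ univ))
    {b : SpTime n → Sp n} {d : SpTime n → ℝ}
    (hb : ∀ R, IntegrableOn b (Ioo 0 T ×ˢ closedBall 0 R))
    (hd : ∀ R, IntegrableOn d (Ioo 0 T ×ˢ closedBall 0 R)) {f : SpTime n → ℝ} {L : NNReal}
    (hf : LipschitzWith L f) (hc : HasCompactSupport f) (hfT : tsupport f ⊆ Iio T ×ˢ univ) :
    Integrable fun z => W z * fadj (zeroExt b) (zeroExt d) f z := by
  obtain ⟨C, hC⟩ := hc.exists_bound_of_continuous hf.continuous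
  exact hW.integrable_mul hc hfT (integrableOn_fadj hf hC hc.measure_lt_top
    (integrableOn_zeroExt hb hc hfT) (integrableOn_zeroExt hd hc hfT))
    fun z hz => fadj_eq_zero_of_notMem_tsupport hz

/-- At negative times the extended field and its divergence vanish and only `u₀ ∂ₜφ` remains. Its
integral in time over `(-∞,0)` is `u₀ φ(0,·)`, which is the initial term. -/
lemma setIntegral_past_eq (hT : 0 < T) {u₀ : Sp n → ℝ} {u : SpTime n → ℝ}
    (hu₀ : MemLinftyLoc u₀ univ) (hu : MemLinftyLoc u (Ico 0 T ×ˢ univ))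
    {b : SpTime n → Sp n} {d : SpTime n → ℝ}
    (hb : ∀ R, IntegrableOn b (Ioo 0 T ×ˢ closedBall 0 R))
    (hd : ∀ R, IntegrableOn d (Ioo 0 T ×ˢ closedBall 0 R)) {φ : SpTime n → ℝ}
    (hφ : IsTestFun (Iio T ×ˢ univ) φ) :
    ∫ z in Iio T ×ˢ univ, pastExt u₀ u z * adjTransport (zeroExt b) (zeroExt d) φ z =
      (∫ x, u₀ x * φ (0, x)) + ∫ z in Ioo 0 T ×ˢ univ, u z * adjTransport b d φ z := by
  obtain ⟨L, C, hL, -⟩ := hφ.exists_lipschitz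
  have hint : Integrable fun z =>
      pastExt u₀ u z * adjTransport (zeroExt b) (zeroExt d) φ z := by
    rw [hφ.adjTransport_eq]
    exact integrable_mul_fadj (memLinftyLoc_pastExt hT hu₀ hu) hb hd hL hφ.2.1 hφ.2.2
  have hsplit : (Iio T ×ˢ (univ : Set (Sp n))) = Iio 0 ×ˢ univ ∪ Ico 0 T ×ˢ univ := by
    rw [← union_prod, Iio_union_Ico_eq_Iio hT.le]
  have hdisj : Disjoint (Iio (0 : ℝ) ×ˢ (univ : Set (Sp n))) (Ico 0 T ×ˢ univ) :=
    Set.disjoint_left.2 fun z hz hz' => absurd hz'.1.1 (not_le.2 hz.1)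
  rw [hsplit, setIntegral_union hdisj (measurableSet_Ico.prod MeasurableSet.univ)
    hint.integrableOn hint.integrableOn]
  congr 1
  · have h1 : ∫ z in Iio 0 ×ˢ univ, pastExt u₀ u z * adjTransport (zeroExt b) (zeroExt d) φ z =
        ∫ z in Iio 0 ×ˢ univ, u₀ z.2 * timeDeriv φ z := by
      refine setIntegral_congr_fun (measurableSet_Iio.prod MeasurableSet.univ) fun z hz => ?_
      have hz : z.1 < 0 := hz.1
      simp [pastExt, adjTransport, zeroExt, hz]
    have h2 : IntegrableOn (fun z : SpTime n => u₀ z.2 * timeDeriv φ z) (Iio 0 ×ˢ univ) := by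
      refine hint.integrableOn.congr_fun (fun z hz => ?_)
        (measurableSet_Iio.prod MeasurableSet.univ)
      have hz : z.1 < 0 := hz.1
      simp [pastExt, adjTransport, zeroExt, hz]
    rw [h1, volume_restrict_prod_univ, integral_prod_symm]
    · refine integral_congr_ae (Eventually.of_forall fun x => ?_)
      simp only [timeDeriv]
      rw [integral_const_mul, ← integral_Iic_eq_integral_Iio]
      congr 1
      have hc : Topology.IsClosedEmbedding fun s : ℝ => (s, x) :=
        (Isometry.of_dist_eq fun s t => by simp [Prod.dist_eq]).isClosedEmbedding
      exact HasCompactSupport.integral_Iic_deriv_eq (f := fun s => φ (s, x))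
        ((hφ.1.comp (by fun_prop : ContDiff ℝ ∞ fun s : ℝ => (s, x))).of_le (by simp))
        (hφ.2.1.comp_isClosedEmbedding hc) 0
    · rw [← volume_restrict_prod_univ]
      exact h2
  · have hae : (Ico 0 T ×ˢ (univ : Set (Sp n)) : Set (SpTime n)) =ᵐ[volume] Ioo 0 T ×ˢ univ := by
      filter_upwards [ae_fst_ne_zero (n := n)] with z hz
      refine propext ⟨fun h => ⟨⟨lt_of_le_of_ne h.1.1 (Ne.symm hz), h.1.2⟩, h.2⟩,
        fun h => ⟨⟨h.1.1.le, h.1.2⟩, h.2⟩⟩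
    rw [setIntegral_congr_set hae]
    refine setIntegral_congr_fun (measurableSet_Ioo.prod MeasurableSet.univ) fun z hz => ?_
    have hz : ¬ z.1 < 0 := not_lt.2 hz.1.1.le
    simp [pastExt, adjTransport, zeroExt, hz]

/-- Weak solutions with initial data are the weak solutions on `(-∞, T)` equal to the initial data
at negative times. -/
lemma isWeakSol_iff_past (hT : 0 < T) {u₀ : Sp n → ℝ} {u : SpTime n → ℝ}
    (hu₀ : MemLinftyLoc u₀ univ) (hu : MemLinftyLoc u (Ico 0 T ×ˢ univ))
    {b : SpTime n → Sp n} {d : SpTime n → ℝ}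
    (hb : ∀ R, IntegrableOn b (Ioo 0 T ×ˢ closedBall 0 R))
    (hd : ∀ R, IntegrableOn d (Ioo 0 T ×ˢ closedBall 0 R)) :
    IsWeakSol T b d u₀ u ↔ IsWeakSolPast T (zeroExt b) (zeroExt d) (pastExt u₀ u) := by
  constructor
  · rintro ⟨-, -, h⟩
    exact ⟨memLinftyLoc_pastExt hT hu₀ hu, fun φ hφ => by
      rw [setIntegral_past_eq hT hu₀ hu hb hd hφ]; exact h φ hφ⟩
  · rintro ⟨-, h⟩
    exact ⟨hu₀, hu, fun φ hφ => by
      rw [← setIntegral_past_eq hT hu₀ hu hb hd hφ]; exact h φ hφ⟩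

/-! ### Passing from smooth to Lipschitz test functions -/

/-- Needed because cutoffs built from `d_S` are only Lipschitz. The mollified test functions share a
compact support and a gradient bound, so local integrability of the coefficients dominates the
integrands, and the gradients converge almost everywhere. -/
lemma setIntegral_fadj_eq_zero_of_lipschitz {W : SpTime n → ℝ}
    (hW : MemLinftyLoc W (Iio T ×ˢ univ)) {b : SpTime n → Sp n} {d : SpTime n → ℝ}
    (hb : ∀ R, IntegrableOn b (Ioo 0 T ×ˢ closedBall 0 R))
    (hd : ∀ R, IntegrableOn d (Ioo 0 T ×ˢ closedBall 0 R)) {V : Set (SpTime n)} (hV : IsOpen V)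
    (hVT : V ⊆ Iio T ×ˢ univ)
    (h : ∀ φ, IsTestFun V φ →
      ∫ z in Iio T ×ˢ univ, W z * adjTransport (zeroExt b) (zeroExt d) φ z = 0)
    {f : SpTime n → ℝ} {L : NNReal} (hf : LipschitzWith L f) (hc : HasCompactSupport f)
    (hfV : tsupport f ⊆ V) :
    ∫ z in Iio T ×ˢ univ, W z * fadj (zeroExt b) (zeroExt d) f z = 0 := by
  obtain ⟨K, hK, hKV, φ, hφ, hsupp, ⟨C, hC⟩, hφL, hlim, hlim'⟩ :=
    hf.exists_contDiff_approx volume hc hV hfV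
  have hKT := hKV.trans hVT
  have htest : ∀ k, IsTestFun V (φ k) := fun k =>
    ⟨hφ k, hK.of_isClosed_subset (isClosed_tsupport _) (hsupp k), (hsupp k).trans hKV⟩
  obtain ⟨hWm, M, -, hM⟩ := memLp_top_iff_exists_bound.1 (hW K hK hKT)
  set B := zeroExt b
  set D := zeroExt d
  have hBK : IntegrableOn B K := integrableOn_zeroExt hb hK hKT
  have hDK : IntegrableOn D K := integrableOn_zeroExt hd hK hKT
  have hbound : IntegrableOn (fun z => M * (L * (1 + ‖B z‖) + C * |D z|)) K :=
    ((((integrableOn_const hK.measure_lt_top.ne).add hBK.norm).const_mul _).add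
      (hDK.norm.const_mul C)).const_mul M
  have hzero : ∀ᵐ z : SpTime n, z ∉ K → ∀ k, fadj B D (φ k) z = 0 :=
    Eventually.of_forall fun z hz k =>
      fadj_eq_zero_of_notMem_tsupport fun h => hz (hsupp k h)
  have hT := tendsto_integral_of_dominated_convergence
    (μ := volume.restrict (Iio T ×ˢ (univ : Set (Sp n))))
    (F := fun k z => W z * fadj B D (φ k) z) (f := fun z => W z * fadj B D f z)
    (K.indicator fun z => M * (L * (1 + ‖B z‖) + C * |D z|)) (fun k => ?_) ?_ (fun k => ?_) ?_
  · refine tendsto_nhds_unique hT (tendsto_const_nhds.congr fun k => ?_)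
    rw [← h (φ k) (htest k), (htest k).adjTransport_eq]
  · obtain ⟨L', -, hL', -⟩ := (htest k).exists_lipschitz
    exact (integrable_mul_fadj hW hb hd hL' (htest k).2.1
      ((htest k).2.2.trans hVT)).aestronglyMeasurable.restrict
  · exact ((integrable_indicator_iff hK.measurableSet).2 hbound).integrableOn
  · refine ae_restrict_of_ae ?_
    rw [ae_restrict_iff' hK.measurableSet] at hM
    filter_upwards [hzero, hM] with z hz hMz
    by_cases hzK : z ∈ K
    · rw [indicator_of_mem hzK, norm_mul]
      have := (abs_nonneg _).trans (hMz hzK)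
      exact mul_le_mul (hMz hzK) (abs_fadj_le (hφL k z) (hC k z)) (norm_nonneg _) this
    · rw [indicator_of_notMem hzK, hz hzK k]
      simp
  · refine ae_restrict_of_ae ?_
    filter_upwards [hlim'] with z hz
    refine Tendsto.const_mul _ (Tendsto.add ?_ ((hlim z).const_mul _))
    exact ((ContinuousLinearMap.apply ℝ ℝ ((1 : ℝ), B z)).continuous.tendsto _).comp hz

end Extension

section Distance

variable {n : ℕ} {T : ℝ} {S : Set (SpTime n)}

/-! ### The distance to the singular set -/

/-- Passing to `WithLp 2` turns the spelled-out Euclidean distance into a metric one, so that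
continuity and the Lipschitz property carry over. -/
lemma eDistTo_eq_infEDist (S : Set (SpTime n)) (z : SpTime n) :
    eDistTo S z = infEDist (WithLp.toLp 2 z) (WithLp.toLp 2 '' S) := by
  rw [eDistTo, infEDist, iInf_image]
  refine iInf_congr fun w => iInf_congr fun _ => ?_
  rw [edist_dist, WithLp.prod_dist_eq_of_L2]
  simp [dist_eq_norm]

lemma distTo_eq_infDist (S : Set (SpTime n)) (z : SpTime n) :
    distTo S z = infDist (WithLp.toLp 2 z) (WithLp.toLp 2 '' S) := by
  rw [distTo, eDistTo_eq_infEDist, infDist]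

lemma exists_lipschitzWith_distTo (S : Set (SpTime n)) : ∃ L, LipschitzWith L (distTo S) := by
  have h1 := (lipschitz_infDist_pt (WithLp.toLp 2 '' S)).comp
    (WithLp.prod_lipschitzWith_toLp 2 ℝ (Sp n))
  have h2 : distTo S = (fun x => infDist x (WithLp.toLp 2 '' S)) ∘ WithLp.toLp 2 :=
    funext fun z => distTo_eq_infDist S z
  exact ⟨_, h2 ▸ h1⟩

lemma continuous_eDistTo (S : Set (SpTime n)) : Continuous (eDistTo S) := by
  have : eDistTo S = fun z => infEDist (WithLp.toLp 2 z) (WithLp.toLp 2 '' S) :=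
    funext fun z => eDistTo_eq_infEDist S z
  rw [this]
  exact continuous_infEDist.comp (WithLp.prod_continuous_toLp 2 ℝ (Sp n))

lemma eDistTo_ne_top (hne : S.Nonempty) (z : SpTime n) : eDistTo S z ≠ ⊤ := by
  rw [eDistTo_eq_infEDist]
  exact infEDist_ne_top (hne.image _)

lemma ofReal_distTo (hne : S.Nonempty) (z : SpTime n) :
    ENNReal.ofReal (distTo S z) = eDistTo S z := ENNReal.ofReal_toReal (eDistTo_ne_top hne z)

lemma distTo_nonneg (S : Set (SpTime n)) (z : SpTime n) : 0 ≤ distTo S z := ENNReal.toReal_nonneg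

lemma eDistTo_eq_zero_of_mem {z : SpTime n} (hz : z ∈ S) : eDistTo S z = 0 := by
  rw [eDistTo_eq_infEDist]
  exact infEDist_zero_of_mem (mem_image_of_mem _ hz)

lemma distTo_eq_zero_of_mem {z : SpTime n} (hz : z ∈ S) : distTo S z = 0 := by
  rw [distTo, eDistTo_eq_zero_of_mem hz, ENNReal.toReal_zero]

/-- `S` lies at nonnegative times, so reflecting a negative time brings the point closer to `S`.
This transfers integrability of `1/d_S` from `(0,T)` to `(-T,0)`. -/
lemma eDistTo_reflect_le (hST : S ⊆ Icc 0 T ×ˢ univ) {z : SpTime n} (hz : z.1 ≤ 0) :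
    eDistTo S (-z.1, z.2) ≤ eDistTo S z := by
  refine iInf₂_mono fun w hw => ENNReal.ofReal_le_ofReal (Real.sqrt_le_sqrt ?_)
  have h1 : 0 ≤ w.1 := (hST hw).1.1
  gcongr ?_ + _
  simp only
  nlinarith

lemma ofReal_neg_fst_le_eDistTo (hST : S ⊆ Icc 0 T ×ˢ univ) {z : SpTime n} (hz : z.1 ≤ 0) :
    ENNReal.ofReal (-z.1) ≤ eDistTo S z := by
  refine le_iInf₂ fun w hw => ENNReal.ofReal_le_ofReal (Real.le_sqrt_of_sq_le ?_)
  have h1 : 0 ≤ w.1 := (hST hw).1.1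
  nlinarith [sq_nonneg ‖z.2 - w.2‖]

lemma MemMixedLpLoc.one (T : ℝ) (p q : ℝ≥0∞) : MemMixedLpLoc (n := n) T p q fun _ => (1 : ℝ) := by
  refine ⟨aestronglyMeasurable_const, fun K hK => ?_⟩
  have : IsFiniteMeasure (volume.restrict K) := ⟨by simpa using hK.measure_lt_top⟩
  have h1 : eLpNorm (fun _ : Sp n => (1 : ℝ)) q (volume.restrict K) < ⊤ := (memLp_const 1).2
  lift eLpNorm (fun _ : Sp n => (1 : ℝ)) q (volume.restrict K) to NNReal using h1.ne with c
  have h2 : eLpNorm (fun _ : ℝ => (c : ℝ)) p (volume.restrict (Ioo 0 T)) < ⊤ := (memLp_const _).2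
  refine lt_of_le_of_lt (eLpNorm_mono_enorm fun t => ?_) h2
  simp

/-- The product of functions in dual mixed spaces is integrable on bounded sets. -/
lemma MemMixedLpLoc.lintegral_mul_lt_top {p q p' q' : ℝ≥0∞} (hp : 1 ≤ p) (hq : 1 ≤ q)
    (hpp : p⁻¹ + p'⁻¹ = 1) (hqq : q⁻¹ + q'⁻¹ = 1) {f : SpTime n → ℝ} {g : SpTime n → ℝ≥0∞}
    (hf : MemMixedLpLoc T p q f) (hg : MemMixedLpLoc T p' q' g) {K : Set (Sp n)}
    (hK : IsCompact K) : ∫⁻ z in Ioo 0 T ×ˢ K, ‖f z‖ₑ * g z < ⊤ := by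
  have hsub : Ioo 0 T ×ˢ K ⊆ Ioo 0 T ×ˢ univ := prod_mono_right (subset_univ K)
  have h1 := (hf.1.mono_measure (Measure.restrict_mono hsub le_rfl)).enorm
  have h2 := hg.1.aemeasurable.mono_measure (Measure.restrict_mono hsub le_rfl)
  rw [volume_restrict_prod] at h1 h2 ⊢
  refine (lintegral_prod_mul_le_mixed hp hq hpp hqq h1 h2).trans_lt (ENNReal.mul_lt_top ?_ ?_)
  · simpa only [eLpNorm_enorm] using hf.2 K hK
  · exact hg.2 K hK

/-- `1 / d_S` is integrable on bounded subsets of `(-∞, T) × ℝⁿ`. -/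
lemma lintegral_inv_eDistTo_lt_top (hT : 0 < T) (hST : S ⊆ Icc 0 T ×ˢ univ) {p q p' q' : ℝ≥0∞}
    (hp : 1 ≤ p) (hq : 1 ≤ q) (hpp : p⁻¹ + p'⁻¹ = 1) (hqq : q⁻¹ + q'⁻¹ = 1)
    (hg : MemMixedLpLoc T p' q' fun z => (eDistTo S z)⁻¹) (A : ℝ) {K : Set (Sp n)}
    (hK : IsCompact K) : ∫⁻ z in Ioo (-A) T ×ˢ K, (eDistTo S z)⁻¹ < ⊤ := by
  have hmeas : Measurable fun z : SpTime n => (eDistTo S z)⁻¹ :=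
    (continuous_eDistTo S).measurable.inv
  -- Positive times: Hölder's inequality against the constant 1, which lies in every local mixed
  -- space.
  have h1 : ∫⁻ z in Ioo 0 T ×ˢ K, (eDistTo S z)⁻¹ < ⊤ := by
    simpa using (MemMixedLpLoc.one T p q).lintegral_mul_lt_top hp hq hpp hqq hg hK
  have h2 : ∫⁻ z in Ioo (-T) 0 ×ˢ K, (eDistTo S z)⁻¹ < ⊤ := by
    refine lt_of_le_of_lt ?_ h1
    rw [volume_restrict_prod, volume_restrict_prod, lintegral_prod _ hmeas.aemeasurable,
      lintegral_prod _ hmeas.aemeasurable]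
    have h3 : ∀ f : ℝ → ℝ≥0∞, ∫⁻ t in Ioo (-T) 0, f (-t) = ∫⁻ t in Ioo 0 T, f t := fun f => by
      have h4 := (Measure.measurePreserving_neg (volume : Measure ℝ)).setLIntegral_comp_preimage_emb
        (Homeomorph.neg ℝ).measurableEmbedding f (Ioo 0 T)
      rw [← h4]
      simp
    rw [← h3 fun t => ∫⁻ x in K, (eDistTo S (t, x))⁻¹]
    refine setLIntegral_mono' measurableSet_Ioo fun t ht => lintegral_mono fun x => ?_
    exact ENNReal.inv_le_inv.2 (eDistTo_reflect_le hST (z := (t, x)) ht.2.le)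
  -- Reflection reaches back only to `-T`; before that the distance to `S` is at least `T`.
  have h3 : ∫⁻ z in Ioc (-A) (-T) ×ˢ K, (eDistTo S z)⁻¹ < ⊤ := by
    have hle : ∫⁻ z in Ioc (-A) (-T) ×ˢ K, (eDistTo S z)⁻¹ ≤
        ∫⁻ _ in Ioc (-A) (-T) ×ˢ K, (ENNReal.ofReal T)⁻¹ := by
      refine setLIntegral_mono' (measurableSet_Ioc.prod hK.measurableSet) fun z hz => ?_
      refine ENNReal.inv_le_inv.2 (le_trans (ENNReal.ofReal_le_ofReal ?_)
        (ofReal_neg_fst_le_eDistTo hST ?_))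
      · linarith [hz.1.2]
      · linarith [hz.1.2]
    refine lt_of_le_of_lt hle ?_
    rw [setLIntegral_const]
    refine ENNReal.mul_lt_top (by simpa using hT) ?_
    exact (measure_mono (prod_mono_left Ioc_subset_Icc_self)).trans_lt
      (isCompact_Icc.prod hK).measure_lt_top
  have hae : (Ioo (-A) T ×ˢ K : Set (SpTime n)) ≤ᵐ[volume]
      ((Ioc (-A) (-T) ×ˢ K ∪ Ioo (-T) 0 ×ˢ K) ∪ Ioo 0 T ×ˢ K : Set (SpTime n)) := by
    filter_upwards [ae_fst_ne_zero (n := n)] with z hz hzA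
    rcases lt_or_gt_of_ne hz with h | h
    · rcases le_or_gt z.1 (-T) with h' | h'
      · exact Or.inl (Or.inl ⟨⟨hzA.1.1, h'⟩, hzA.2⟩)
      · exact Or.inl (Or.inr ⟨⟨h', h⟩, hzA.2⟩)
    · exact Or.inr ⟨⟨h, hzA.1.2⟩, hzA.2⟩
  refine (lintegral_mono_set' hae).trans_lt ((lintegral_union_le _ _ _).trans_lt ?_)
  exact ENNReal.add_lt_top.2 ⟨(lintegral_union_le _ _ _).trans_lt
    (ENNReal.add_lt_top.2 ⟨h3, h2⟩), h1⟩

end Distance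

section Renormalization

variable {n : ℕ} {T : ℝ} {S : Set (SpTime n)}

/-! ### Renormalization across the singular set -/

lemma deriv_smoothTransition_eq_zero {x : ℝ} (hx : x < 0 ∨ 1 < x) :
    deriv Real.smoothTransition x = 0 := by
  rcases hx with hx | hx
  · have : Real.smoothTransition =ᶠ[𝓝 x] fun _ => 0 := by
      filter_upwards [gt_mem_nhds hx] with y hy using Real.smoothTransition.zero_of_nonpos hy.le
    rw [this.deriv_eq, deriv_const]
  · have : Real.smoothTransition =ᶠ[𝓝 x] fun _ => 1 := by
      filter_upwards [lt_mem_nhds hx] with y hy using Real.smoothTransition.one_of_one_le hy.le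
    rw [this.deriv_eq, deriv_const]

lemma exists_bound_deriv_smoothTransition :
    ∃ C : NNReal, ∀ x, ‖deriv Real.smoothTransition x‖ ≤ C := by
  have hcont : Continuous (deriv Real.smoothTransition) :=
    (Real.smoothTransition.contDiff (n := 1)).continuous_deriv le_rfl
  obtain ⟨C, hC⟩ := (isCompact_Icc (a := (0 : ℝ)) (b := 1)).exists_bound_of_continuousOn
    hcont.continuousOn
  refine ⟨C.toNNReal, fun x => ?_⟩
  by_cases hx : x ∈ Icc (0 : ℝ) 1
  · exact (hC x hx).trans (Real.le_coe_toNNReal C)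
  · rw [mem_Icc, not_and_or, not_le, not_le] at hx
    rw [deriv_smoothTransition_eq_zero hx]
    simp

lemma LipschitzWith.mul_of_bounded {X : Type*} [PseudoMetricSpace X] {f g : X → ℝ} {L L' : NNReal}
    {C C' : NNReal} (hf : LipschitzWith L f) (hg : LipschitzWith L' g) (hC : ∀ x, |f x| ≤ C)
    (hC' : ∀ x, |g x| ≤ C') : LipschitzWith (C * L' + C' * L) fun x => f x * g x := by
  refine LipschitzWith.of_dist_le_mul fun x y => ?_
  have h1 := hf.dist_le_mul x y
  have h2 := hg.dist_le_mul x y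
  rw [Real.dist_eq] at *
  have h3 : f x * g x - f y * g y = f x * (g x - g y) + g y * (f x - f y) := by ring
  rw [h3]
  refine (abs_add_le _ _).trans ?_
  rw [abs_mul, abs_mul]
  push_cast
  have h4 := mul_le_mul (hC x) h2 (abs_nonneg _) C.2
  have h5 := mul_le_mul (hC' y) h1 (abs_nonneg _) C'.2
  linarith

/-- The cutoff that vanishes near `S`. -/
noncomputable def cutoffOff (S : Set (SpTime n)) (k : ℕ) (z : SpTime n) : ℝ :=
  Real.smoothTransition (distTo S z * (k + 1) - 1)

lemma abs_cutoffOff_le_one (S : Set (SpTime n)) (k : ℕ) (z : SpTime n) :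
    |cutoffOff S k z| ≤ 1 := by
  rw [cutoffOff, abs_of_nonneg (Real.smoothTransition.nonneg _)]
  exact Real.smoothTransition.le_one _

lemma exists_lipschitzWith_cutoffOff (S : Set (SpTime n)) (k : ℕ) :
    ∃ L, LipschitzWith L (cutoffOff S k) := by
  obtain ⟨L, hL⟩ := exists_lipschitzWith_distTo S
  obtain ⟨C, hC⟩ := exists_bound_deriv_smoothTransition
  have h1 : LipschitzWith C Real.smoothTransition :=
    lipschitzWith_of_nnnorm_deriv_le
      ((Real.smoothTransition.contDiff (n := 1)).differentiable (by simp)) hC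
  have h2 : LipschitzWith (‖((k : ℝ) + 1)‖₊ * L) fun z => distTo S z * (k + 1) - 1 := by
    refine LipschitzWith.of_dist_le_mul fun x y => ?_
    have h := hL.dist_le_mul x y
    rw [Real.dist_eq] at h ⊢
    have h3 : distTo S x * (k + 1) - 1 - (distTo S y * (k + 1) - 1) =
        (k + 1) * (distTo S x - distTo S y) := by ring
    rw [h3, abs_mul]
    push_cast
    rw [Real.norm_eq_abs, mul_assoc]
    gcongr
  exact ⟨_, h1.comp h2⟩

lemma cutoffOff_eq_zero_of_distTo {k : ℕ} {z : SpTime n} (hz : distTo S z * (k + 1) ≤ 1) :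
    cutoffOff S k z = 0 := Real.smoothTransition.zero_of_nonpos (by linarith)

lemma cutoffOff_eq_one_of_distTo {k : ℕ} {z : SpTime n} (hz : 2 ≤ distTo S z * (k + 1)) :
    cutoffOff S k z = 1 := Real.smoothTransition.one_of_one_le (by linarith)

/-- The cutoff is nonzero only where `d_S (k+1) > 1`; the closure of this set keeps `d_S (k+1) ≥ 1`
and therefore misses `S`. -/
lemma tsupport_mul_cutoffOff_subset (φ : SpTime n → ℝ) (k : ℕ) :
    tsupport (fun z => φ z * cutoffOff S k z) ⊆ tsupport φ \ S := by
  have hcl : IsClosed {z : SpTime n | 1 ≤ distTo S z * (k + 1)} := by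
    obtain ⟨L, hL⟩ := exists_lipschitzWith_distTo S
    exact isClosed_le continuous_const (hL.continuous.mul continuous_const)
  have h1 : tsupport (fun z => φ z * cutoffOff S k z) ⊆
      tsupport φ ∩ {z | 1 ≤ distTo S z * (k + 1)} := by
    refine closure_minimal (fun z hz => ⟨subset_tsupport _ (left_ne_zero_of_mul hz), ?_⟩)
      ((isClosed_tsupport _).inter hcl)
    by_contra h
    exact right_ne_zero_of_mul hz (cutoffOff_eq_zero_of_distTo (not_le.1 h).le)
  refine fun z hz => ⟨(h1 hz).1, fun hzS => ?_⟩
  have := (h1 hz).2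
  rw [mem_ofPred_eq, distTo_eq_zero_of_mem hzS] at this
  norm_num at this

lemma fadj_mul_cutoffOff {φ : SpTime n → ℝ} {z : SpTime n} (hφ : DifferentiableAt ℝ φ z)
    (hd : DifferentiableAt ℝ (distTo S) z) (B : SpTime n → Sp n) (D : SpTime n → ℝ) (k : ℕ) :
    fadj B D (fun z => φ z * cutoffOff S k z) z = cutoffOff S k z * fadj B D φ z +
      φ z * (deriv Real.smoothTransition (distTo S z * (k + 1) - 1) * (k + 1)) *
        fderiv ℝ (distTo S) z (1, B z) := by
  have h1 : HasFDerivAt (fun z => distTo S z * (k + 1) - 1)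
      (((k : ℝ) + 1) • fderiv ℝ (distTo S) z) z := (hd.hasFDerivAt.mul_const _).sub_const 1
  have h2 := (((Real.smoothTransition.contDiff (n := 1)).differentiable
    (by simp)).differentiableAt (x := distTo S z * (k + 1) - 1)).hasDerivAt.comp_hasFDerivAt z h1
  have h3 := hφ.hasFDerivAt.mul h2
  rw [fadj, fadj]
  change fderiv ℝ (φ * (Real.smoothTransition ∘ fun z => distTo S z * (k + 1) - 1)) z _ + _ = _
  rw [h3.fderiv]
  simp only [cutoffOff, add_apply, smul_apply, smul_eq_mul,
    Function.comp_apply]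
  ring

/-- The derivative survives only in the layer `1 ≤ r (k+1) ≤ 2`, where `k+1 ≤ 2/r`. The growing
factor is thus traded for `1/r`, uniformly in `k`. -/
lemma abs_deriv_cutoff_le {C : NNReal} (hC : ∀ x, ‖deriv Real.smoothTransition x‖ ≤ C) (r : ℝ)
    (hr : 0 ≤ r) (k : ℕ) :
    |deriv Real.smoothTransition (r * (k + 1) - 1) * (k + 1)| ≤ 2 * C * r⁻¹ := by
  by_cases h : 1 ≤ r * (k + 1) ∧ r * (k + 1) ≤ 2
  · have hr0 : 0 < r := by
      rcases hr.eq_or_lt with rfl | h'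
      · norm_num at h
      · exact h'
    rw [abs_mul, abs_of_pos (by positivity : (0 : ℝ) < k + 1), ← Real.norm_eq_abs]
    have h1 : ((k : ℝ) + 1) ≤ 2 * r⁻¹ := by
      rw [← div_eq_mul_inv, le_div_iff₀ hr0]
      linarith [h.2]
    calc _ ≤ C * (2 * r⁻¹) := mul_le_mul (hC _) h1 (by positivity) C.2
      _ = _ := by ring
  · rw [deriv_smoothTransition_eq_zero]
    · simp only [zero_mul, abs_zero]
      positivity
    · rw [not_and_or, not_le, not_le] at h
      exact h.imp (fun h => by linarith) fun h => by linarith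

/-- An equation that holds off `S` holds across `S`, if `b·∇d_S / d_S` and `1 / d_S` are
integrable. -/
lemma setIntegral_adjTransport_eq_zero_of_off (hT : 0 < T) (hS : IsClosed S) (hne : S.Nonempty)
    {W : SpTime n → ℝ} (hW : MemLinftyLoc W (Iio T ×ˢ univ)) {b : SpTime n → Sp n}
    {d : SpTime n → ℝ}
    (hb : ∀ R, IntegrableOn b (Ioo 0 T ×ˢ closedBall 0 R))
    (hd : ∀ R, IntegrableOn d (Ioo 0 T ×ˢ closedBall 0 R))
    (hinv : ∀ A R, ∫⁻ z in Ioo (-A) T ×ˢ closedBall 0 R, (eDistTo S z)⁻¹ < ⊤)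
    (hbinv : ∀ R, ∫⁻ z in Ioo 0 T ×ˢ closedBall 0 R,
      ‖(inner ℝ (b z) (spaceGrad (distTo S) z) : ℝ)‖ₑ * (eDistTo S z)⁻¹ < ⊤)
    (h : ∀ φ, IsTestFun ((Iio T ×ˢ univ) \ S) φ →
      ∫ z in Iio T ×ˢ univ, W z * adjTransport (zeroExt b) (zeroExt d) φ z = 0)
    {φ : SpTime n → ℝ} (hφ : IsTestFun (Iio T ×ˢ univ) φ) :
    ∫ z in Iio T ×ˢ univ, W z * adjTransport (zeroExt b) (zeroExt d) φ z = 0 := by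
  obtain ⟨Lφ, Cφ, hLφ, hCφ⟩ := hφ.exists_lipschitz
  have hCφ0 : 0 ≤ Cφ := (abs_nonneg _).trans (hCφ 0)
  obtain ⟨L, hL⟩ := exists_lipschitzWith_distTo S
  obtain ⟨Cg, hCg⟩ := exists_bound_deriv_smoothTransition
  set K := tsupport φ with hKdef
  have hK : IsCompact K := hφ.2.1
  have hKT : K ⊆ Iio T ×ˢ univ := hφ.2.2
  obtain ⟨A, R, T', -, -, -, hT'T, hbox⟩ := hK.exists_subset_box hT hKT
  have hKbox : K ⊆ Ioo (-(A + 1)) T ×ˢ closedBall 0 R := fun z hz =>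
    ⟨⟨by linarith [(hbox hz).1.1], (hbox hz).1.2.trans_lt hT'T⟩, (hbox hz).2⟩
  set B := zeroExt b with hBdef
  set D := zeroExt d with hDdef
  have hBK : IntegrableOn B K := integrableOn_zeroExt hb hK hKT
  have hDK : IntegrableOn D K := integrableOn_zeroExt hd hK hKT
  obtain ⟨hWm, M, hM0, hM⟩ := memLp_top_iff_exists_bound.1 (hW K hK hKT)
  rw [ae_restrict_iff' hK.measurableSet] at hM
  have hdiff : ∀ᵐ z : SpTime n, DifferentiableAt ℝ (distTo S) z := hL.ae_differentiableAt
  -- A finite integral of `1/d_S` forces `d_S > 0` almost everywhere, so `S` is null in `K`.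
  have hpos : ∀ᵐ z : SpTime n, z ∈ K → 0 < distTo S z := by
    have h1 := ae_lt_top (μ := volume.restrict (Ioo (-(A + 1)) T ×ˢ closedBall 0 R))
      (continuous_eDistTo S).measurable.inv (hinv (A + 1) R).ne
    rw [ae_restrict_iff' (measurableSet_Ioo.prod measurableSet_closedBall)] at h1
    filter_upwards [h1] with z hz hzK
    refine ENNReal.toReal_pos (fun h0 => ?_) (eDistTo_ne_top hne z)
    have := hz (hKbox hzK)
    simp [h0] at this
  have hinvle : ∀ z, ENNReal.ofReal (distTo S z)⁻¹ ≤ (eDistTo S z)⁻¹ := fun z => by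
    rw [← ofReal_distTo hne]
    rcases (distTo_nonneg S z).eq_or_lt with h0 | h0
    · simp [← h0]
    · rw [ENNReal.ofReal_inv_of_pos h0]
  -- The majorant of the cutoff error, up to a constant. The time derivative of `d_S` costs only the
  -- Lipschitz constant; the spatial part is `b·∇d_S`.
  set H : SpTime n → ℝ := fun z => (distTo S z)⁻¹ * (L + |fderiv ℝ (distTo S) z (0, B z)|) with hH
  have hHint : IntegrableOn H K := by
    have hm1 : AEStronglyMeasurable (fun z => fderiv ℝ (distTo S) z (0, B z))
        (volume.restrict K) :=
      isBoundedBilinearMap_apply.continuous.comp_aestronglyMeasurable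
        ((measurable_fderiv ℝ (distTo S)).aestronglyMeasurable.prodMk
          (aestronglyMeasurable_const.prodMk hBK.1))
    refine ⟨(hL.continuous.measurable.inv.aestronglyMeasurable).mul
      (aestronglyMeasurable_const.add hm1.norm), ?_⟩
    have hle : ∀ᵐ z ∂(volume.restrict K), ‖H z‖ₑ ≤ L * (eDistTo S z)⁻¹ +
        ‖fderiv ℝ (distTo S) z (0, B z)‖ₑ * (eDistTo S z)⁻¹ := Eventually.of_forall fun z => by
      rw [hH]
      simp only
      rw [enorm_mul, mul_comm, ← add_mul,
        Real.enorm_of_nonneg (inv_nonneg.2 (distTo_nonneg S z))]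
      refine mul_le_mul' ((enorm_add_le _ _).trans (le_of_eq ?_)) (hinvle z)
      simp
    refine (lintegral_mono_ae hle).trans_lt ?_
    have hmE : Measurable fun z : SpTime n => (eDistTo S z)⁻¹ :=
      (continuous_eDistTo S).measurable.inv
    rw [lintegral_add_left (hmE.const_mul _), lintegral_const_mul _ hmE]
    refine ENNReal.add_lt_top.2 ⟨ENNReal.mul_lt_top ENNReal.coe_lt_top
      ((lintegral_mono_set hKbox).trans_lt (hinv _ _)), ?_⟩
    have hind : ∀ᵐ z ∂(volume : Measure (SpTime n)), K.indicator (fun z =>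
        ‖fderiv ℝ (distTo S) z (0, B z)‖ₑ * (eDistTo S z)⁻¹) z ≤
        (Ioo 0 T ×ˢ closedBall 0 R).indicator (fun z =>
          ‖(inner ℝ (b z) (spaceGrad (distTo S) z) : ℝ)‖ₑ * (eDistTo S z)⁻¹) z := by
      filter_upwards [hdiff, ae_fst_ne_zero (n := n)] with z hz hz0
      by_cases hzK : z ∈ K
      · rw [indicator_of_mem hzK]
        -- At negative times the extended field is zero and the spatial part disappears, so the
        -- bound on `(0,T)` suffices.
        rcases lt_or_gt_of_ne hz0 with h0 | h0
        · have : B z = 0 := if_pos h0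
          have h00 : ((0 : ℝ), (0 : Sp n)) = 0 := rfl
          rw [this, h00, map_zero, enorm_zero, zero_mul]
          exact zero_le
        · have hb' : B z = b z := if_neg (not_lt.2 h0.le)
          have hzb : z ∈ Ioo 0 T ×ˢ closedBall 0 R := ⟨⟨h0, (hKbox hzK).1.2⟩, (hKbox hzK).2⟩
          rw [indicator_of_mem hzb,
            inner_spaceGrad_eq_fderiv hz, hb']
      · rw [indicator_of_notMem hzK]
        exact zero_le
    rw [← lintegral_indicator hK.measurableSet]
    refine (lintegral_mono_ae hind).trans_lt ?_
    rw [lintegral_indicator (measurableSet_Ioo.prod measurableSet_closedBall)]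
    exact hbinv R
  have hφK : IntegrableOn (fadj B D φ) K :=
    integrableOn_fadj hLφ hCφ hK.measure_lt_top hBK hDK
  have hfk : ∀ k, ∃ L', LipschitzWith L' fun z => φ z * cutoffOff S k z := fun k => by
    obtain ⟨L', hL'⟩ := exists_lipschitzWith_cutoffOff S k
    exact ⟨_, hLφ.mul_of_bounded (C := Cφ.toNNReal) (C' := 1) hL'
      (fun z => (hCφ z).trans (Real.le_coe_toNNReal _)) fun z => by
        simpa using abs_cutoffOff_le_one S k z⟩
  have hsupp : ∀ k, tsupport (fun z => φ z * cutoffOff S k z) ⊆ K \ S := fun k =>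
    tsupport_mul_cutoffOff_subset φ k
  have hcomp : ∀ k, HasCompactSupport fun z => φ z * cutoffOff S k z := fun k =>
    hK.of_isClosed_subset (isClosed_tsupport _) ((hsupp k).trans sdiff_subset)
  have hzero : ∀ k, ∫ z in Iio T ×ˢ univ, W z * fadj B D (fun z => φ z * cutoffOff S k z) z = 0 :=
    fun k => by
      obtain ⟨L', hL'⟩ := hfk k
      exact setIntegral_fadj_eq_zero_of_lipschitz hW hb hd
        ((isOpen_Iio.prod isOpen_univ).sdiff hS) sdiff_subset h hL' (hcomp k)
        ((hsupp k).trans (sdiff_subset_sdiff_left hKT))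
  have hlim := tendsto_integral_of_dominated_convergence
    (μ := volume.restrict (Iio T ×ˢ (univ : Set (Sp n))))
    (F := fun k z => W z * fadj B D (fun z => φ z * cutoffOff S k z) z)
    (f := fun z => W z * fadj B D φ z)
    (K.indicator fun z => M * (|fadj B D φ z| + Cφ * (2 * Cg) * H z)) (fun k => ?_) ?_
    (fun k => ?_) ?_
  · rw [hφ.adjTransport_eq]
    exact tendsto_nhds_unique hlim (tendsto_const_nhds.congr fun k => (hzero k).symm)
  · obtain ⟨L', hL'⟩ := hfk k
    exact (integrable_mul_fadj hW hb hd hL' (hcomp k)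
      (((hsupp k).trans sdiff_subset).trans hKT)).aestronglyMeasurable.restrict
  · exact ((integrable_indicator_iff hK.measurableSet).2
      ((hφK.norm.add (hHint.const_mul _)).const_mul M)).integrableOn
  · refine ae_restrict_of_ae ?_
    filter_upwards [hM, hdiff] with z hMz hdz
    by_cases hzK : z ∈ K
    · rw [indicator_of_mem hzK, norm_mul]
      refine mul_le_mul (hMz hzK) ?_ (norm_nonneg _) hM0
      rw [fadj_mul_cutoffOff (hφ.1.differentiable (by simp) z) hdz]
      refine (norm_add_le _ _).trans (add_le_add ?_ ?_)
      · rw [norm_mul]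
        exact mul_le_of_le_one_left (norm_nonneg _) (abs_cutoffOff_le_one S k z)
      · have h1 : ‖fderiv ℝ (distTo S) z (1, B z)‖ ≤
            L + |fderiv ℝ (distTo S) z (0, B z)| := by
          have h2 : ((1 : ℝ), B z) = (1, 0) + (0, B z) := by simp
          rw [h2, map_add]
          refine (norm_add_le _ _).trans (add_le_add ?_ le_rfl)
          refine ((fderiv ℝ (distTo S) z).le_of_opNorm_le
            (norm_fderiv_le_of_lipschitz ℝ hL) _).trans (le_of_eq ?_)
          simp [Prod.norm_def]
        have h3 := abs_deriv_cutoff_le hCg (distTo S z) (distTo_nonneg S z) k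
        rw [norm_mul, norm_mul]
        calc _ ≤ Cφ * (2 * Cg * (distTo S z)⁻¹) *
              (L + |fderiv ℝ (distTo S) z (0, B z)|) := by
              have h4 : 0 ≤ (distTo S z)⁻¹ := inv_nonneg.2 (distTo_nonneg S z)
              exact mul_le_mul (mul_le_mul (hCφ z) h3 (norm_nonneg _) hCφ0) h1 (norm_nonneg _)
                (by positivity)
          _ = _ := by rw [hH]; ring
    · rw [indicator_of_notMem hzK,
        fadj_eq_zero_of_notMem_tsupport fun h => hzK ((hsupp k) h).1]
      simp
  · refine ae_restrict_of_ae ?_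
    filter_upwards [hpos, hdiff] with z hz hdz
    -- Off `S` the sequence is eventually constant: once `d_S (k+1) > 2`, the cutoff equals 1 and
    -- its derivative is 0.
    refine tendsto_const_nhds.congr' ?_
    by_cases hzK : z ∈ K
    · have hd0 := hz hzK
      filter_upwards [eventually_ge_atTop ⌈2 / distTo S z⌉₊] with k hk
      have h1 : 2 / distTo S z ≤ k := (Nat.le_ceil _).trans (by exact_mod_cast hk)
      rw [div_le_iff₀ hd0] at h1
      rw [fadj_mul_cutoffOff (hφ.1.differentiable (by simp) z) hdz,
        cutoffOff_eq_one_of_distTo (by linarith), deriv_smoothTransition_eq_zero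
          (Or.inr (by linarith))]
      ring
    · refine Eventually.of_forall fun k => ?_
      simp only
      rw [fadj_eq_zero_of_notMem_tsupport hzK,
        fadj_eq_zero_of_notMem_tsupport fun h => hzK ((hsupp k) h).1]

/-- The local renormalization property off `S` yields the global one. -/
theorem hasRenormProp_of_locRenormProp (hT : 0 < T) (hS : IsClosed S)
    {b : SpTime n → Sp n} {d : SpTime n → ℝ}
    (hb : ∀ R, IntegrableOn b (Ioo 0 T ×ˢ closedBall 0 R))
    (hd : ∀ R, IntegrableOn d (Ioo 0 T ×ˢ closedBall 0 R))
    (hinv : ∀ A R, ∫⁻ z in Ioo (-A) T ×ˢ closedBall 0 R, (eDistTo S z)⁻¹ < ⊤)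
    (hbinv : ∀ R, ∫⁻ z in Ioo 0 T ×ˢ closedBall 0 R,
      ‖(inner ℝ (b z) (spaceGrad (distTo S) z) : ℝ)‖ₑ * (eDistTo S z)⁻¹ < ⊤)
    (hren : ∀ Ω : Set (SpTime n), IsOpen Ω → IsCompact (closure Ω) →
      closure Ω ⊆ (Iio T ×ˢ univ) \ S → HasLocRenormProp T (zeroExt b) (zeroExt d) Ω) :
    HasRenormProp T b d := by
  intro u₀ u hu β hβ
  have hβu₀ := hu.1.continuous_comp hβ.continuous
  have hβu := hu.2.1.continuous_comp hβ.continuous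
  have hpast := (isWeakSol_iff_past hT hu.1 hu.2.1 hb hd).1 hu
  rw [isWeakSol_iff_past hT hβu₀ hβu hb hd, ← comp_pastExt]
  have hW := hpast.1.continuous_comp hβ.continuous
  have hVo : IsOpen ((Iio T ×ˢ (univ : Set (Sp n))) \ S) :=
    (isOpen_Iio.prod isOpen_univ).sdiff hS
  have hoff : ∀ φ, IsTestFun ((Iio T ×ˢ univ) \ S) φ → ∫ z in Iio T ×ˢ univ,
      β (pastExt u₀ u z) * adjTransport (zeroExt b) (zeroExt d) φ z = 0 := by
    intro φ hφ
    -- The local hypothesis concerns relatively compact sets only; one of them fits between the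
    -- support of `φ` and the complement of `S`.
    obtain ⟨Ω, hΩ, hφΩ, hΩV, hΩc⟩ :=
      exists_open_between_and_isCompact_closure hφ.2.1 hVo hφ.2.2
    have h1 := hren Ω hΩ hΩc hΩV _ hpast β hβ φ ⟨hφ.1, hφ.2.1, hφΩ⟩
    rw [← h1, hφ.adjTransport_eq]
    have h0 : ∀ z ∉ tsupport φ, β (pastExt u₀ u z) * fadj (zeroExt b) (zeroExt d) φ z = 0 :=
      fun z hz => by rw [fadj_eq_zero_of_notMem_tsupport hz, mul_zero]
    rw [setIntegral_eq_integral_of_forall_compl_eq_zero fun z hz =>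
        h0 z fun h => hz (hφ.2.2 h).1,
      setIntegral_eq_integral_of_forall_compl_eq_zero fun z hz => h0 z fun h => hz (hφΩ h)]
  refine ⟨hW, fun φ hφ => ?_⟩
  -- For empty `S` the real distance `distTo` takes the default value 0 and the cutoffs vanish
  -- identically, but then there is nothing to cut off.
  rcases S.eq_empty_or_nonempty with rfl | hne
  · exact hoff φ (by simpa using hφ)
  · exact setIntegral_adjTransport_eq_zero_of_off hT hS hne hW hb hd hinv hbinv hoff hφ

end Renormalization

section Weights

/-! ### From the weak to the integrated equation in time -/

/-- If `m' = G` weakly on `(-∞, T)`, where `m = G = 0` for negative times, then `m` is the primitive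
of `G`. -/
theorem ae_eq_primitive_of_weak_deriv {T : ℝ} {m G : ℝ → ℝ} (hm : IntegrableOn m (Ioo 0 T))
    (hG : IntegrableOn G (Ioo 0 T))
    (h : ∀ η : ℝ → ℝ, ContDiff ℝ ∞ η → HasCompactSupport η → tsupport η ⊆ Iio T →
      ∫ t in Ioo 0 T, (deriv η t * m t + η t * G t) = 0) :
    ∀ᵐ t ∂(volume.restrict (Ioo 0 T)), m t = ∫ s in Ioo 0 t, G s := by
  have hG' : Integrable ((Ioo 0 T).indicator G) := (integrable_indicator_iff measurableSet_Ioo).2 hG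
  set P : ℝ → ℝ := fun t => ∫ s in (0 : ℝ)..t, (Ioo 0 T).indicator G s with hP
  have hPc : Continuous P :=
    intervalIntegral.continuous_primitive (fun _ _ => hG'.intervalIntegrable) 0
  have hPeq : ∀ t ∈ Ioo 0 T, P t = ∫ s in Ioo 0 t, G s := fun t ht => by
    rw [hP]
    simp only
    rw [intervalIntegral.integral_of_le ht.1.le, integral_Ioc_eq_integral_Ioo]
    refine setIntegral_congr_fun measurableSet_Ioo fun s hs => ?_
    rw [indicator_of_mem]
    exact ⟨hs.1, hs.2.trans ht.2⟩
  have hloc : LocallyIntegrableOn (fun t => m t - P t) (Ioo 0 T) :=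
    hm.locallyIntegrableOn.sub (hPc.locallyIntegrable.locallyIntegrableOn _)
  -- It suffices to test `m - P` with `θ` in `C_c^∞(0,T)`. The test function in the weak equation is
  -- the primitive of `θ` that vanishes near `T`, cut off between the times -1 and 0. It need not
  -- vanish at 0, and this is how the zero initial value enters.
  have hkey := isOpen_Ioo.ae_eq_zero_of_integral_contDiff_smul_eq_zero hloc fun θ hθ hθc hθs => by
    set η₀ : ℝ → ℝ := fun t => ∫ s in T..t, θ s with hη₀
    have hder : ∀ t, HasDerivAt η₀ (θ t) t := fun t =>
      (hθ.continuous.integral_hasStrictDerivAt T t).hasDerivAt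
    have hη₀s : ContDiff ℝ ∞ η₀ := by
      rw [contDiff_infty_iff_deriv]
      refine ⟨fun t => (hder t).differentiableAt, ?_⟩
      have : deriv η₀ = θ := funext fun t => (hder t).deriv
      rwa [this]
    set η : ℝ → ℝ := fun t => Real.smoothTransition (t + 1) * η₀ t with hη
    have hηs : ContDiff ℝ ∞ η := (Real.smoothTransition.contDiff.comp (by fun_prop)).mul hη₀s
    obtain ⟨c, hcT, hc⟩ : ∃ c < T, ∀ t, c ≤ t → θ t = 0 := by
      rcases (tsupport θ).eq_empty_or_nonempty with he | hne
      · exact ⟨T - 1, by linarith, fun t _ => image_eq_zero_of_notMem_tsupport (by simp [he])⟩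
      · obtain ⟨c, hc, hmax⟩ := hθc.isCompact.exists_isMaxOn hne continuous_id.continuousOn
        have hcT : c < T := (hθs hc).2
        refine ⟨(c + T) / 2, by linarith, fun t ht => image_eq_zero_of_notMem_tsupport fun hmem => ?_⟩
        have : t ≤ c := hmax hmem
        linarith
    have hη₀c : ∀ t, c ≤ t → η₀ t = 0 := fun t ht => by
      refine (intervalIntegral.integral_congr fun s hs => ?_).trans intervalIntegral.integral_zero
      exact hc s ((le_min hcT.le ht).trans hs.1)
    have hηsupp : tsupport η ⊆ Icc (-1) c := by
      refine closure_minimal (fun t ht => ?_) isClosed_Icc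
      refine ⟨?_, ?_⟩
      · by_contra hlt
        exact left_ne_zero_of_mul ht (Real.smoothTransition.zero_of_nonpos (by linarith))
      · by_contra hlt
        exact right_ne_zero_of_mul ht (hη₀c t (not_le.1 hlt).le)
    have h1 := h η hηs (isCompact_Icc.of_isClosed_subset (isClosed_tsupport _) hηsupp)
      (hηsupp.trans fun t ht => ht.2.trans_lt hcT)
    have hηeq : ∀ t ∈ Ioo 0 T, deriv η t = θ t ∧ η t = η₀ t := fun t ht => by
      have hev : η =ᶠ[𝓝 t] η₀ := by
        filter_upwards [lt_mem_nhds ht.1] with s hs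
        rw [hη]
        simp only
        rw [Real.smoothTransition.one_of_one_le (by linarith), one_mul]
      exact ⟨by rw [hev.deriv_eq, (hder t).deriv], hev.eq_of_nhds⟩
    have h2 : ∫ t in Ioo 0 T, (θ t * m t + η₀ t * G t) = 0 := by
      refine Eq.trans ?_ h1
      refine setIntegral_congr_fun measurableSet_Ioo fun t ht => ?_
      simp only [(hηeq t ht).1, (hηeq t ht).2]
    obtain ⟨C, hC⟩ := hθc.exists_bound_of_continuous hθ.continuous
    have hθm : IntegrableOn (fun t => θ t * m t) (Ioo 0 T) :=
      hm.bdd_mul hθ.continuous.aestronglyMeasurable (Eventually.of_forall hC)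
    have hθi : IntegrableOn θ (Ioo 0 T) :=
      (hθ.continuous.integrable_of_hasCompactSupport hθc).integrableOn
    have hθP : IntegrableOn (fun t => θ t * P t) (Ioo 0 T) :=
      ((hθ.continuous.mul hPc).integrable_of_hasCompactSupport hθc.mul_right).integrableOn
    obtain ⟨C', hC'⟩ := (isCompact_Icc (a := (0 : ℝ)) (b := T)).exists_bound_of_continuousOn
      hη₀s.continuous.continuousOn
    have hη₀G : IntegrableOn (fun t => η₀ t * G t) (Ioo 0 T) := by
      refine hG.bdd_mul (c := C') hη₀s.continuous.aestronglyMeasurable ?_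
      rw [ae_restrict_iff' measurableSet_Ioo]
      exact Eventually.of_forall fun t ht => hC' t (Ioo_subset_Icc_self ht)
    -- Integration by parts, done as Fubini's theorem for `G t * θ s` on the triangle `t < s`.
    have h3 : ∫ t in Ioo 0 T, η₀ t * G t = -∫ s in Ioo 0 T, θ s * P s := by
      set F : ℝ → ℝ → ℝ := fun t s => {p : ℝ × ℝ | p.1 < p.2}.indicator
        (fun p => G p.1 * θ p.2) (t, s) with hF
      have hFi : Integrable (Function.uncurry F)
          ((volume.restrict (Ioo 0 T)).prod (volume.restrict (Ioo 0 T))) := by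
        have := (Integrable.mul_prod hG hθi).indicator
          (measurableSet_lt (measurable_fst (α := ℝ) (β := ℝ)) measurable_snd)
        exact this
      have hswap := integral_integral_swap hFi
      have hl : ∫ t in Ioo 0 T, ∫ s in Ioo 0 T, F t s = -∫ t in Ioo 0 T, η₀ t * G t := by
        rw [← integral_neg]
        refine setIntegral_congr_fun measurableSet_Ioo fun t ht => ?_
        have e1 : ∀ s, F t s = (Ioi t).indicator (fun s => G t * θ s) s := fun s => by
          simp only [hF, indicator]
          rfl
        simp only [e1]
        rw [setIntegral_indicator measurableSet_Ioi, integral_const_mul, hη₀]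
        simp only
        rw [intervalIntegral.integral_symm, intervalIntegral.integral_of_le ht.2.le,
          integral_Ioc_eq_integral_Ioo]
        have : Ioo 0 T ∩ Ioi t = Ioo t T := by
          ext s
          exact ⟨fun hs => ⟨hs.2, hs.1.2⟩, fun hs => ⟨⟨ht.1.trans hs.1, hs.2⟩, hs.1⟩⟩
        rw [this]
        ring
      have hr : ∫ s in Ioo 0 T, ∫ t in Ioo 0 T, F t s = ∫ s in Ioo 0 T, θ s * P s := by
        refine setIntegral_congr_fun measurableSet_Ioo fun s hs => ?_
        have e1 : ∀ t, F t s = (Iio s).indicator (fun t => G t * θ s) t := fun t => by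
          simp only [hF, indicator]
          rfl
        simp only [e1]
        rw [setIntegral_indicator measurableSet_Iio, integral_mul_const, hPeq s hs]
        have : Ioo 0 T ∩ Iio s = Ioo 0 s := by
          ext t
          exact ⟨fun ht => ⟨ht.1.1, ht.2⟩, fun ht => ⟨⟨ht.1, ht.2.trans hs.2⟩, ht.2⟩⟩
        rw [this]
        ring
      rw [← hr, ← hswap, hl, neg_neg]
    rw [integral_add hθm hη₀G, h3] at h2
    have h4 : ∫ t, θ t • (m t - P t) = ∫ t in Ioo 0 T, (θ t * m t - θ t * P t) := by
      rw [setIntegral_eq_integral_of_forall_compl_eq_zero fun t ht => ?_]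
      · simp only [smul_eq_mul, mul_sub]
      · rw [image_eq_zero_of_notMem_tsupport fun hmem => ht (hθs hmem)]
        simp
    rw [h4, integral_sub hθm hθP]
    linarith
  rw [ae_restrict_iff' measurableSet_Ioo]
  filter_upwards [hkey] with t ht htT
  rw [← hPeq t htT]
  linarith [ht htT]

/-! ### Weights in space -/

variable {n : ℕ}

/-- An integrable weight whose gradient is controlled by the weight itself. -/
structure IsWeight (C : ℝ) (ψ : Sp n → ℝ) : Prop where
  contDiff : ContDiff ℝ ∞ ψ
  pos : ∀ x, 0 < ψ x
  le_one : ∀ x, ψ x ≤ 1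
  integrable : Integrable ψ
  grad_le : ∀ x, (1 + ‖x‖) * ‖fderiv ℝ ψ x‖ ≤ C * ψ x

/-- The weight `(1 + |x|² / (k + 1)²)⁻⁽ⁿ⁺¹⁾`. -/
noncomputable def polyWeight (n k : ℕ) (x : Sp n) : ℝ :=
  ((1 + ((k : ℝ) + 1)⁻¹ ^ 2 * ‖x‖ ^ 2)⁻¹) ^ (n + 1)

lemma polyWeight_base_pos (k : ℕ) (x : Sp n) : 0 < 1 + ((k : ℝ) + 1)⁻¹ ^ 2 * ‖x‖ ^ 2 := by
  positivity

lemma norm_fderiv_polyWeight_le (k : ℕ) (x : Sp n) :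
    ‖fderiv ℝ (polyWeight n k) x‖ ≤ 2 * (n + 1) * (((k : ℝ) + 1)⁻¹ ^ 2 * ‖x‖) *
      (1 + ((k : ℝ) + 1)⁻¹ ^ 2 * ‖x‖ ^ 2)⁻¹ * polyWeight n k x := by
  have hq := polyWeight_base_pos k x
  have h1 : HasFDerivAt (fun x : Sp n => 1 + ((k : ℝ) + 1)⁻¹ ^ 2 * ‖x‖ ^ 2)
      ((((k : ℝ) + 1)⁻¹ ^ 2) • (2 • (innerSL ℝ) x)) x :=
    ((hasStrictFDerivAt_norm_sq x).hasFDerivAt.const_mul _).const_add 1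
  have h2 := ((hasDerivAt_inv hq.ne').pow (n + 1)).comp_hasFDerivAt x h1
  have h3 : fderiv ℝ (polyWeight n k) x = _ := h2.fderiv
  rw [h3, norm_smul, norm_smul]
  have h4 : ‖(2 : ℕ) • (innerSL ℝ) x‖ ≤ 2 * ‖x‖ := by
    rw [two_smul, two_mul]
    exact (norm_add_le _ _).trans (by simp)
  set q := 1 + ((k : ℝ) + 1)⁻¹ ^ 2 * ‖x‖ ^ 2 with hqdef
  have h5 : polyWeight n k x = q⁻¹ ^ (n + 1) := rfl
  rw [h5]
  have h6 : ‖((n + 1 : ℕ) : ℝ) * q⁻¹ ^ (n + 1 - 1) * -(q ^ 2)⁻¹‖ = (n + 1) * (q⁻¹ * q⁻¹ ^ (n + 1)) := by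
    rw [norm_mul, norm_mul, norm_neg, Real.norm_of_nonneg (by positivity),
      Real.norm_of_nonneg (by positivity), Real.norm_of_nonneg (by positivity)]
    push_cast
    simp only [pow_succ]
    rw [mul_inv]
    ring
  calc _ ≤ ((n + 1) * (q⁻¹ * q⁻¹ ^ (n + 1))) * ((((k : ℝ) + 1)⁻¹ ^ 2) * (2 * ‖x‖)) := by
        refine mul_le_mul (le_of_eq h6) ?_ (by positivity) (by positivity)
        rw [Real.norm_of_nonneg (by positivity)]
        gcongr
    _ = _ := by ring

lemma inv_succ_sq_le_one (k : ℕ) : ((k : ℝ) + 1)⁻¹ ^ 2 ≤ 1 := by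
  refine pow_le_one₀ (by positivity) (inv_le_one_of_one_le₀ ?_)
  linarith [(Nat.cast_nonneg k : (0 : ℝ) ≤ k)]

lemma polyWeight_le_one (k : ℕ) (x : Sp n) : polyWeight n k x ≤ 1 := by
  refine pow_le_one₀ (inv_nonneg.2 (polyWeight_base_pos k x).le) (inv_le_one_of_one_le₀ ?_)
  have : 0 ≤ ((k : ℝ) + 1)⁻¹ ^ 2 * ‖x‖ ^ 2 := by positivity
  linarith

/-- The mass for the fixed weight `k = 0` is thus bounded by the mass for each of the flatter
weights. -/
lemma polyWeight_zero_le (k : ℕ) (x : Sp n) : polyWeight n 0 x ≤ polyWeight n k x := by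
  have h := polyWeight_base_pos k x
  unfold polyWeight
  gcongr
  simp

lemma polyWeight_le (k : ℕ) (x : Sp n) :
    polyWeight n k x ≤ ((k + 1 : ℝ) ^ 2) ^ (n + 1) * polyWeight n 0 x := by
  have hq := polyWeight_base_pos k x
  have hk : (0 : ℝ) < k + 1 := by positivity
  have h1 : (1 : ℝ) ≤ (k + 1) ^ 2 := one_le_pow₀ (by linarith [(Nat.cast_nonneg k : (0 : ℝ) ≤ k)])
  have hp : (0 : ℝ) < 1 + ‖x‖ ^ 2 := by positivity
  have h2 : polyWeight n 0 x = ((1 + ‖x‖ ^ 2)⁻¹) ^ (n + 1) := by simp [polyWeight]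
  rw [h2, ← mul_pow]
  refine pow_le_pow_left₀ (inv_nonneg.2 hq.le) ?_ _
  rw [← div_eq_mul_inv, le_div_iff₀ hp, inv_mul_le_iff₀ hq]
  have h3 : (1 + ((k : ℝ) + 1)⁻¹ ^ 2 * ‖x‖ ^ 2) * (k + 1) ^ 2 = (k + 1) ^ 2 + ‖x‖ ^ 2 := by
    field_simp
  rw [h3]
  linarith

lemma integrable_polyWeight (n k : ℕ) : Integrable (polyWeight n k) := by
  have h0 : Integrable (polyWeight n 0) := by
    -- The power `n + 1` gives decay of order `2(n+1)`, which exceeds the dimension.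
    have h1 := integrable_rpow_neg_one_add_norm_sq (E := Sp n) (μ := volume) (r := 2 * (n + 1))
      (by simp; linarith)
    refine h1.congr (Eventually.of_forall fun x => ?_)
    have h2 : (0 : ℝ) < 1 + ‖x‖ ^ 2 := by positivity
    simp only [polyWeight, CharP.cast_eq_zero, zero_add, inv_one, one_pow, one_mul]
    rw [show -(2 * ((n : ℝ) + 1)) / 2 = -((n + 1 : ℕ) : ℝ) by push_cast; ring,
      Real.rpow_neg h2.le, Real.rpow_natCast, inv_pow]
  refine (h0.const_mul (((k + 1 : ℝ) ^ 2) ^ (n + 1))).mono' ?_ (Eventually.of_forall fun x => ?_)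
  · refine Continuous.aestronglyMeasurable ?_
    unfold polyWeight
    exact ((by fun_prop : Continuous fun x : Sp n => 1 + ((k : ℝ) + 1)⁻¹ ^ 2 * ‖x‖ ^ 2).inv₀
      fun x => (polyWeight_base_pos k x).ne').pow _
  · have h1 : 0 ≤ polyWeight n k x := pow_nonneg (inv_nonneg.2 (polyWeight_base_pos k x).le) _
    rw [Real.norm_of_nonneg h1]
    exact polyWeight_le k x

/-- The constant does not depend on `k`, so one Gronwall constant serves all the weights. -/
theorem isWeight_polyWeight (n k : ℕ) : IsWeight (4 * (n + 1)) (polyWeight n k) where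
  contDiff := by
    unfold polyWeight
    refine ContDiff.pow (ContDiff.inv ?_ fun x => (polyWeight_base_pos k x).ne') _
    exact contDiff_const.add (contDiff_const.mul (contDiff_norm_sq ℝ))
  pos x := pow_pos (inv_pos.2 (polyWeight_base_pos k x)) _
  le_one := polyWeight_le_one k
  integrable := integrable_polyWeight n k
  grad_le x := by
    have hq := polyWeight_base_pos k x
    have hp : 0 ≤ polyWeight n k x := pow_nonneg (inv_nonneg.2 hq.le) _
    have h1 := norm_fderiv_polyWeight_le k x
    have hs := inv_succ_sq_le_one k
    have hs0 : (0 : ℝ) ≤ ((k : ℝ) + 1)⁻¹ ^ 2 := by positivity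
    set s := ((k : ℝ) + 1)⁻¹ ^ 2 with hsdef
    -- From `‖x‖ ≤ (1 + ‖x‖²)/2` and `s ≤ 1`.
    have h2 : (1 + ‖x‖) * (s * ‖x‖) * (1 + s * ‖x‖ ^ 2)⁻¹ ≤ 2 := by
      rw [mul_inv_le_iff₀ hq]
      nlinarith [sq_nonneg (‖x‖ - 1), norm_nonneg x, mul_nonneg hs0 (sq_nonneg (‖x‖ - 1))]
    calc _ ≤ (1 + ‖x‖) * (2 * (n + 1) * (s * ‖x‖) * (1 + s * ‖x‖ ^ 2)⁻¹ * polyWeight n k x) := by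
          gcongr
      _ = 2 * (n + 1) * ((1 + ‖x‖) * (s * ‖x‖) * (1 + s * ‖x‖ ^ 2)⁻¹) * polyWeight n k x := by ring
      _ ≤ 2 * (n + 1) * 2 * polyWeight n k x := by gcongr
      _ = _ := by ring

lemma tendsto_norm_fderiv_polyWeight (x : Sp n) :
    Tendsto (fun k => ‖fderiv ℝ (polyWeight n k) x‖) atTop (𝓝 0) := by
  have h1 : Tendsto (fun k : ℕ => 2 * ((n : ℝ) + 1) * (((k : ℝ) + 1)⁻¹ ^ 2 * ‖x‖)) atTop (𝓝 0) := by
    have h2 := (tendsto_one_div_add_atTop_nhds_zero_nat (𝕜 := ℝ)).pow 2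
    have h3 := (h2.mul_const ‖x‖).const_mul (2 * ((n : ℝ) + 1))
    simpa using h3
  refine squeeze_zero (fun k => norm_nonneg _) (fun k => ?_) h1
  refine (norm_fderiv_polyWeight_le k x).trans ?_
  rw [mul_assoc]
  refine mul_le_of_le_one_right (by positivity) (mul_le_one₀ ?_ ?_ (polyWeight_le_one k x))
  · refine inv_le_one_of_one_le₀ ?_
    have : 0 ≤ ((k : ℝ) + 1)⁻¹ ^ 2 * ‖x‖ ^ 2 := by positivity
    linarith
  · exact pow_nonneg (inv_nonneg.2 (polyWeight_base_pos k x).le) _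

/-- Cutoffs in space, equal to `1` on the ball of radius `k + 1`. -/
noncomputable def spaceCutoff (n k : ℕ) (x : Sp n) : ℝ :=
  (⟨1, 2, one_pos, one_lt_two⟩ : ContDiffBump (0 : Sp n)) (((k : ℝ) + 1)⁻¹ • x)

lemma contDiff_spaceCutoff (k : ℕ) : ContDiff ℝ ∞ (spaceCutoff n k) :=
  (ContDiffBump.contDiff _).comp (contDiff_const_smul _)

lemma spaceCutoff_mem_Icc (k : ℕ) (x : Sp n) : spaceCutoff n k x ∈ Icc (0 : ℝ) 1 :=
  ⟨ContDiffBump.nonneg _, ContDiffBump.le_one _⟩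

lemma spaceCutoff_eq_zero {k : ℕ} {x : Sp n} (hx : 2 * ((k : ℝ) + 1) ≤ ‖x‖) :
    spaceCutoff n k x = 0 := by
  refine ContDiffBump.zero_of_le_dist _ ?_
  have hk : (0 : ℝ) < k + 1 := by positivity
  rw [dist_zero_right, norm_smul, Real.norm_of_nonneg (by positivity)]
  rw [inv_mul_eq_div, le_div_iff₀ hk]
  exact hx

lemma spaceCutoff_eq_one {k : ℕ} {x : Sp n} (hx : ‖x‖ ≤ k + 1) : spaceCutoff n k x = 1 := by
  refine ContDiffBump.one_of_mem_closedBall _ ?_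
  have hk : (0 : ℝ) < k + 1 := by positivity
  rw [mem_closedBall_zero_iff, norm_smul, Real.norm_of_nonneg (by positivity), inv_mul_eq_div,
    div_le_iff₀ hk, one_mul]
  exact hx

lemma hasCompactSupport_spaceCutoff (k : ℕ) : HasCompactSupport (spaceCutoff n k) := by
  refine HasCompactSupport.intro (isCompact_closedBall (0 : Sp n) (2 * ((k : ℝ) + 1))) fun x hx => ?_
  rw [mem_closedBall_zero_iff, not_le] at hx
  exact spaceCutoff_eq_zero hx.le

lemma fderiv_spaceCutoff_eq_zero {k : ℕ} {x : Sp n} (hx : ‖x‖ < k + 1) :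
    fderiv ℝ (spaceCutoff n k) x = 0 := by
  have : spaceCutoff n k =ᶠ[𝓝 x] fun _ => 1 := by
    filter_upwards [continuous_norm.continuousAt.eventually_lt continuousAt_const hx] with y hy
    exact spaceCutoff_eq_one hy.le
  rw [this.fderiv_eq, fderiv_const_apply]

/-- The gradient is of size `1/(k+1)` and vanishes for `|x| > 2(k+1)`, which balances the factor `1
+ |x|` uniformly in `k`. -/
lemma exists_bound_fderiv_spaceCutoff (n : ℕ) :
    ∃ C : ℝ, 0 ≤ C ∧ ∀ k x, (1 + ‖x‖) * ‖fderiv ℝ (spaceCutoff n k) x‖ ≤ C := by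
  set χ : ContDiffBump (0 : Sp n) := ⟨1, 2, one_pos, one_lt_two⟩ with hχ
  obtain ⟨C, hC⟩ := (χ.hasCompactSupport.fderiv ℝ).exists_bound_of_continuous
    (χ.contDiff.continuous_fderiv (n := 1) (by simp))
  have hC0 : 0 ≤ C := (norm_nonneg _).trans (hC 0)
  refine ⟨3 * C, by positivity, fun k x => ?_⟩
  have hk : (1 : ℝ) ≤ k + 1 := by linarith [(Nat.cast_nonneg k : (0 : ℝ) ≤ k)]
  rcases le_or_gt ‖x‖ (2 * ((k : ℝ) + 1)) with hx | hx
  · have h1 : fderiv ℝ (spaceCutoff n k) x = ((k : ℝ) + 1)⁻¹ • fderiv ℝ χ (((k : ℝ) + 1)⁻¹ • x) :=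
      fderiv_comp_smul _
    rw [h1, norm_smul, Real.norm_of_nonneg (by positivity)]
    have h2 := hC (((k : ℝ) + 1)⁻¹ • x)
    have h3 : (1 + ‖x‖) * ((k : ℝ) + 1)⁻¹ ≤ 3 := by
      rw [mul_inv_le_iff₀ (by positivity)]
      linarith
    rw [← mul_assoc]
    exact mul_le_mul h3 h2 (norm_nonneg _) (by norm_num)
  · have : spaceCutoff n k =ᶠ[𝓝 x] fun _ => 0 := by
      filter_upwards [continuousAt_const.eventually_lt continuous_norm.continuousAt hx] with y hy
      exact spaceCutoff_eq_zero hy.le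
    rw [this.fderiv_eq, fderiv_const_apply, norm_zero, mul_zero]
    positivity

end Weights

section Uniqueness

variable {n : ℕ} {T : ℝ}

/-! ### Uniqueness -/

lemma isTestFun_mul_of_separated {η : ℝ → ℝ} {ζ : Sp n → ℝ} (hη : ContDiff ℝ ∞ η)
    (hηc : HasCompactSupport η) (hηT : tsupport η ⊆ Iio T) (hζ : ContDiff ℝ ∞ ζ)
    (hζc : HasCompactSupport ζ) : IsTestFun (Iio T ×ˢ univ) fun z : SpTime n => η z.1 * ζ z.2 := by
  have hsub : tsupport (fun z : SpTime n => η z.1 * ζ z.2) ⊆ tsupport η ×ˢ tsupport ζ :=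
    closure_minimal (fun z hz => ⟨subset_tsupport _ (left_ne_zero_of_mul hz),
      subset_tsupport _ (right_ne_zero_of_mul hz)⟩)
      ((isClosed_tsupport _).prod (isClosed_tsupport _))
  exact ⟨(hη.comp contDiff_fst).mul (hζ.comp contDiff_snd),
    (hηc.isCompact.prod hζc.isCompact).of_isClosed_subset (isClosed_tsupport _) hsub,
    hsub.trans (prod_mono hηT (subset_univ _))⟩

lemma adjTransport_separated {η : ℝ → ℝ} {ζ : Sp n → ℝ} (b : SpTime n → Sp n) (d : SpTime n → ℝ)
    {z : SpTime n} (hη : DifferentiableAt ℝ η z.1) (hζ : DifferentiableAt ℝ ζ z.2) :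
    adjTransport b d (fun z : SpTime n => η z.1 * ζ z.2) z =
      deriv η z.1 * ζ z.2 + η z.1 * (fderiv ℝ ζ z.2 (b z) + d z * ζ z.2) := by
  have h1 : timeDeriv (fun z : SpTime n => η z.1 * ζ z.2) z = deriv η z.1 * ζ z.2 := by
    simp only [timeDeriv]
    exact (hη.hasDerivAt.mul_const _).deriv
  have h2 : inner ℝ (b z) (spaceGrad (fun z : SpTime n => η z.1 * ζ z.2) z) =
      η z.1 * fderiv ℝ ζ z.2 (b z) := by
    rw [spaceGrad, gradient, real_inner_comm, InnerProductSpace.toDual_symm_apply,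
      (hζ.hasFDerivAt.const_mul (η z.1)).fderiv]
    rfl
  rw [adjTransport, h1, h2]
  ring

/-- A countable compact exhaustion: `MemLinftyLoc` gives measurability on compact sets only, and
this extends it to the whole strip. -/
lemma iUnion_cylinder_eq (hT : 0 < T) : (Ico 0 T ×ˢ (univ : Set (Sp n))) =
    ⋃ k : ℕ, Icc 0 (T - T / (k + 1)) ×ˢ closedBall (0 : Sp n) k := by
  ext z
  simp only [mem_prod, mem_univ, and_true, mem_iUnion, mem_closedBall_zero_iff]
  constructor
  · rintro ⟨h0, h1⟩
    obtain ⟨k, hk⟩ := exists_nat_ge (max ‖z.2‖ (T / (T - z.1)))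
    have hz : 0 < T - z.1 := by linarith
    have h2 := (le_max_right _ _).trans hk
    rw [div_le_iff₀ hz] at h2
    refine ⟨k, ⟨h0, ?_⟩, (le_max_left _ _).trans hk⟩
    have h3 : T / (k + 1) ≤ T - z.1 := by
      rw [div_le_iff₀ (by positivity)]
      linarith
    linarith
  · rintro ⟨k, ⟨h0, h1⟩, -⟩
    refine ⟨h0, h1.trans_lt ?_⟩
    have : 0 < T / ((k : ℝ) + 1) := by positivity
    linarith

lemma MemLinftyLoc.aestronglyMeasurable_strip (hT : 0 < T) {u : SpTime n → ℝ}
    (hu : MemLinftyLoc u (Ico 0 T ×ˢ univ)) :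
    AEStronglyMeasurable u (volume.restrict (Ioo 0 T ×ˢ (univ : Set (Sp n)))) := by
  have h1 : AEStronglyMeasurable u (volume.restrict (Ico 0 T ×ˢ (univ : Set (Sp n)))) := by
    rw [iUnion_cylinder_eq hT, aestronglyMeasurable_iUnion_iff]
    refine fun k => (hu _ (isCompact_Icc.prod (isCompact_closedBall _ _)) ?_).1
    rw [iUnion_cylinder_eq hT]
    exact subset_iUnion (fun k : ℕ => Icc 0 (T - T / ((k : ℝ) + 1)) ×ˢ closedBall (0 : Sp n) k) k
  exact h1.mono_measure (Measure.restrict_mono (prod_mono_left Ioo_subset_Ico_self) le_rfl)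

variable {b b₁ b₂ : SpTime n → Sp n} {d : SpTime n → ℝ}

lemma aestronglyMeasurable_fderiv_apply {ζ : Sp n → ℝ} {μ : Measure (SpTime n)}
    (hb : AEStronglyMeasurable b μ) :
    AEStronglyMeasurable (fun z : SpTime n => fderiv ℝ ζ z.2 (b z)) μ :=
  isBoundedBilinearMap_apply.continuous.comp_aestronglyMeasurable
    (((measurable_fderiv ℝ ζ).comp measurable_snd).aestronglyMeasurable.prodMk hb)

/-- The bound of the transport term by the decomposition of the field. -/
lemma norm_fderiv_apply_le_of_decay {ζ : Sp n → ℝ} {z : SpTime n}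
    (hz : (1 + ‖z.2‖)⁻¹ • b z = b₁ z + b₂ z) :
    ‖fderiv ℝ ζ z.2 (b z)‖ ≤ (1 + ‖z.2‖) * ‖fderiv ℝ ζ z.2‖ * (‖b₁ z‖ + ‖b₂ z‖) := by
  have h0 : (0 : ℝ) < 1 + ‖z.2‖ := by positivity
  have h1 : b z = (1 + ‖z.2‖) • (b₁ z + b₂ z) := by
    rw [← hz, smul_smul, mul_inv_cancel₀ h0.ne', one_smul]
  refine ((fderiv ℝ ζ z.2).le_opNorm _).trans ?_
  rw [h1, norm_smul, Real.norm_of_nonneg h0.le]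
  calc _ = (1 + ‖z.2‖) * ‖fderiv ℝ ζ z.2‖ * ‖b₁ z + b₂ z‖ := by ring
    _ ≤ _ := by gcongr; exact norm_add_le _ _

lemma integrableOn_comp_snd {ψ : Sp n → ℝ} (hψ : Integrable ψ) :
    IntegrableOn (fun z : SpTime n => ψ z.2) (Ioo 0 T ×ˢ univ) := by
  rw [IntegrableOn, volume_restrict_prod_univ]
  have : IsFiniteMeasure (volume.restrict (Ioo (0 : ℝ) T)) := ⟨by simp⟩
  exact hψ.comp_snd _

lemma integrableOn_weight_bound {C : ℝ} {ψ : Sp n → ℝ} (hψ : IsWeight C ψ)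
    (h₁ : IntegrableOn b₁ (Ioo 0 T ×ˢ univ)) (h₂ : MemMixedLp T 1 ⊤ b₂)
    (hd : MemMixedLp T 1 ⊤ d) (c c' : ℝ) :
    IntegrableOn (fun z : SpTime n => c * ψ z.2 + c' * (‖b₁ z‖ + ‖ψ z.2 • b₂ z‖ + ‖ψ z.2 • d z‖))
      (Ioo 0 T ×ˢ univ) :=
  ((integrableOn_comp_snd hψ.integrable).const_mul c).add
    (((h₁.norm.add (h₂.integrable_smul hψ.integrable).norm).add
      (hd.integrable_smul hψ.integrable).norm).const_mul c')

/-- The bounds on the flux of a function controlled by a weight. -/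
lemma abs_flux_le_of_weight {C C' : ℝ} (hC' : 0 ≤ C') {ψ ζ : Sp n → ℝ} (hψ : IsWeight C ψ)
    {z : SpTime n} (hz : (1 + ‖z.2‖)⁻¹ • b z = b₁ z + b₂ z)
    (hζ : |ζ z.2| ≤ ψ z.2) (hζ' : (1 + ‖z.2‖) * ‖fderiv ℝ ζ z.2‖ ≤ C' * ψ z.2) :
    |fderiv ℝ ζ z.2 (b z) + d z * ζ z.2| ≤
      (C' + 1) * (‖b₁ z‖ + ‖ψ z.2 • b₂ z‖ + ‖ψ z.2 • d z‖) := by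
  have h1 := norm_fderiv_apply_le_of_decay (ζ := ζ) hz
  have hp := hψ.pos z.2
  have h2 : (1 + ‖z.2‖) * ‖fderiv ℝ ζ z.2‖ * (‖b₁ z‖ + ‖b₂ z‖) ≤
      C' * ψ z.2 * (‖b₁ z‖ + ‖b₂ z‖) := by gcongr
  have h3 : ψ z.2 * ‖b₁ z‖ ≤ ‖b₁ z‖ := mul_le_of_le_one_left (norm_nonneg _) (hψ.le_one _)
  have h4 : |d z * ζ z.2| ≤ ψ z.2 * ‖d z‖ := by
    rw [abs_mul, mul_comm, Real.norm_eq_abs]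
    gcongr
  rw [norm_smul, norm_smul, Real.norm_of_nonneg hp.le]
  refine (abs_add_le _ _).trans ?_
  rw [Real.norm_eq_abs] at h1
  have h5 := mul_le_mul_of_nonneg_left h3 hC'
  have h6 : 0 ≤ ψ z.2 * ‖b₂ z‖ := by positivity
  have h7 : 0 ≤ C' * (ψ z.2 * ‖d z‖) := by positivity
  have h8 := norm_nonneg (b₁ z)
  nlinarith

/-- Bounded weak solutions with zero initial data may be tested with weights in space. -/
lemma IsWeakSol.setIntegral_weight_eq_zero (hT : 0 < T) {v : SpTime n → ℝ}
    (hv : IsWeakSol T b d (fun _ => 0) v) (hv1 : ∀ z, |v z| ≤ 1)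
    (hb : AEStronglyMeasurable b (volume.restrict (Ioo 0 T ×ˢ (univ : Set (Sp n)))))
    (h₁ : IntegrableOn b₁ (Ioo 0 T ×ˢ univ)) (h₂ : MemMixedLp T 1 ⊤ b₂)
    (hdec : ∀ᵐ z ∂(volume.restrict (Ioo 0 T ×ˢ (univ : Set (Sp n)))),
      (1 + ‖z.2‖)⁻¹ • b z = b₁ z + b₂ z)
    (hd : MemMixedLp T 1 ⊤ d) {C : ℝ} (hC : 0 ≤ C) {ψ : Sp n → ℝ} (hψ : IsWeight C ψ) {η : ℝ → ℝ}
    (hη : ContDiff ℝ ∞ η) (hηc : HasCompactSupport η) (hηT : tsupport η ⊆ Iio T) :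
    ∫ z in Ioo 0 T ×ˢ univ, v z * (deriv η z.1 * ψ z.2 +
      η z.1 * (fderiv ℝ ψ z.2 (b z) + d z * ψ z.2)) = 0 := by
  obtain ⟨Cχ, hCχ0, hCχ⟩ := exists_bound_fderiv_spaceCutoff n
  obtain ⟨Cη, hCη⟩ := hηc.exists_bound_of_continuous hη.continuous
  obtain ⟨Cη', hCη'⟩ := hηc.deriv.exists_bound_of_continuous (hη.continuous_deriv (by simp))
  have hCη0 : 0 ≤ Cη := (norm_nonneg _).trans (hCη 0)
  have hCη'0 : 0 ≤ Cη' := (norm_nonneg _).trans (hCη' 0)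
  have hηd : Differentiable ℝ η := hη.differentiable (by simp)
  have hψd : Differentiable ℝ ψ := hψ.contDiff.differentiable (by simp)
  have hχd : ∀ k, Differentiable ℝ (spaceCutoff n k) := fun k =>
    (contDiff_spaceCutoff k).differentiable (by simp)
  -- Truncating the weight makes it admissible. The bound of the gradient by the weight survives
  -- with the constant `Cχ + C`, so the flux keeps one majorant for all `k`.
  set ζ : ℕ → Sp n → ℝ := fun k x => ψ x * spaceCutoff n k x with hζ
  have hζs : ∀ k, ContDiff ℝ ∞ (ζ k) := fun k => hψ.contDiff.mul (contDiff_spaceCutoff k)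
  have hζc : ∀ k, HasCompactSupport (ζ k) := fun k => (hasCompactSupport_spaceCutoff k).mul_left
  have hζder : ∀ k x, fderiv ℝ (ζ k) x =
      ψ x • fderiv ℝ (spaceCutoff n k) x + spaceCutoff n k x • fderiv ℝ ψ x := fun k x =>
    fderiv_mul (hψd x) (hχd k x)
  have hζle : ∀ k x, |ζ k x| ≤ ψ x := fun k x => by
    obtain ⟨h0, h1⟩ := spaceCutoff_mem_Icc k x
    rw [hζ, abs_of_nonneg (mul_nonneg (hψ.pos x).le h0)]
    exact mul_le_of_le_one_right (hψ.pos x).le h1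
  have hζ'le : ∀ k x, (1 + ‖x‖) * ‖fderiv ℝ (ζ k) x‖ ≤ (Cχ + C) * ψ x := fun k x => by
    obtain ⟨h0, h1⟩ := spaceCutoff_mem_Icc k x
    have hp := (hψ.pos x).le
    have h2 : ‖fderiv ℝ (ζ k) x‖ ≤ ψ x * ‖fderiv ℝ (spaceCutoff n k) x‖ + ‖fderiv ℝ ψ x‖ := by
      rw [hζder]
      refine (norm_add_le _ _).trans ?_
      rw [norm_smul, norm_smul, Real.norm_of_nonneg hp, Real.norm_of_nonneg h0]
      gcongr
      exact mul_le_of_le_one_left (norm_nonneg _) h1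
    calc _ ≤ (1 + ‖x‖) * (ψ x * ‖fderiv ℝ (spaceCutoff n k) x‖ + ‖fderiv ℝ ψ x‖) := by gcongr
      _ = ψ x * ((1 + ‖x‖) * ‖fderiv ℝ (spaceCutoff n k) x‖) + (1 + ‖x‖) * ‖fderiv ℝ ψ x‖ := by ring
      _ ≤ ψ x * Cχ + C * ψ x := by
          exact add_le_add (mul_le_mul_of_nonneg_left (hCχ k x) hp) (hψ.grad_le x)
      _ = _ := by ring
  have hvm := hv.2.1.aestronglyMeasurable_strip hT
  have hlim := tendsto_integral_of_dominated_convergence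
    (μ := volume.restrict (Ioo 0 T ×ˢ (univ : Set (Sp n))))
    (F := fun k z => v z * (deriv η z.1 * ζ k z.2 +
      η z.1 * (fderiv ℝ (ζ k) z.2 (b z) + d z * ζ k z.2)))
    (f := fun z => v z * (deriv η z.1 * ψ z.2 + η z.1 * (fderiv ℝ ψ z.2 (b z) + d z * ψ z.2)))
    (fun z => Cη' * ψ z.2 + Cη * ((Cχ + C) + 1) *
      (‖b₁ z‖ + ‖ψ z.2 • b₂ z‖ + ‖ψ z.2 • d z‖)) (fun k => ?_)
    (integrableOn_weight_bound hψ h₁ h₂ hd _ _) (fun k => ?_) ?_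
  · refine tendsto_nhds_unique hlim (tendsto_const_nhds.congr fun k => ?_)
    have h1 := hv.2.2 _ (isTestFun_mul_of_separated hη hηc hηT (hζs k) (hζc k))
    simp only [zero_mul, integral_zero, zero_add] at h1
    refine h1.symm.trans (integral_congr_ae (Eventually.of_forall fun z => ?_))
    simp only
    rw [adjTransport_separated b d (hηd _) ((hζs k).differentiable (by simp) _)]
  · refine hvm.mul (AEStronglyMeasurable.add ?_ (AEStronglyMeasurable.mul ?_
      ((aestronglyMeasurable_fderiv_apply hb).add (hd.1.mul ?_))))
    · exact (((hη.continuous_deriv (by simp)).comp continuous_fst).mul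
        ((hζs k).continuous.comp continuous_snd)).aestronglyMeasurable
    · exact (hη.continuous.comp continuous_fst).aestronglyMeasurable
    · exact ((hζs k).continuous.comp continuous_snd).aestronglyMeasurable
  · filter_upwards [hdec] with z hz
    have h1 := abs_flux_le_of_weight (d := d) (add_nonneg hCχ0 hC) hψ hz (hζle k z.2)
      (hζ'le k z.2)
    rw [norm_mul]
    refine (mul_le_of_le_one_left (norm_nonneg _) (hv1 z)).trans ((norm_add_le _ _).trans ?_)
    rw [norm_mul, norm_mul (η z.1), mul_assoc]
    refine add_le_add ?_ (mul_le_mul (hCη _) h1 (norm_nonneg _) hCη0)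
    exact mul_le_mul (hCη' _) (hζle k z.2) (norm_nonneg _) hCη'0
  · refine Eventually.of_forall fun z => tendsto_const_nhds.congr' ?_
    filter_upwards [eventually_ge_atTop ⌈‖z.2‖⌉₊] with k hk
    have h1 : ‖z.2‖ ≤ k := (Nat.le_ceil _).trans (by exact_mod_cast hk)
    rw [hζder, fderiv_spaceCutoff_eq_zero (by linarith), hζ]
    simp only
    rw [spaceCutoff_eq_one (by linarith)]
    simp

lemma ae_norm_le_toReal_eLpNorm_top {α E : Type*} [MeasurableSpace α] [NormedAddCommGroup E]
    {μ : Measure α} {f : α → E} (hf : eLpNorm f ⊤ μ < ⊤) :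
    ∀ᵐ x ∂μ, ‖f x‖ ≤ (eLpNorm f ⊤ μ).toReal := by
  rw [eLpNorm_exponent_top] at hf ⊢
  filter_upwards [ae_le_eLpNormEssSup (f := f) (μ := μ)] with x hx
  rw [← toReal_enorm]
  exact ENNReal.toReal_mono hf.ne hx

set_option maxHeartbeats 400000 in
/-- The weighted mass of a bounded nonnegative weak solution with zero initial data is controlled by
the integrable part of the field. -/
theorem exists_setIntegral_weight_le (hT : 0 < T)
    (hb : AEStronglyMeasurable b (volume.restrict (Ioo 0 T ×ˢ (univ : Set (Sp n)))))
    (h₁ : IntegrableOn b₁ (Ioo 0 T ×ˢ univ)) (h₂ : MemMixedLp T 1 ⊤ b₂)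
    (hdec : ∀ᵐ z ∂(volume.restrict (Ioo 0 T ×ˢ (univ : Set (Sp n)))),
      (1 + ‖z.2‖)⁻¹ • b z = b₁ z + b₂ z)
    (hd : MemMixedLp T 1 ⊤ d) {C : ℝ} (hC : 0 ≤ C) :
    ∃ A : ℝ, ∀ (v : SpTime n → ℝ) (ψ : Sp n → ℝ), IsWeakSol T b d (fun _ => 0) v →
      (∀ z, 0 ≤ v z) → (∀ z, v z ≤ 1) → IsWeight C ψ →
      ∫ z in Ioo 0 T ×ˢ univ, v z * ψ z.2 ≤
        A * ∫ z in Ioo 0 T ×ˢ univ, (1 + ‖z.2‖) * ‖fderiv ℝ ψ z.2‖ * ‖b₁ z‖ := by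
  set Nb : ℝ → ℝ≥0∞ := fun t => eLpNorm (fun x : Sp n => b₂ (t, x)) ⊤ volume with hNb
  set Nd : ℝ → ℝ≥0∞ := fun t => eLpNorm (fun x : Sp n => d (t, x)) ⊤ volume with hNd
  set I := volume.restrict (Ioo (0 : ℝ) T) with hI
  have hstrip : (volume : Measure (SpTime n)).restrict (Ioo 0 T ×ˢ univ) = I.prod volume :=
    volume_restrict_prod_univ _
  have hfin : IsFiniteMeasure I := ⟨by simp [hI]⟩
  have hNbm : AEMeasurable Nb I := by
    have := aemeasurable_eLpNorm_section (μ := I) (ν := (volume : Measure (Sp n)))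
      (hstrip ▸ h₂.1.enorm) ⊤
    simpa only [eLpNorm_enorm] using this
  have hNdm : AEMeasurable Nd I := by
    have := aemeasurable_eLpNorm_section (μ := I) (ν := (volume : Measure (Sp n)))
      (hstrip ▸ hd.1.enorm) ⊤
    simpa only [eLpNorm_enorm] using this
  have hNbi : ∫⁻ t, Nb t ∂I ≠ ⊤ := by
    have := h₂.2
    rw [eLpNorm_one_eq_lintegral_enorm] at this
    exact this.ne
  have hNdi : ∫⁻ t, Nd t ∂I ≠ ⊤ := by
    have := hd.2
    rw [eLpNorm_one_eq_lintegral_enorm] at this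
    exact this.ne
  -- The Gronwall coefficient involves only `C`, `b₂` and `d`, so `A` is fixed before `v` and `ψ`
  -- are chosen.
  set a : ℝ → ℝ := fun t => C * (Nb t).toReal + (Nd t).toReal with ha
  have ha0 : ∀ t, 0 ≤ a t := fun t =>
    add_nonneg (mul_nonneg hC ENNReal.toReal_nonneg) ENNReal.toReal_nonneg
  have hai : Integrable a I :=
    ((integrable_toReal_of_lintegral_ne_top hNbm hNbi).const_mul C).add
      (integrable_toReal_of_lintegral_ne_top hNdm hNdi)
  obtain ⟨A, hA0, hA⟩ := exists_gronwall_const ha0 hai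
  -- The bound `m t ≤ A * E` integrated over `(0,T)` produces the factor `T`.
  refine ⟨T * A, fun v ψ hv hv0 hv1 hψ => ?_⟩
  have hvabs : ∀ z, |v z| ≤ 1 := fun z => abs_le.2 ⟨by linarith [hv0 z], hv1 z⟩
  have hvm := hv.2.1.aestronglyMeasurable_strip hT
  set g : SpTime n → ℝ := fun z => fderiv ℝ ψ z.2 (b z) + d z * ψ z.2 with hg
  set κ : Sp n → ℝ := fun x => (1 + ‖x‖) * ‖fderiv ℝ ψ x‖ with hκ
  have hκ0 : ∀ x, 0 ≤ κ x := fun x => by positivity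
  have hgi : Integrable g (I.prod volume) := by
    rw [← hstrip]
    refine (integrableOn_weight_bound hψ h₁ h₂ hd 0 (C + 1)).mono' ?_ ?_
    · exact (aestronglyMeasurable_fderiv_apply hb).add (hd.1.mul
        (hψ.contDiff.continuous.comp continuous_snd).aestronglyMeasurable)
    · filter_upwards [hdec] with z hz
      rw [zero_mul, zero_add]
      exact abs_flux_le_of_weight hC hψ hz (abs_of_pos (hψ.pos _)).le (hψ.grad_le _)
  have hψi : Integrable (fun z : SpTime n => ψ z.2) (I.prod volume) := by
    rw [← hstrip]
    exact integrableOn_comp_snd hψ.integrable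
  rw [hstrip] at hvm
  have hvψ : Integrable (fun z => v z * ψ z.2) (I.prod volume) :=
    hψi.bdd_mul hvm (Eventually.of_forall hvabs)
  have hvg : Integrable (fun z => v z * g z) (I.prod volume) :=
    hgi.bdd_mul hvm (Eventually.of_forall hvabs)
  have hκb : Integrable (fun z => κ z.2 * ‖b₁ z‖) (I.prod volume) := by
    have h1 : Integrable (fun z => ‖b₁ z‖) (I.prod volume) := by
      rw [← hstrip]; exact h₁.norm
    refine h1.bdd_mul (c := C) ?_ (Eventually.of_forall fun z => ?_)
    · have : Continuous κ := (continuous_const.add continuous_norm).mul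
        (hψ.contDiff.continuous_fderiv (by simp)).norm
      exact (this.comp continuous_snd).aestronglyMeasurable
    · rw [Real.norm_of_nonneg (hκ0 _)]
      exact (hψ.grad_le _).trans (mul_le_of_le_one_right hC (hψ.le_one _))
  set m : ℝ → ℝ := fun t => ∫ x, v (t, x) * ψ x with hm
  set G : ℝ → ℝ := fun t => ∫ x, v (t, x) * g (t, x) with hG
  set e : ℝ → ℝ := fun t => ∫ x, κ x * ‖b₁ (t, x)‖ with he
  have hmi : Integrable m I := hvψ.integral_prod_left
  have hGi : Integrable G I := hvg.integral_prod_left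
  have hei : Integrable e I := hκb.integral_prod_left
  have hm0 : ∀ t, 0 ≤ m t := fun t =>
    integral_nonneg fun x => mul_nonneg (hv0 _) (hψ.pos x).le
  have hmle : ∀ t, ‖m t‖ ≤ ∫ x, ψ x := fun t => by
    refine norm_integral_le_of_norm_le hψ.integrable (Eventually.of_forall fun x => ?_)
    rw [norm_mul, Real.norm_of_nonneg (hψ.pos x).le]
    exact mul_le_of_le_one_left (hψ.pos x).le (hvabs _)
  have ham : Integrable (fun t => a t * m t) I :=
    hai.mul_bdd (c := ∫ x, ψ x) hmi.1 (Eventually.of_forall hmle)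
  have he0 : ∀ t, 0 ≤ e t := fun t =>
    integral_nonneg fun x => mul_nonneg (hκ0 x) (norm_nonneg _)
  -- Testing with `η(t) ψ(x)` says that the mass `m` has the weak derivative `G` and starts from 0.
  have hprim : ∀ᵐ t ∂I, m t = ∫ s in Ioo 0 t, G s := by
    refine ae_eq_primitive_of_weak_deriv hmi hGi fun η hη hηc hηT => ?_
    have h1 := hv.setIntegral_weight_eq_zero hT hvabs hb h₁ h₂ hdec hd hC hψ hη hηc hηT
    rw [hstrip] at h1
    obtain ⟨Cη, hCη⟩ := hηc.exists_bound_of_continuous hη.continuous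
    obtain ⟨Cη', hCη'⟩ := hηc.deriv.exists_bound_of_continuous (hη.continuous_deriv (by simp))
    have h2 : Integrable (fun z : SpTime n => deriv η z.1 * (v z * ψ z.2)) (I.prod volume) :=
      hvψ.bdd_mul ((hη.continuous_deriv (by simp)).comp continuous_fst).aestronglyMeasurable
        (Eventually.of_forall fun z => hCη' _)
    have h3 : Integrable (fun z : SpTime n => η z.1 * (v z * g z)) (I.prod volume) :=
      hvg.bdd_mul (hη.continuous.comp continuous_fst).aestronglyMeasurable
        (Eventually.of_forall fun z => hCη _)
    have h4 : ∫ z, (deriv η z.1 * (v z * ψ z.2) + η z.1 * (v z * g z)) ∂(I.prod volume) = 0 := by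
      refine Eq.trans (integral_congr_ae (Eventually.of_forall fun z => ?_)) h1
      simp only [hg]
      ring
    have h5 := integral_prod (fun z : SpTime n =>
      deriv η z.1 * (v z * ψ z.2) + η z.1 * (v z * g z)) (h2.add h3)
    rw [h4] at h5
    refine Eq.trans (integral_congr_ae ?_) h5.symm
    filter_upwards [hvψ.prod_right_ae, hvg.prod_right_ae] with t ht1 ht2
    simp only [hm, hG]
    rw [← integral_const_mul, ← integral_const_mul,
      ← integral_add (ht1.const_mul _) (ht2.const_mul _)]
  -- The parts from `b₂` and `d` are bounded in `x` by multiples of `ψ` and return `a t * m t`. The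
  -- part from `b₁` has no such bound; there `v ≤ 1` is used and the result goes into `e`.
  have hGle : ∀ᵐ t ∂I, G t ≤ e t + a t * m t := by
    have hb₂ := Measure.ae_ae_of_ae_prod (hstrip ▸ hdec)
    filter_upwards [hb₂, ae_lt_top' hNbm hNbi, ae_lt_top' hNdm hNdi, hvψ.prod_right_ae,
      hvg.prod_right_ae, hκb.prod_right_ae] with t ht hNbt hNdt i1 i2 i3
    simp only [hG, he, hm]
    rw [← integral_const_mul, ← integral_add i3 (i1.const_mul _)]
    refine integral_mono_ae i2 (i3.add (i1.const_mul _)) ?_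
    have hNb' : ∀ᵐ x : Sp n, ‖b₂ (t, x)‖ ≤ (Nb t).toReal := ae_norm_le_toReal_eLpNorm_top
      (f := fun x : Sp n => b₂ (t, x)) (μ := volume) hNbt
    have hNd' : ∀ᵐ x : Sp n, ‖d (t, x)‖ ≤ (Nd t).toReal := ae_norm_le_toReal_eLpNorm_top
      (f := fun x : Sp n => d (t, x)) (μ := volume) hNdt
    filter_upwards [ht, hNb', hNd'] with x hx e1 e2
    rw [Real.norm_eq_abs] at e2
    have e3 := norm_fderiv_apply_le_of_decay (ζ := ψ) (z := (t, x)) (b := b) (b₁ := b₁) (b₂ := b₂) hx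
    have hp := (hψ.pos x).le
    have hvx := hv0 (t, x)
    have e4 : |g (t, x)| ≤ κ x * ‖b₁ (t, x)‖ + a t * ψ x := by
      have e5 : κ x * ‖b₂ (t, x)‖ ≤ C * ψ x * (Nb t).toReal :=
        mul_le_mul (hψ.grad_le x) e1 (norm_nonneg _) (mul_nonneg hC hp)
      have e6 : |d (t, x) * ψ x| ≤ (Nd t).toReal * ψ x := by
        rw [abs_mul, abs_of_nonneg hp]
        gcongr
      refine (abs_add_le _ _).trans ?_
      have e7 : |fderiv ℝ ψ x (b (t, x))| ≤ κ x * (‖b₁ (t, x)‖ + ‖b₂ (t, x)‖) := e3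
      simp only [ha]
      linarith
    calc v (t, x) * g (t, x) ≤ v (t, x) * (κ x * ‖b₁ (t, x)‖ + a t * ψ x) :=
          mul_le_mul_of_nonneg_left ((le_abs_self _).trans e4) hvx
      _ = v (t, x) * (κ x * ‖b₁ (t, x)‖) + a t * (v (t, x) * ψ x) := by ring
      _ ≤ κ x * ‖b₁ (t, x)‖ + a t * (v (t, x) * ψ x) := by
          have := mul_le_of_le_one_left (mul_nonneg (hκ0 x) (norm_nonneg (b₁ (t, x)))) (hv1 (t, x))
          linarith
  set E : ℝ := ∫ t, e t ∂I with hE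
  have hE0 : 0 ≤ E := integral_nonneg he0
  have hmG : ∀ᵐ t ∂I, m t ≤ E + ∫ s in Ioo 0 t, a s * m s := by
    have hmem : ∀ᵐ t ∂I, t ∈ Ioo 0 T := ae_restrict_mem measurableSet_Ioo
    filter_upwards [hprim, hmem] with t ht htT
    have hsub : Ioo 0 t ⊆ Ioo 0 T := Ioo_subset_Ioo le_rfl htT.2.le
    have hei' : IntegrableOn e (Ioo 0 t) := IntegrableOn.mono_set (t := Ioo 0 T) hei hsub
    have ham' : IntegrableOn (fun t => a t * m t) (Ioo 0 t) :=
      IntegrableOn.mono_set (t := Ioo 0 T) ham hsub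
    rw [ht]
    calc ∫ s in Ioo 0 t, G s ≤ ∫ s in Ioo 0 t, (e s + a s * m s) :=
          integral_mono_ae (IntegrableOn.mono_set (t := Ioo 0 T) hGi hsub) (hei'.add ham')
            (ae_restrict_of_ae_restrict_of_subset hsub hGle)
      _ = (∫ s in Ioo 0 t, e s) + ∫ s in Ioo 0 t, a s * m s := integral_add hei' ham'
      _ ≤ E + ∫ s in Ioo 0 t, a s * m s := by
          gcongr
          exact setIntegral_mono_set hei (Eventually.of_forall he0) hsub.eventuallyLE
  have hfinal := hA m E ham hm0 hE0 hmG
  rw [hstrip, integral_prod _ hvψ, integral_prod _ hκb]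
  calc ∫ t, m t ∂I ≤ ∫ _, A * E ∂I := integral_mono_ae hmi (integrable_const _) hfinal
    _ = T * A * E := by
        rw [integral_const]
        simp [hI, hT.le, mul_assoc]

/-- Bounded nonnegative weak solutions with zero initial data vanish. -/
theorem IsWeakSol.ae_eq_zero_of_nonneg_of_le_one (hT : 0 < T) {v : SpTime n → ℝ}
    (hv : IsWeakSol T b d (fun _ => 0) v) (hv0 : ∀ z, 0 ≤ v z) (hv1 : ∀ z, v z ≤ 1)
    (hb : AEStronglyMeasurable b (volume.restrict (Ioo 0 T ×ˢ (univ : Set (Sp n)))))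
    (h₁ : IntegrableOn b₁ (Ioo 0 T ×ˢ univ)) (h₂ : MemMixedLp T 1 ⊤ b₂)
    (hdec : ∀ᵐ z ∂(volume.restrict (Ioo 0 T ×ˢ (univ : Set (Sp n)))),
      (1 + ‖z.2‖)⁻¹ • b z = b₁ z + b₂ z)
    (hd : MemMixedLp T 1 ⊤ d) :
    v =ᵐ[volume.restrict (Ioo 0 T ×ˢ (univ : Set (Sp n)))] 0 := by
  have hC : (0 : ℝ) ≤ 4 * (n + 1) := by positivity
  obtain ⟨A, hA⟩ := exists_setIntegral_weight_le hT hb h₁ h₂ hdec hd hC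
  have hvabs : ∀ z, |v z| ≤ 1 := fun z => abs_le.2 ⟨by linarith [hv0 z], hv1 z⟩
  have hvm := hv.2.1.aestronglyMeasurable_strip hT
  have hvψ : ∀ k, IntegrableOn (fun z => v z * polyWeight n k z.2) (Ioo 0 T ×ˢ univ) := fun k =>
    Integrable.bdd_mul (integrableOn_comp_snd (integrable_polyWeight n k)) hvm
      (Eventually.of_forall hvabs)
  -- As the weights flatten, their gradients tend to 0 pointwise, and `4(n+1) ‖b₁‖` dominates.
  have hE : Tendsto (fun k => ∫ z in Ioo 0 T ×ˢ univ,
      (1 + ‖z.2‖) * ‖fderiv ℝ (polyWeight n k) z.2‖ * ‖b₁ z‖) atTop (𝓝 0) := by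
    suffices h : Tendsto (fun k => ∫ z in Ioo 0 T ×ˢ univ,
        (1 + ‖z.2‖) * ‖fderiv ℝ (polyWeight n k) z.2‖ * ‖b₁ z‖) atTop
        (𝓝 (∫ z in Ioo 0 T ×ˢ (univ : Set (Sp n)), (0 : ℝ))) by
      rwa [integral_zero] at h
    refine tendsto_integral_of_dominated_convergence (fun z => 4 * (n + 1) * ‖b₁ z‖)
      (fun k => ?_) (h₁.norm.const_mul _) (fun k => Eventually.of_forall fun z => ?_)
      (Eventually.of_forall fun z => ?_)
    · refine AEStronglyMeasurable.mul ?_ h₁.1.norm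
      have : Continuous fun x : Sp n => (1 + ‖x‖) * ‖fderiv ℝ (polyWeight n k) x‖ :=
        (continuous_const.add continuous_norm).mul
          ((isWeight_polyWeight n k).contDiff.continuous_fderiv (by simp)).norm
      exact (this.comp continuous_snd).aestronglyMeasurable
    · rw [Real.norm_of_nonneg (by positivity)]
      exact mul_le_mul_of_nonneg_right (((isWeight_polyWeight n k).grad_le z.2).trans
        (mul_le_of_le_one_right hC (polyWeight_le_one k z.2))) (norm_nonneg _)
    · have := ((tendsto_norm_fderiv_polyWeight z.2).const_mul (1 + ‖z.2‖)).mul_const ‖b₁ z‖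
      simpa using this
  have hle : ∫ z in Ioo 0 T ×ˢ univ, v z * polyWeight n 0 z.2 ≤ 0 := by
    have hlim := hE.const_mul A
    rw [mul_zero] at hlim
    refine ge_of_tendsto' hlim fun k => le_trans ?_ (hA v _ hv hv0 hv1 (isWeight_polyWeight n k))
    exact integral_mono (hvψ 0) (hvψ k) fun z =>
      mul_le_mul_of_nonneg_left (polyWeight_zero_le k z.2) (hv0 z)
  have hpos : ∀ x, 0 < polyWeight n 0 x := (isWeight_polyWeight n 0).pos
  have hz := (integral_eq_zero_iff_of_nonneg (fun z => mul_nonneg (hv0 z) (hpos z.2).le)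
    (hvψ 0)).1 (le_antisymm hle (integral_nonneg fun z => mul_nonneg (hv0 z) (hpos z.2).le))
  filter_upwards [hz] with z hz
  exact (mul_eq_zero.1 hz).resolve_right (hpos z.2).ne'

lemma IsWeakSol.sub (hT : 0 < T) (hb : ∀ R, IntegrableOn b (Ioo 0 T ×ˢ closedBall 0 R))
    (hd : ∀ R, IntegrableOn d (Ioo 0 T ×ˢ closedBall 0 R)) {u₀ : Sp n → ℝ} {u v : SpTime n → ℝ}
    (hu : IsWeakSol T b d u₀ u) (hv : IsWeakSol T b d u₀ v) :
    IsWeakSol T b d (fun _ => 0) fun z => u z - v z := by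
  have h0 : MemLinftyLoc (fun _ : Sp n => (0 : ℝ)) univ := fun K _ _ => MemLp.zero
  have hw : MemLinftyLoc (fun z => u z - v z) (Ico 0 T ×ˢ univ) := hu.2.1.sub hv.2.1
  rw [isWeakSol_iff_past hT h0 hw hb hd]
  have h1 := (isWeakSol_iff_past hT hu.1 hu.2.1 hb hd).1 hu
  have h2 := (isWeakSol_iff_past hT hv.1 hv.2.1 hb hd).1 hv
  refine ⟨memLinftyLoc_pastExt hT h0 hw, fun φ hφ => ?_⟩
  obtain ⟨L, -, hL, -⟩ := hφ.exists_lipschitz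
  have i1 := integrable_mul_fadj h1.1 hb hd hL hφ.2.1 hφ.2.2
  have i2 := integrable_mul_fadj h2.1 hb hd hL hφ.2.1 hφ.2.2
  have e1 := h1.2 φ hφ
  have e2 := h2.2 φ hφ
  rw [hφ.adjTransport_eq] at e1 e2 ⊢
  have e3 := integral_sub i1.integrableOn (i2.integrableOn (s := Iio T ×ˢ univ))
  rw [e1, e2, sub_zero] at e3
  refine Eq.trans (integral_congr_ae (Eventually.of_forall fun z => ?_)) e3
  simp only [pastExt]
  split_ifs <;> ring

/-- Uniqueness of weak solutions for fields with the renormalization property. -/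
theorem HasRenormProp.ae_eq (hT : 0 < T) (hren : HasRenormProp T b d)
    (hb : AEStronglyMeasurable b (volume.restrict (Ioo 0 T ×ˢ (univ : Set (Sp n)))))
    (h₁ : IntegrableOn b₁ (Ioo 0 T ×ˢ univ)) (h₂ : MemMixedLp T 1 ⊤ b₂)
    (hdec : ∀ᵐ z ∂(volume.restrict (Ioo 0 T ×ˢ (univ : Set (Sp n)))),
      (1 + ‖z.2‖)⁻¹ • b z = b₁ z + b₂ z)
    (hd : MemMixedLp T 1 ⊤ d) {u₀ : Sp n → ℝ} {u v : SpTime n → ℝ}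
    (hu : IsWeakSol T b d u₀ u) (hv : IsWeakSol T b d u₀ v) :
    u =ᵐ[volume.restrict (Ioo 0 T ×ˢ (univ : Set (Sp n)))] v := by
  have hw := hu.sub hT (integrableOn_box_of_decay h₁ h₂ hdec) hd.integrableOn_box hv
  -- This `β` takes values in `[0,1)` and vanishes only at 0. It makes the merely locally bounded
  -- difference globally bounded and nonnegative without losing its zero set.
  have hβ : ContDiff ℝ 1 fun s : ℝ => s ^ 2 / (1 + s ^ 2) :=
    (contDiff_id.pow 2).div (contDiff_const.add (contDiff_id.pow 2)) fun s => by positivity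
  have h1 := hren _ _ hw _ hβ
  have h2 : (fun _ : Sp n => (0 : ℝ) ^ 2 / (1 + 0 ^ 2)) = fun _ => 0 := by simp
  rw [h2] at h1
  have h3 := h1.ae_eq_zero_of_nonneg_of_le_one hT (fun z => by positivity)
    (fun z => div_le_one_of_le₀ (by linarith) (by positivity)) hb h₁ h₂ hdec hd
  filter_upwards [h3] with z hz
  have h4 : (u z - v z) ^ 2 = 0 := by
    rcases div_eq_zero_iff.1 hz with h | h
    · exact h
    · have : 0 < 1 + (u z - v z) ^ 2 := by positivity
      exact absurd h this.ne'
  exact sub_eq_zero.1 (pow_eq_zero_iff (two_ne_zero)|>.1 h4)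

end Uniqueness

section Existence

variable {n : ℕ} {T : ℝ} {b : SpTime n → Sp n} {d : SpTime n → ℝ}

/-! ### Existence of bounded weak solutions -/

lemma IsTestFun.integrableOn_strip_fadj (hb : ∀ R, IntegrableOn b (Ioo 0 T ×ˢ closedBall 0 R))
    (hd : ∀ R, IntegrableOn d (Ioo 0 T ×ˢ closedBall 0 R)) {φ : SpTime n → ℝ}
    (hφ : IsTestFun (Iio T ×ˢ univ) φ) : IntegrableOn (fadj b d φ) (Ioo 0 T ×ˢ univ) := by
  obtain ⟨L, -, hL, -⟩ := hφ.exists_lipschitz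
  have h1 := integrable_mul_fadj (W := fun _ => 1) (fun K hK _ => by
    have : IsFiniteMeasure (volume.restrict K) := ⟨by simpa using hK.measure_lt_top⟩
    exact memLp_const 1) hb hd hL hφ.2.1 hφ.2.2
  refine h1.integrableOn.congr_fun (fun z hz => ?_) (measurableSet_Ioo.prod MeasurableSet.univ)
  have hz : ¬ z.1 < 0 := not_lt.2 hz.1.1.le
  simp [fadj, zeroExt, hz]

lemma IsTestFun.setIntegral_timeDeriv (hT : 0 < T) {φ : SpTime n → ℝ}
    (hφ : IsTestFun (Iio T ×ˢ univ) φ) :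
    ∫ z in Ioo 0 T ×ˢ univ, timeDeriv φ z = -∫ x, φ (0, x) := by
  -- For zero field and zero divergence the adjoint operator is `∂ₜ`, so integrability is a special
  -- case.
  have h1 : timeDeriv φ = fadj 0 0 φ := by
    rw [← hφ.adjTransport_eq]
    funext z
    simp [adjTransport]
  have h2 : IntegrableOn (timeDeriv φ) (Ioo 0 T ×ˢ univ) := by
    rw [h1]
    exact hφ.integrableOn_strip_fadj (fun R => integrableOn_zero) fun R => integrableOn_zero
  rw [IntegrableOn, volume_restrict_prod_univ] at h2
  rw [volume_restrict_prod_univ, integral_prod_symm _ h2, ← integral_neg]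
  refine integral_congr_ae (Eventually.of_forall fun x => ?_)
  have hx : ContDiff ℝ ∞ fun s : ℝ => φ (s, x) :=
    hφ.1.comp (by fun_prop : ContDiff ℝ ∞ fun s : ℝ => (s, x))
  have hTx : φ (T, x) = 0 := image_eq_zero_of_notMem_tsupport fun h => lt_irrefl T (hφ.2.2 h).1
  simp only [timeDeriv]
  rw [← integral_Ioc_eq_integral_Ioo, ← intervalIntegral.integral_of_le hT.le,
    intervalIntegral.integral_deriv_eq_sub' (fun s => φ (s, x)) rfl
      (fun s _ => (hx.differentiable (by simp)) s) (hx.continuous_deriv (by simp)).continuousOn,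
    hTx, zero_sub]

lemma spaceGrad_time_mul {φ : SpTime n → ℝ} (hφ : Differentiable ℝ φ) (θ : ℝ → ℝ) (z : SpTime n) :
    spaceGrad (fun z => θ z.1 * φ z) z = θ z.1 • spaceGrad φ z := by
  have h : DifferentiableAt ℝ (fun y : Sp n => φ (z.1, y)) z.2 :=
    (hφ _).comp z.2 (by fun_prop : DifferentiableAt ℝ (fun y : Sp n => (z.1, y)) z.2)
  simp only [spaceGrad, gradient]
  rw [fderiv_const_mul h, map_smul]

/-- The divergence equation against test functions which need not vanish at `t = 0`. -/
lemma IsWeakDiv.setIntegral_eq_zero (hdiv : IsWeakDiv T b d)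
    (hb : ∀ R, IntegrableOn b (Ioo 0 T ×ˢ closedBall 0 R))
    (hd : ∀ R, IntegrableOn d (Ioo 0 T ×ˢ closedBall 0 R)) {φ : SpTime n → ℝ}
    (hφ : IsTestFun (Iio T ×ˢ univ) φ) :
    IntegrableOn (fun z => inner ℝ (b z) (spaceGrad φ z) + d z * φ z) (Ioo 0 T ×ˢ univ) ∧
    ∫ z in Ioo 0 T ×ˢ univ, (inner ℝ (b z) (spaceGrad φ z) + d z * φ z) = 0 := by
  have hz : ∀ R, IntegrableOn (0 : SpTime n → Sp n) (Ioo 0 T ×ˢ closedBall 0 R) :=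
    fun R => integrableOn_zero
  have hz' : ∀ R, IntegrableOn (0 : SpTime n → ℝ) (Ioo 0 T ×ˢ closedBall 0 R) :=
    fun R => integrableOn_zero
  -- This is `∂ₜφ`; subtracting it isolates `b·∇φ` and `d φ` one at a time.
  have i0 := hφ.integrableOn_strip_fadj hz hz'
  have i1 : IntegrableOn (fun z => inner ℝ (b z) (spaceGrad φ z)) (Ioo 0 T ×ˢ univ) := by
    refine ((hφ.integrableOn_strip_fadj hb hz').sub i0).congr (Eventually.of_forall fun z => ?_)
    rw [← hφ.adjTransport_eq, ← hφ.adjTransport_eq]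
    simp [adjTransport]
  have i2 : IntegrableOn (fun z => d z * φ z) (Ioo 0 T ×ˢ univ) := by
    refine ((hφ.integrableOn_strip_fadj hz hd).sub i0).congr (Eventually.of_forall fun z => ?_)
    rw [← hφ.adjTransport_eq, ← hφ.adjTransport_eq]
    simp [adjTransport]
  have i3 : IntegrableOn (fun z => inner ℝ (b z) (spaceGrad φ z) + d z * φ z) (Ioo 0 T ×ˢ univ) :=
    i1.add i2
  refine ⟨i3, ?_⟩
  -- The divergence equation contains no time derivative, so a cutoff near `t = 0` passes through it
  -- as a factor and can be removed by dominated convergence.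
  set θ : ℕ → ℝ → ℝ := fun k t => Real.smoothTransition ((k + 1) * t - 1) with hθ
  have hθc : ∀ k, ContDiff ℝ ∞ (θ k) := fun k =>
    Real.smoothTransition.contDiff.comp ((contDiff_const.mul contDiff_id).sub contDiff_const)
  have hθb : ∀ k t, ‖θ k t‖ ≤ 1 := fun k t => by
    rw [Real.norm_of_nonneg (Real.smoothTransition.nonneg _)]
    exact Real.smoothTransition.le_one _
  have hθm : ∀ k, AEStronglyMeasurable (fun z : SpTime n => θ k z.1)
      (volume.restrict (Ioo 0 T ×ˢ univ)) := fun k =>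
    ((hθc k).continuous.comp continuous_fst).aestronglyMeasurable
  have htest : ∀ k, IsTestFun (Ioo 0 T ×ˢ univ) fun z => θ k z.1 * φ z := fun k => by
    refine ⟨((hθc k).comp contDiff_fst).mul hφ.1, hφ.2.1.mul_left, ?_⟩
    have h1 : tsupport (fun z : SpTime n => θ k z.1 * φ z) ⊆
        tsupport φ ∩ {z | 0 ≤ (k + 1) * z.1 - 1} := by
      refine closure_minimal (fun z hz => ⟨subset_tsupport _ (right_ne_zero_of_mul hz), ?_⟩)
        ((isClosed_tsupport _).inter (isClosed_le continuous_const (by fun_prop)))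
      by_contra h
      exact left_ne_zero_of_mul hz (Real.smoothTransition.zero_of_nonpos (not_le.1 h).le)
    intro z hz
    obtain ⟨hz1, hz2⟩ := h1 hz
    have hz2 : 0 ≤ ((k : ℝ) + 1) * z.1 - 1 := hz2
    refine ⟨⟨?_, (hφ.2.2 hz1).1⟩, mem_univ _⟩
    by_contra h
    have : ((k : ℝ) + 1) * z.1 ≤ 0 :=
      mul_nonpos_of_nonneg_of_nonpos (by positivity) (not_lt.1 h)
    linarith
  have hk : ∀ k, ∫ z in Ioo 0 T ×ˢ univ,
      θ k z.1 * (inner ℝ (b z) (spaceGrad φ z) + d z * φ z) = 0 := fun k => by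
    have h1 := hdiv.2 _ (htest k)
    have j1 : IntegrableOn (fun z => θ k z.1 * inner ℝ (b z) (spaceGrad φ z)) (Ioo 0 T ×ˢ univ) :=
      Integrable.bdd_mul i1 (hθm k) (Eventually.of_forall fun z => hθb k _)
    have j2 : IntegrableOn (fun z => θ k z.1 * (d z * φ z)) (Ioo 0 T ×ˢ univ) :=
      Integrable.bdd_mul i2 (hθm k) (Eventually.of_forall fun z => hθb k _)
    have h2 := integral_add j1 j2
    have h3 : ∫ z in Ioo 0 T ×ˢ univ, θ k z.1 * inner ℝ (b z) (spaceGrad φ z) =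
        ∫ z in Ioo 0 T ×ˢ univ, inner ℝ (b z) (spaceGrad (fun z => θ k z.1 * φ z) z) :=
      integral_congr_ae (Eventually.of_forall fun z => by
        simp only [spaceGrad_time_mul (hφ.1.differentiable (by simp)), inner_smul_right])
    have h4 : ∫ z in Ioo 0 T ×ˢ univ, θ k z.1 * (d z * φ z) =
        ∫ z in Ioo 0 T ×ˢ univ, d z * (θ k z.1 * φ z) :=
      integral_congr_ae (Eventually.of_forall fun z => by simp only; ring)
    simp only [mul_add]
    linarith
  have hlim := tendsto_integral_of_dominated_convergence
    (μ := volume.restrict (Ioo 0 T ×ˢ (univ : Set (Sp n))))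
    (F := fun k z => θ k z.1 * (inner ℝ (b z) (spaceGrad φ z) + d z * φ z))
    (f := fun z => inner ℝ (b z) (spaceGrad φ z) + d z * φ z) _
    (fun k => (hθm k).mul i3.1) i3.norm (fun k => Eventually.of_forall fun z => by
      rw [norm_mul]
      exact mul_le_of_le_one_left (norm_nonneg _) (hθb k _)) (by
      filter_upwards [ae_restrict_mem (measurableSet_Ioo.prod MeasurableSet.univ)] with z hz
      refine tendsto_const_nhds.congr' ?_
      filter_upwards [eventually_ge_atTop ⌈2 / z.1⌉₊] with k hk
      have h1 : 2 / z.1 ≤ k := (Nat.le_ceil _).trans (by exact_mod_cast hk)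
      rw [div_le_iff₀ hz.1.1] at h1
      have h2 : θ k z.1 = 1 := Real.smoothTransition.one_of_one_le (by linarith [hz.1.1])
      rw [h2, one_mul])
  exact tendsto_nhds_unique hlim (tendsto_const_nhds.congr fun k => (hk k).symm)

/-- Constants are weak solutions. -/
lemma IsWeakDiv.integral_add_setIntegral_fadj (hT : 0 < T) (hdiv : IsWeakDiv T b d)
    (hb : ∀ R, IntegrableOn b (Ioo 0 T ×ˢ closedBall 0 R))
    (hd : ∀ R, IntegrableOn d (Ioo 0 T ×ˢ closedBall 0 R)) {φ : SpTime n → ℝ}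
    (hφ : IsTestFun (Iio T ×ˢ univ) φ) :
    (∫ x, φ (0, x)) + ∫ z in Ioo 0 T ×ˢ univ, fadj b d φ z = 0 := by
  obtain ⟨i1, h1⟩ := hdiv.setIntegral_eq_zero hb hd hφ
  have i2 := hφ.integrableOn_strip_fadj hb hd
  have h2 := integral_sub i2 i1
  have h3 : ∫ z in Ioo 0 T ×ˢ univ,
      (fadj b d φ z - (inner ℝ (b z) (spaceGrad φ z) + d z * φ z)) =
      ∫ z in Ioo 0 T ×ˢ univ, timeDeriv φ z :=
    integral_congr_ae (Eventually.of_forall fun z => by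
      simp only [← hφ.adjTransport_eq, adjTransport]
      ring)
  have h4 := hφ.setIntegral_timeDeriv hT
  linarith

lemma hasDerivAt_sqrt_sq_add {ε : ℝ} (hε : 0 < ε) (s : ℝ) :
    HasDerivAt (fun s => √(s ^ 2 + ε ^ 2) - ε) (s / √(s ^ 2 + ε ^ 2)) s := by
  have h0 : 0 < s ^ 2 + ε ^ 2 := by positivity
  have h1 : HasDerivAt (fun s : ℝ => s ^ 2 + ε ^ 2) (2 * s) s := by
    simpa using (hasDerivAt_pow 2 s).add_const (ε ^ 2)
  have h2 := (h1.sqrt h0.ne').sub_const ε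
  rwa [mul_div_mul_left _ _ two_ne_zero] at h2

/-- The `L¹` estimate for the backward equation with source. -/
theorem IsWeakDiv.integral_abs_le (hT : 0 < T) (hdiv : IsWeakDiv T b d)
    (hb : ∀ R, IntegrableOn b (Ioo 0 T ×ˢ closedBall 0 R))
    (hd : ∀ R, IntegrableOn d (Ioo 0 T ×ˢ closedBall 0 R)) {φ : SpTime n → ℝ}
    (hφ : IsTestFun (Iio T ×ˢ univ) φ) :
    ∫ x, |φ (0, x)| ≤ ∫ z in Ioo 0 T ×ˢ univ, ‖fadj b d φ z‖ := by
  obtain ⟨R, hR⟩ := hφ.2.1.isCompact.isBounded.subset_closedBall 0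
  have hsupp : ∀ z : SpTime n, z.2 ∉ closedBall (0 : Sp n) R → z ∉ tsupport φ := fun z hz h => by
    have := hR h
    rw [mem_closedBall_zero_iff, Prod.norm_def] at this
    exact hz (mem_closedBall_zero_iff.2 ((le_max_right _ _).trans this))
  have i1 := hφ.integrableOn_strip_fadj hb hd
  -- The first term collects the error of the chain rule and the second the loss `|s| - β s ≤ ε` at
  -- time 0.
  set E : ℝ := (∫ z in Ioo 0 T ×ˢ closedBall 0 R, ‖d z‖) + volume.real (closedBall (0 : Sp n) R)
    with hE
  have hE0 : 0 ≤ E := add_nonneg (integral_nonneg fun _ => norm_nonneg _) measureReal_nonneg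
  have key : ∀ ε > 0, ∫ x, |φ (0, x)| ≤ (∫ z in Ioo 0 T ×ˢ univ, ‖fadj b d φ z‖) + ε * E := by
    intro ε hε
    -- A smooth version of `|s|` that vanishes at 0, so `β(φ)` is again a test function. By the
    -- chain rule the adjoint operator sends it to `β'(φ)` times that of `φ`, plus `d (β(φ) - β'(φ)
    -- φ)`, where `|β'| ≤ 1` and the bracket is at most `ε` in absolute value.
    set β : ℝ → ℝ := fun s => √(s ^ 2 + ε ^ 2) - ε with hβ
    have hpos : ∀ s : ℝ, 0 < s ^ 2 + ε ^ 2 := fun s => by positivity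
    have hβ0 : β 0 = 0 := by simp [hβ, Real.sqrt_sq hε.le]
    have hβc : ContDiff ℝ ∞ β :=
      (((contDiff_id.pow 2).add contDiff_const).sqrt fun s => (hpos s).ne').sub contDiff_const
    have hsq : ∀ s : ℝ, |s| ≤ √(s ^ 2 + ε ^ 2) := fun s =>
      Real.abs_le_sqrt (by linarith [sq_nonneg ε])
    have hsε : ∀ s : ℝ, ε ≤ √(s ^ 2 + ε ^ 2) := fun s =>
      Real.le_sqrt_of_sq_le (by linarith [sq_nonneg s])
    have hβφ : IsTestFun (Iio T ×ˢ univ) fun z => β (φ z) :=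
      ⟨hβc.comp hφ.1, hφ.2.1.comp_left hβ0, (tsupport_comp_subset hβ0 φ).trans hφ.2.2⟩
    have h1 := hdiv.integral_add_setIntegral_fadj hT hb hd hβφ
    have hdec : ∀ z, fadj b d (fun z => β (φ z)) z =
        φ z / √(φ z ^ 2 + ε ^ 2) * fadj b d φ z +
          d z * (β (φ z) - φ z / √(φ z ^ 2 + ε ^ 2) * φ z) := fun z => by
      have h2 := (hasDerivAt_sqrt_sq_add hε (φ z)).comp_hasFDerivAt z
        ((hφ.1.differentiable (by simp)) z).hasFDerivAt
      have h3 : fderiv ℝ (fun z => β (φ z)) z = _ := h2.fderiv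
      simp only [fadj, h3, smul_apply, smul_eq_mul]
      ring
    have hle1 : ∀ s : ℝ, |s / √(s ^ 2 + ε ^ 2)| ≤ 1 := fun s => by
      rw [abs_div, abs_of_nonneg (Real.sqrt_nonneg _)]
      exact div_le_one_of_le₀ (hsq s) (Real.sqrt_nonneg _)
    have hle2 : ∀ s : ℝ, |β s - s / √(s ^ 2 + ε ^ 2) * s| ≤ ε := fun s => by
      have hr : 0 < √(s ^ 2 + ε ^ 2) := Real.sqrt_pos.2 (hpos s)
      have h2 : β s - s / √(s ^ 2 + ε ^ 2) * s = ε * (ε / √(s ^ 2 + ε ^ 2) - 1) := by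
        have h3 := Real.sq_sqrt (hpos s).le
        simp only [hβ]
        field_simp
        nlinarith
      have h4 : ε / √(s ^ 2 + ε ^ 2) ≤ 1 := div_le_one_of_le₀ (hsε s) hr.le
      have h5 : 0 ≤ ε / √(s ^ 2 + ε ^ 2) := by positivity
      rw [h2, abs_mul, abs_of_pos hε]
      exact mul_le_of_le_one_right hε.le (abs_le.2 ⟨by linarith, by linarith⟩)
    have i2 : IntegrableOn ((Ioo (0 : ℝ) T ×ˢ closedBall (0 : Sp n) R).indicator fun z => ‖d z‖)
        (Ioo 0 T ×ˢ univ) :=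
      ((integrable_indicator_iff (measurableSet_box _ measurableSet_Ioo R)).2
        (hd R).norm).integrableOn
    have h6 : ‖∫ z in Ioo 0 T ×ˢ univ, fadj b d (fun z => β (φ z)) z‖ ≤
        ∫ z in Ioo 0 T ×ˢ univ, (‖fadj b d φ z‖ +
          ε * (Ioo (0 : ℝ) T ×ˢ closedBall (0 : Sp n) R).indicator (fun z => ‖d z‖) z) := by
      refine norm_integral_le_of_norm_le (i1.norm.add (i2.const_mul ε)) ?_
      filter_upwards [ae_restrict_mem (measurableSet_Ioo.prod MeasurableSet.univ)] with z hz
      by_cases hzR : z.2 ∈ closedBall (0 : Sp n) R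
      · have hzm : z ∈ Ioo (0 : ℝ) T ×ˢ closedBall (0 : Sp n) R := ⟨hz.1, hzR⟩
        rw [indicator_of_mem hzm, hdec]
        refine (norm_add_le _ _).trans (add_le_add ?_ ?_)
        · rw [norm_mul]
          exact mul_le_of_le_one_left (norm_nonneg _) (hle1 _)
        · rw [norm_mul, mul_comm]
          exact mul_le_mul_of_nonneg_right (hle2 _) (norm_nonneg _)
      · have h7 : fadj b d (fun z => β (φ z)) z = 0 :=
          fadj_eq_zero_of_notMem_tsupport fun h =>
            hsupp z hzR (tsupport_comp_subset hβ0 φ h)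
        rw [h7, norm_zero]
        have : 0 ≤ (Ioo (0 : ℝ) T ×ˢ closedBall (0 : Sp n) R).indicator (fun z => ‖d z‖) z :=
          indicator_nonneg (fun _ _ => norm_nonneg _) _
        positivity
    have h8 : ∫ z in Ioo 0 T ×ˢ univ, (‖fadj b d φ z‖ +
          ε * (Ioo (0 : ℝ) T ×ˢ closedBall (0 : Sp n) R).indicator (fun z => ‖d z‖) z) =
        (∫ z in Ioo 0 T ×ˢ univ, ‖fadj b d φ z‖) +
          ε * ∫ z in Ioo 0 T ×ˢ closedBall 0 R, ‖d z‖ := by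
      have h9 := integral_add i1.norm (i2.const_mul ε)
      rw [integral_const_mul, setIntegral_indicator (measurableSet_box _ measurableSet_Ioo R),
        prod_inter_prod, inter_self, univ_inter] at h9
      exact h9
    have hc0 : Continuous fun x : Sp n => φ (0, x) := hφ.1.continuous.comp (by fun_prop)
    have hcs0 : ∀ {f : SpTime n → ℝ}, Continuous f → (∀ z : SpTime n, z ∉ tsupport φ → f z = 0) →
        Integrable fun x : Sp n => f (0, x) := fun hf h0 =>
      (hf.comp (by fun_prop : Continuous fun x : Sp n => ((0 : ℝ), x))).integrable_of_hasCompactSupport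
        (HasCompactSupport.intro (isCompact_closedBall (0 : Sp n) R) fun x hx =>
          h0 _ (hsupp (0, x) hx))
    have i3 : Integrable fun x : Sp n => |φ (0, x)| :=
      hcs0 (f := fun z => |φ z|) hφ.1.continuous.abs fun z hz => by
        simp [image_eq_zero_of_notMem_tsupport hz]
    have i4 : Integrable fun x : Sp n => β (φ (0, x)) :=
      hcs0 (f := fun z => β (φ z)) hβφ.1.continuous fun z hz => by
        simp [image_eq_zero_of_notMem_tsupport hz, hβ0]
    have i5 : Integrable ((closedBall (0 : Sp n) R).indicator fun _ => ε) :=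
      (integrable_indicator_iff measurableSet_closedBall).2
        (integrableOn_const measure_closedBall_lt_top.ne)
    have h10 : ∫ x, |φ (0, x)| ≤
        ∫ x, (β (φ (0, x)) + (closedBall (0 : Sp n) R).indicator (fun _ => ε) x) := by
      refine integral_mono i3 (i4.add i5) fun x => ?_
      by_cases hx : x ∈ closedBall (0 : Sp n) R
      · simp only [indicator_of_mem hx, hβ]
        linarith [hsq (φ (0, x))]
      · simp [indicator_of_notMem hx, image_eq_zero_of_notMem_tsupport (hsupp (0, x) hx), hβ0]
    have h11 := integral_add i4 i5
    rw [integral_indicator measurableSet_closedBall, setIntegral_const, smul_eq_mul] at h11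
    rw [h8] at h6
    have h12 := (abs_le.1 h6).1
    have h13 : ∫ x, |φ (0, x)| ≤ (∫ x, β (φ (0, x))) + volume.real (closedBall (0 : Sp n) R) * ε :=
      h10.trans_eq h11
    rw [hE, mul_add]
    linarith
  refine le_of_forall_pos_le_add fun δ hδ => (key (δ / (E + 1)) (by positivity)).trans ?_
  gcongr
  rw [div_mul_eq_mul_div, div_le_iff₀ (by positivity)]
  gcongr
  linarith

/-- The test functions supported in `U`. -/
def testFunSubmodule (U : Set (SpTime n)) : Submodule ℝ (SpTime n → ℝ) where
  carrier := {φ | IsTestFun U φ}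
  zero_mem' := ⟨contDiff_const, HasCompactSupport.zero, by simp [tsupport]⟩
  add_mem' := fun {φ ψ} hφ hψ => ⟨hφ.1.add hψ.1, hφ.2.1.add hψ.2.1,
    (tsupport_add φ ψ).trans (union_subset hφ.2.2 hψ.2.2)⟩
  smul_mem' := fun c φ hφ => ⟨hφ.1.const_smul c, hφ.2.1.smul_left (f := fun _ => c),
    (tsupport_smul_subset_right (fun _ => c) φ).trans hφ.2.2⟩

/-- Existence of bounded weak solutions. -/
theorem IsWeakDiv.exists_isWeakSol (hT : 0 < T) (hdiv : IsWeakDiv T b d)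
    (hb : ∀ R, IntegrableOn b (Ioo 0 T ×ˢ closedBall 0 R))
    (hd : ∀ R, IntegrableOn d (Ioo 0 T ×ˢ closedBall 0 R)) {u₀ : Sp n → ℝ}
    (hu₀ : MemLp u₀ ⊤ volume) :
    ∃ u : SpTime n → ℝ, MemLp u ⊤ (volume.restrict (Ioo 0 T ×ˢ (univ : Set (Sp n)))) ∧
      IsWeakSol T b d u₀ u := by
  obtain ⟨hu₀m, M, hM0, hM⟩ := memLp_top_iff_exists_bound.1 hu₀
  let V := testFunSubmodule (Iio T ×ˢ (univ : Set (Sp n)))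
  have hV : ∀ φ : V, IsTestFun (Iio T ×ˢ univ) (φ : SpTime n → ℝ) := fun φ => φ.2
  have hdiff : ∀ φ : V, Differentiable ℝ (φ : SpTime n → ℝ) := fun φ =>
    (hV φ).1.differentiable (by simp)
  have hint : ∀ φ : V, Integrable fun x : Sp n => (φ : SpTime n → ℝ) (0, x) := fun φ => by
    have hc : Topology.IsClosedEmbedding fun x : Sp n => ((0 : ℝ), x) :=
      (Isometry.of_dist_eq fun s t => by simp [Prod.dist_eq]).isClosedEmbedding
    exact ((hV φ).1.continuous.comp hc.continuous).integrable_of_hasCompactSupport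
      ((hV φ).2.1.comp_isClosedEmbedding hc)
  have hint' : ∀ φ : V, Integrable fun x : Sp n => u₀ x * (φ : SpTime n → ℝ) (0, x) := fun φ =>
    (hint φ).bdd_mul hu₀m hM
  let A : V →ₗ[ℝ] SpTime n → ℝ :=
    { toFun := fun φ => fadj b d φ
      map_add' := fun φ ψ => by
        funext z
        have h := fderiv_add (hdiff φ z) (hdiff ψ z)
        simp only [fadj, Submodule.coe_add, Pi.add_apply, h, add_apply]
        ring
      map_smul' := fun c φ => by
        funext z
        have h := fderiv_const_smul (hdiff φ z) c
        simp only [fadj, Submodule.coe_smul, Pi.smul_apply, h, smul_apply, RingHom.id_apply,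
          smul_eq_mul]
        ring }
  let ℓ : V →ₗ[ℝ] ℝ :=
    { toFun := fun φ => -∫ x, u₀ x * (φ : SpTime n → ℝ) (0, x)
      map_add' := fun φ ψ => by
        rw [← neg_add]
        have h := integral_add (hint' φ) (hint' ψ)
        rw [← h]
        simp only [Submodule.coe_add, Pi.add_apply, mul_add]
      map_smul' := fun c φ => by
        rw [RingHom.id_apply, smul_eq_mul, mul_neg, ← integral_const_mul]
        simp only [Submodule.coe_smul, Pi.smul_apply, smul_eq_mul, mul_left_comm] }
  -- The weak formulation reads `∫ v (A φ) = ℓ φ`, and the `L¹` estimate is the bound that duality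
  -- requires. The solution inherits the bound `M` of `u₀`.
  obtain ⟨v, hv, hvM, hvA⟩ := exists_bounded_of_abs_le_integral_norm
    (μ := volume.restrict (Ioo 0 T ×ˢ (univ : Set (Sp n)))) A
    (fun φ => (hV φ).integrableOn_strip_fadj hb hd) ℓ hM0 fun φ => by
      have h1 : |ℓ φ| ≤ ∫ x, M * |(φ : SpTime n → ℝ) (0, x)| := by
        change |-∫ x, u₀ x * (φ : SpTime n → ℝ) (0, x)| ≤ _
        rw [abs_neg, ← Real.norm_eq_abs]
        refine norm_integral_le_of_norm_le ((hint φ).norm.const_mul M) ?_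
        filter_upwards [hM] with x hx
        rw [norm_mul]
        exact mul_le_mul_of_nonneg_right hx (norm_nonneg _)
      rw [integral_const_mul] at h1
      exact h1.trans (mul_le_mul_of_nonneg_left (hdiv.integral_abs_le hT hb hd (hV φ)) hM0)
  have hvtop : MemLp v ⊤ (volume.restrict (Ioo 0 T ×ˢ (univ : Set (Sp n)))) :=
    memLp_top_of_bound hv M hvM
  -- Local boundedness is required up to the time 0, but that slice is null.
  have hae : (Ico 0 T ×ˢ (univ : Set (Sp n)) : Set (SpTime n)) =ᵐ[volume] Ioo 0 T ×ˢ univ := by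
    filter_upwards [ae_fst_ne_zero (n := n)] with z hz
    exact propext ⟨fun h => ⟨⟨lt_of_le_of_ne h.1.1 (Ne.symm hz), h.1.2⟩, h.2⟩,
      fun h => ⟨⟨h.1.1.le, h.1.2⟩, h.2⟩⟩
  refine ⟨v, hvtop, fun K _ _ => hu₀.restrict K, fun K _ hK => ?_, fun φ hφ => ?_⟩
  · refine MemLp.mono_measure (Measure.restrict_mono hK le_rfl) ?_
    rwa [Measure.restrict_congr_set hae]
  · have h1 : ∫ z in Ioo 0 T ×ˢ univ, v z * fadj b d φ z = -∫ x, u₀ x * φ (0, x) := hvA ⟨φ, hφ⟩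
    rw [hφ.adjTransport_eq, h1, add_neg_cancel]

end Existence

/-! ### Assembly of the three conclusions -/

theorem theorem2p1 (n : ℕ) (T : ℝ) (hT : 0 < T)
    (S : Set (SpTime n)) (hS : IsCompact S) (hST : S ⊆ Icc 0 T ×ˢ univ)
    (b : SpTime n → Sp n) (divb : SpTime n → ℝ)
    -- `b ∈ L¹_loc((0,T) × ℝⁿ)`
    (hb : LocallyIntegrableOn b (Ioo 0 T ×ˢ univ))
    -- `div b ∈ L¹(0,T; L^∞(ℝⁿ))`
    (hdiv : IsWeakDiv T b divb)
    (hdiv_bdd : MemMixedLp T 1 ⊤ divb)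
    -- `b / (1 + |x|) ∈ L¹((0,T) × ℝⁿ) + L¹(0,T; L^∞(ℝⁿ))`
    (hdecay : ∃ b₁ b₂ : SpTime n → Sp n,
      IntegrableOn b₁ (Ioo 0 T ×ˢ univ) ∧ MemMixedLp T 1 ⊤ b₂ ∧
      ∀ᵐ z ∂(volume.restrict (Ioo 0 T ×ˢ (univ : Set (Sp n)))),
        (1 + ‖z.2‖)⁻¹ • b z = b₁ z + b₂ z)
    -- local renormalization property off `S`
    (hren : ∀ Ω : Set (SpTime n), IsOpen Ω → IsCompact (closure Ω) →
      closure Ω ⊆ (Iio T ×ˢ univ) \ S →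
      HasLocRenormProp T (zeroExt b) (zeroExt divb) Ω)
    -- integrability of `b·∇d_S` and `d_S⁻¹` with conjugate exponents
    (hdist : ∃ p q p' q' : ℝ≥0∞, 1 ≤ p ∧ 1 ≤ q ∧ p⁻¹ + p'⁻¹ = 1 ∧ q⁻¹ + q'⁻¹ = 1 ∧
      MemMixedLpLoc T p q (fun z => inner ℝ (b z) (spaceGrad (distTo S) z)) ∧
      MemMixedLpLoc T p' q' (fun z => (eDistTo S z)⁻¹)) :
    HasRenormProp T b divb ∧
    (∀ (u₀ : Sp n → ℝ) (u v : SpTime n → ℝ),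
      IsWeakSol T b divb u₀ u → IsWeakSol T b divb u₀ v →
      u =ᵐ[volume.restrict (Ioo 0 T ×ˢ (univ : Set (Sp n)))] v) ∧
    (∀ u₀ : Sp n → ℝ, MemLp u₀ ⊤ volume →
      ∃ u : SpTime n → ℝ, MemLp u ⊤ (volume.restrict (Ioo 0 T ×ˢ (univ : Set (Sp n)))) ∧
        IsWeakSol T b divb u₀ u) := by
  obtain ⟨b₁, b₂, h₁, h₂, hdec⟩ := hdecay
  have hbox := integrableOn_box_of_decay h₁ h₂ hdec
  have hdbox := hdiv_bdd.integrableOn_box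
  obtain ⟨p, q, p', q', hp, hq, hpp, hqq, hbd, hinv⟩ := hdist
  have hrenorm : HasRenormProp T b divb :=
    hasRenormProp_of_locRenormProp hT hS.isClosed hbox hdbox
      (fun A R => lintegral_inv_eDistTo_lt_top hT hST hp hq hpp hqq hinv A
        (isCompact_closedBall 0 R))
      (fun R => hbd.lintegral_mul_lt_top hp hq hpp hqq hinv (isCompact_closedBall 0 R)) hren
  exact ⟨hrenorm, fun u₀ u v hu hv => hrenorm.ae_eq hT hb.aestronglyMeasurable h₁ h₂ hdec
    hdiv_bdd hu hv, fun u₀ hu₀ => hdiv.exists_isWeakSol hT hbox hdbox hu₀⟩
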